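/- **Proposition (On the topology of the hypersurface).** Let $n>d\ge 2$ and let $x_1,\dots,x_n\in\mathbb{R}^d$ be distinct data points. For every $i$ let $x_{i,1},\dots,x_{i,d}$ be $d$ nearest neighbours of $x_i$ among the other data points. Fix $0<\delta\le\varepsilon<1$, let $S_i$ be a $(d-1)$-sphere, with radius $R_i$, through $x_i$ and the moved neighbours $(1-\varepsilon)x_i+\varepsilon x_{i,j}$, $1\le j\le d$, and let $$S_i'=\{x\in S_i : \|x-x_i\|\le\delta\},\qquad \delta<2R_i,$$ be the *hyper-cap* at $x_i$. The hyper-caps are assumed pairwise disjoint. The *rim* of $S_i'$ is the round $(d-2)$-sphere $\{x\in S_i:\|x-x_i\|=\delta\}$. Write $u_i$ for the unit outward normal of $S_i$ at $x_i$, and $m_i,\rho_i$ for the centre and the radius of the rim. A *foot* on the rim is a set $\{p : \langle h,p-m_i\rangle\ge\kappa\rho_i\}$ of rim points with $\|h\|=1$, $h\perp u_i$, $0\le\kappa<1$ (exactly one closed half of the rim if $\kappa=0$). Two feet of one cap are *opposite* if their vectors $h$ are negatives of each other. A *link* from $S_i'$ to $S_j'$ is a foot $F$ on the rim of $S_i'$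 together with a linear isometry $A$ of $\mathbb{R}^d$ with $Au_i=u_j$. It induces the similarity $\varphi(p)=m_j+\frac{\rho_j}{\rho_i}A(p-m_i)$ between the rims, which takes $F$ to a foot on the rim of $S_j'$. The *partial hyper-cylinder* of the link is the union of the segments $[p,\varphi(p)]$, $p\in F$ (half of a tilted hyper-cylinder if $\kappa=0$). A *hyper-strip* along the link is the image of a continuous injective map $\sigma$ on $F\times[0,1]$ with $\sigma(p,0)=p$ and $\sigma(p,1)=\varphi(p)$. Let $\mathcal{E}$ be a set of pairs of indices, each unordered pair of distinct indices occurring at most once, whose graph on $\{1,\dots,n\}$ is connected; two distinct indices $i_a,i_b$ (the boundary hyper-caps) have degree $1$ in it, all others have degree $2$. For $(i,j)\in\mathcal{E}$ let $c_{i,j}$ be a partial hyper-cylinder from $S_i'$ to $S_j'$. All connectors (the partial hyper-cylinders and the hyper-strips below) do not intersect themselves (for a partial hyper-cylinder: $(p,t)\mapsto(1-t)p+t\varphi(p)$ is injective on $F\times[0,1]$). Each connector meets the hyper-caps exactly in its feet. Different connectors meet at most on the hyper-caps. Different connectors at the same cap have opposite feet there. * **First approach.** The boundary hyper-caps are joined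 to each other by a hyper-strip $s_{i_a,i_b}$ from $S_{i_a}'$ to $S_{i_b}'$, and the connectors are untwisted: one can choose sides (signs) $s_1,\dots,s_n\in\{1,-1\}$ of the hyper-caps such that $s_is_j\det A=-1$ for every link (from $S_i'$ to $S_j'$, with isometry $A$) in the construction, including that of the hyper-strip. That is, the orientations of the caps given by the normals $s_iu_i$ extend over all connectors. Let $$\mathcal{W}=\bigcup_i S_i'\cup\bigcup_{(i,j)\in\mathcal{E}}c_{i,j}\cup s_{i_a,i_b}.$$ * **Second approach.** The boundary hyper-caps are joined to two points at infinity in opposite directions $v$ and $-v$, $\|v\|=1$, by two disjoint hyper-strips $s_{i_a}$ and $s_{i_b}$, each the image of a continuous injective map $\sigma$ on $F\times[0,\infty)$, where $F$ is a foot on the boundary cap and $\sigma(p,0)=p$, such that $\langle v,\sigma(p,t)\rangle\to+\infty$ (respectively $\langle -v,\sigma(p,t)\rangle\to+\infty$) as $t\to\infty$, uniformly in $p\in F$. Let $$\mathcal{W}=\bigcup_i S_i'\cup\bigcup_{(i,j)\in\mathcal{E}}c_{i,j}\cup s_{i_a}\cup s_{i_b}.$$ Then in the first approach $\mathcal{W}$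 is homeomorphic to the orientable hyper-strip loop $B^{d-2}\times S^1$, where $B^{d-2}$ is the closed unit ball of $\mathbb{R}^{d-2}$. In the second approach $\mathcal{W}$ is homeomorphic to the unbounded orientable hyper-strip $B^{d-2}\times\mathbb{R}$, and $\mathcal{W}$ is an unbounded subset of $\mathbb{R}^d$. -/

import Mathlib

open Set Filter Topology

noncomputable section

/-- The Euclidean space `ℝ^d`. -/
abbrev Euc (d : ℕ) : Type := EuclideanSpace ℝ (Fin d)

/-- `nbr i` lists `d` nearest neighbours of the `i`-th data point: `d` distinct other points, none of
them farther from `x i` than any other data point that is not listed. -/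
def IsNearestNeighbors {d n : ℕ} (x : Fin n → Euc d) (nbr : Fin n → Fin d → Fin n) : Prop :=
  ∀ i, Function.Injective (nbr i) ∧ (∀ j, nbr i j ≠ i) ∧
    ∀ j k, k ≠ i → k ∉ range (nbr i) → dist (x i) (x (nbr i j)) ≤ dist (x i) (x k)

/-- A hyper-cap: the points at distance at most `size` from the point `apex` of a hypersphere. The
bound `size < 2 * radius` says that the cap is not the whole hypersphere. -/
structure HyperCap (d : ℕ) where
  sphere : EuclideanGeometry.Sphere (Euc d)
  apex : Euc d
  size : ℝ
  apex_mem : apex ∈ sphere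
  size_pos : 0 < size
  size_lt : size < 2 * sphere.radius

namespace HyperCap

variable {d : ℕ}

/-- The cap as a set of points. -/
def carrier (C : HyperCap d) : Set (Euc d) := {p | p ∈ C.sphere ∧ dist p C.apex ≤ C.size}

/-- The boundary `(d-2)`-sphere of the cap. -/
def rim (C : HyperCap d) : Set (Euc d) := {p | p ∈ C.sphere ∧ dist p C.apex = C.size}

/-- The outward unit normal of the hypersphere at the apex. -/
def normal (C : HyperCap d) : Euc d := C.sphere.radius⁻¹ • (C.apex - C.sphere.center)

/-- The centre of the round sphere `C.rim`; the rim lies in the hyperplane through this point that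
is orthogonal to `C.normal`. -/
def rimCenter (C : HyperCap d) : Euc d :=
  C.apex - (C.size ^ 2 / (2 * C.sphere.radius)) • C.normal

/-- The radius of the round sphere `C.rim`. -/
def rimRadius (C : HyperCap d) : ℝ :=
  C.size * √(1 - (C.size / (2 * C.sphere.radius)) ^ 2)

/-- The part of the rim around the direction `pole`, above relative height `κ`. For `κ = 0` it is
exactly one closed half of the rim. -/
def rimPart (C : HyperCap d) (pole : Euc d) (κ : ℝ) : Set (Euc d) :=
  {p | p ∈ C.rim ∧ κ * C.rimRadius ≤ inner ℝ pole (p - C.rimCenter)}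

end HyperCap

/-- A place on the rim of a hyper-cap at which a connector is attached: at most one half of the
rim (`height = 0` is exactly one half), around a unit vector `pole` in the hyperplane of the rim. -/
structure Foot {d : ℕ} (C : HyperCap d) where
  pole : Euc d
  norm_pole : ‖pole‖ = 1
  pole_normal : inner ℝ pole C.normal = 0
  height : ℝ
  height_nonneg : 0 ≤ height
  height_lt : height < 1

namespace Foot

variable {d : ℕ} {C : HyperCap d}

/-- The set of points of the rim at which the connector is attached. -/
def carrier (F : Foot C) : Set (Euc d) := C.rimPart F.pole F.height

/-- Two feet on a cap lie on complementary halves of the rim. -/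
def Opposite (F G : Foot C) : Prop := G.pole = -F.pole

end Foot

/-- The way in which a connector joins a foot on the cap `C` to a foot on the cap `C'`. The linear
isometry `frame` takes the hyperplane of the rim of `C` to that of `C'`, and so it induces a
similarity `glue` between the two rims. (Requiring `frame C.normal = C'.normal` is a normalization:
the values of `frame` off the hyperplane of the rim do not affect `glue`.) -/
structure Link {d : ℕ} (C C' : HyperCap d) where
  source : Foot C
  target : Foot C'
  frame : Euc d ≃ₗᵢ[ℝ] Euc d
  frame_normal : frame C.normal = C'.normal
  frame_pole : frame source.pole = target.pole
  height_eq : source.height = target.height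

namespace Link

variable {d : ℕ} {C C' : HyperCap d}

/-- The similarity from the rim of `C` to the rim of `C'`. -/
def glue (L : Link C C') (p : Euc d) : Euc d :=
  C'.rimCenter + (C'.rimRadius / C.rimRadius) • L.frame (p - C.rimCenter)

/-- The straight rulings of the (tilted) hyper-cylinder between the two rims. -/
def ruling (L : Link C C') (q : Euc d × ℝ) : Euc d :=
  (1 - q.2) • q.1 + q.2 • L.glue q.1

/-- The partial hyper-cylinder: the rulings that start in the source foot. -/
def cylinder (L : Link C C') : Set (Euc d) :=
  L.ruling '' (L.source.carrier ×ˢ Icc 0 1)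

/-- The link is untwisted with respect to a choice of one of the two sides of each of its caps, that
is of the unit normals `s • C.normal` and `s' • C'.normal` (`s, s' = ±1`): the orientations of the
caps given by these normals extend to one orientation of the two caps and the connector.

The two caps are glued through their boundaries, so this means that the gluing map of the rims, once
extended by `s • C.normal ↦ s' • C'.normal`, reverses the orientation of `ℝ^d`. The
determinant of that extension is `s * s' * det frame`. -/
def Untwisted (L : Link C C') (s s' : ℝ) : Prop :=
  s * s' * LinearMap.det (L.frame.toLinearEquiv : Euc d →ₗ[ℝ] Euc d) = -1

end Link

/-- The part of the construction that is common to both approaches: the hyper-caps of the data points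
and the partial hyper-cylinders that connect them in a chain with ends `ia` and `ib`. -/
structure CapChain (d n : ℕ) where
  /-- the dataset -/
  point : Fin n → Euc d
  point_injective : Function.Injective point
  /-- the nearest neighbours, `d` for each point -/
  nbr : Fin n → Fin d → Fin n
  nbr_nearest : IsNearestNeighbors point nbr
  /-- the small parameter in the motion of the neighbours towards the point -/
  ε : ℝ
  ε_pos : 0 < ε
  ε_lt_one : ε < 1
  /-- the small size of the hyper-caps -/
  δ : ℝ
  δ_le : δ ≤ ε
  /-- the hyper-caps, cut out of the osculating hyperspheres -/
  cap : Fin n → HyperCap d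
  cap_apex : ∀ i, (cap i).apex = point i
  cap_size : ∀ i, (cap i).size = δ
  /-- the hypersphere of a point passes through the moved neighbours (and through the point, by
  `HyperCap.apex_mem`) -/
  cap_fits : ∀ i j, (1 - ε) • point i + ε • point (nbr i j) ∈ (cap i).sphere
  cap_disjoint : ∀ i j, i ≠ j → Disjoint (cap i).carrier (cap j).carrier
  /-- the pairs of indices of the caps that are connected by a partial hyper-cylinder -/
  edges : Set (Fin n × Fin n)
  edges_asymm : ∀ i j, (i, j) ∈ edges → (j, i) ∉ edges
  /-- the indices of the two boundary hyper-caps -/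
  ia : Fin n
  ib : Fin n
  ia_ne_ib : ia ≠ ib
  edges_connected : (SimpleGraph.fromRel fun i j => (i, j) ∈ edges).Connected
  /-- a boundary cap is connected to one other cap, every other cap to exactly two -/
  edges_degree : ∀ i, ((SimpleGraph.fromRel fun i j => (i, j) ∈ edges).neighborSet i).ncard =
    if i = ia ∨ i = ib then 1 else 2
  /-- the connections -/
  link : ∀ i j, (i, j) ∈ edges → Link (cap i) (cap j)
  /-- the partial hyper-cylinders do not intersect themselves -/
  link_injOn : ∀ i j (h : (i, j) ∈ edges),
    InjOn (link i j h).ruling ((link i j h).source.carrier ×ˢ Icc 0 1)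
  /-- a partial hyper-cylinder meets the caps only in its two feet -/
  link_inter_source : ∀ i j (h : (i, j) ∈ edges),
    (link i j h).cylinder ∩ (cap i).carrier = (link i j h).source.carrier
  link_inter_target : ∀ i j (h : (i, j) ∈ edges),
    (link i j h).cylinder ∩ (cap j).carrier = (link i j h).target.carrier
  link_disjoint_cap : ∀ i j (h : (i, j) ∈ edges) (k : Fin n), k ≠ i → k ≠ j →
    Disjoint (link i j h).cylinder (cap k).carrier
  /-- different partial hyper-cylinders do not meet outside the caps -/
  link_inter_link : ∀ i j (h : (i, j) ∈ edges) (k l : Fin n) (h' : (k, l) ∈ edges),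
    (i, j) ≠ (k, l) →
      (link i j h).cylinder ∩ (link k l h').cylinder ⊆ ⋃ m, (cap m).carrier
  /-- two partial hyper-cylinders at one cap are attached to complementary halves of its rim -/
  opposite_out_out : ∀ i j k (h : (i, j) ∈ edges) (h' : (i, k) ∈ edges), j ≠ k →
    (link i j h).source.Opposite (link i k h').source
  opposite_in_in : ∀ i j k (h : (j, i) ∈ edges) (h' : (k, i) ∈ edges), j ≠ k →
    (link j i h).target.Opposite (link k i h').target
  opposite_in_out : ∀ i j k (h : (j, i) ∈ edges) (h' : (i, k) ∈ edges),
    (link j i h).target.Opposite (link i k h').source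

namespace CapChain

variable {d n : ℕ}

/-- The union of all hyper-caps. -/
def caps (X : CapChain d n) : Set (Euc d) := ⋃ i, (X.cap i).carrier

/-- The union of all partial hyper-cylinders. -/
def cylinders (X : CapChain d n) : Set (Euc d) :=
  ⋃ (i) (j) (h : (i, j) ∈ X.edges), (X.link i j h).cylinder

/-- The foot `F` on the cap `i` is on the half of the rim that is complementary to the one used by
the partial hyper-cylinder(s) at that cap. -/
def IsFree (X : CapChain d n) (i : Fin n) (F : Foot (X.cap i)) : Prop :=
  (∀ j (h : (i, j) ∈ X.edges), (X.link i j h).source.Opposite F) ∧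
    ∀ j (h : (j, i) ∈ X.edges), (X.link j i h).target.Opposite F

end CapChain

/-- The first approach: the two boundary hyper-caps are joined by a hyper-strip, which is an embedded,
possibly curved, product of its foot with the interval `[0, 1]`. -/
structure FirstApproach (d n : ℕ) extends CapChain d n where
  strip : Link (cap ia) (cap ib)
  stripMap : Euc d × ℝ → Euc d
  strip_continuousOn : ContinuousOn stripMap (strip.source.carrier ×ˢ Icc 0 1)
  strip_injOn : InjOn stripMap (strip.source.carrier ×ˢ Icc 0 1)
  strip_zero : ∀ p ∈ strip.source.carrier, stripMap (p, 0) = p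
  strip_one : ∀ p ∈ strip.source.carrier, stripMap (p, 1) = strip.glue p
  /-- the hyper-strip is attached to the free halves of the rims of the boundary caps -/
  strip_source_free : toCapChain.IsFree ia strip.source
  strip_target_free : toCapChain.IsFree ib strip.target
  /-- the hyper-strip meets the caps only in its two feet -/
  strip_inter_source :
    stripMap '' (strip.source.carrier ×ˢ Icc 0 1) ∩ (cap ia).carrier = strip.source.carrier
  strip_inter_target :
    stripMap '' (strip.source.carrier ×ˢ Icc 0 1) ∩ (cap ib).carrier = strip.target.carrier
  strip_disjoint_cap : ∀ k, k ≠ ia → k ≠ ib →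
    Disjoint (stripMap '' (strip.source.carrier ×ˢ Icc 0 1)) (cap k).carrier
  /-- the hyper-strip does not meet the partial hyper-cylinders outside the caps -/
  strip_inter_cylinders :
    stripMap '' (strip.source.carrier ×ˢ Icc 0 1) ∩ toCapChain.cylinders ⊆ toCapChain.caps
  /-- the connectors are not twisted: sides of the caps can be chosen that correspond to each other
  along every connector (unlike in a Möbius strip) -/
  untwisted : ∃ s : Fin n → ℝ, (∀ i, s i = 1 ∨ s i = -1) ∧
    (∀ i j (h : (i, j) ∈ edges), (link i j h).Untwisted (s i) (s j)) ∧
    strip.Untwisted (s ia) (s ib)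

/-- The hypersurface of the first approach. -/
def FirstApproach.hypersurface {d n : ℕ} (X : FirstApproach d n) : Set (Euc d) :=
  X.caps ∪ X.cylinders ∪ X.stripMap '' (X.strip.source.carrier ×ˢ Icc 0 1)

/-- A hyper-strip that leads from the boundary hyper-cap `i` of a chain to the point at infinity in the
direction `v`: an embedded product of its foot with `[0, ∞)`. -/
structure StripToInfinity {d n : ℕ} (X : CapChain d n) (i : Fin n) (v : Euc d) where
  foot : Foot (X.cap i)
  toFun : Euc d × ℝ → Euc d
  continuousOn : ContinuousOn toFun (foot.carrier ×ˢ Ici 0)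
  injOn : InjOn toFun (foot.carrier ×ˢ Ici 0)
  zero : ∀ p ∈ foot.carrier, toFun (p, 0) = p
  /-- uniformly over the foot, the strip goes to infinity on the side of `v` -/
  tendsto : Tendsto (fun q => inner ℝ v (toFun q)) (𝓟 foot.carrier ×ˢ atTop) atTop
  /-- the strip is attached to the free half of the rim -/
  foot_free : X.IsFree i foot
  /-- the strip meets the caps only in its foot, and no partial hyper-cylinder outside the caps -/
  inter_cap : toFun '' (foot.carrier ×ˢ Ici 0) ∩ X.caps = foot.carrier
  inter_cylinders : toFun '' (foot.carrier ×ˢ Ici 0) ∩ X.cylinders ⊆ X.caps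

/-- The strip as a set of points. -/
def StripToInfinity.carrier {d n : ℕ} {X : CapChain d n} {i : Fin n} {v : Euc d}
    (s : StripToInfinity X i v) : Set (Euc d) :=
  s.toFun '' (s.foot.carrier ×ˢ Ici 0)

/-- The second approach: the two boundary hyper-caps are joined by disjoint hyper-strips to two points
at infinity in opposite directions. -/
structure SecondApproach (d n : ℕ) extends CapChain d n where
  direction : Euc d
  direction_norm : ‖direction‖ = 1
  stripA : StripToInfinity toCapChain ia direction
  stripB : StripToInfinity toCapChain ib (-direction)
  strips_disjoint : Disjoint stripA.carrier stripB.carrier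

/-- The hypersurface of the second approach. -/
def SecondApproach.hypersurface {d n : ℕ} (X : SecondApproach d n) : Set (Euc d) :=
  X.caps ∪ X.cylinders ∪ X.stripA.carrier ∪ X.stripB.carrier

/-- The orientable `(d-1)`-dimensional hyper-strip loop: the product of a closed `(d-2)`-ball with a
circle (a circle for `d = 2`, an annulus for `d = 3`). -/
abbrev OrientableHyperStripLoop (d : ℕ) : Type :=
  Metric.closedBall (0 : Euc (d - 2)) 1 × Circle

/-- The unbounded orientable `(d-1)`-dimensional hyper-strip: the product of a closed `(d-2)`-ball with
a line. -/
abbrev UnboundedOrientableHyperStrip (d : ℕ) : Type :=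
  Metric.closedBall (0 : Euc (d - 2)) 1 × ℝ

end

/-! ### General topology: quotient maps and spaces glued from finitely many closed pieces. -/

open Set Filter Topology

noncomputable section

/-! Cut every connector in the middle and give each half to the cap at its foot. Every cap then
becomes a bead: a (d-1)-ball with two arms on opposite polar caps of its boundary, where an arm is
half a connector or a strip to infinity. A bead is a product of a (d-2)-ball with an interval, and
different beads share at most the ends of their arms. The hypersurface is the image of a finite
disjoint union of closed sets under maps for which preimages of bounded sets are bounded, so it is a
quotient of that union. Hence it is homeomorphic to any space parametrized by the same pieces with
the same identifications (`nonempty_homeomorph_iUnion_image`), and only identifications have to be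
compared (`Necklace.map_eq_map_iff`).

To compute them, each cap is parametrized by the unit ball of the hyperplane orthogonal to its
normal; in these coordinates the gluing along a link is the linear isometry `frame`
(`Link.glue_param`). The hyperplane splits into the line of the pole `h` and a copy of ℝ^(d-2).
Frames are transported along the chain (`exists_frames`), each step corrected by the reflection `h ↦
-h`, because a link enters a cap at the foot opposite to the one by which the chain leaves. With
these frames the gluings along an open chain are the identity of ℝ^(d-2), and stacking the beads
gives the ball times a line (`Necklace.nonempty_homeomorph_line`).

In a closed chain a holonomy `Q` of ℝ^(d-2) remains at the seam. Untwistedness says exactly that the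
transported frame has determinant 1 after one turn. By Cartan–Dieudonné `Q` is then a product of an
even number of reflections, and a product of two reflections can be deformed to the identity
(`isotopicToId_of_isoDet`). A path of isometries from the identity to `Q` unwinds the gluing, which
leaves the ball times a circle (`Necklace.nonempty_homeomorph_circle`).

The cyclic or linear order of the caps comes from a degree count: a connected graph with two
vertices of degree 1 and all others of degree 2 is a path (`exists_path_of_degree`). -/

/-- Two closed continuous surjections with the same fibres have homeomorphic targets. -/
theorem nonempty_homeomorph_of_same_fibers {X Y Z : Type*} [TopologicalSpace X]
    [TopologicalSpace Y] [TopologicalSpace Z] {f : X → Y} {g : X → Z}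
    (hf : IsQuotientMap f) (hg : IsQuotientMap g)
    (h : ∀ x x', f x = f x' ↔ g x = g x') : Nonempty (Y ≃ₜ Z) :=
  have hf' : IsQuotientMap (⟨f, hf.continuous⟩ : C(X, Y)) := hf
  have hg' : IsQuotientMap (⟨g, hg.continuous⟩ : C(X, Z)) := hg
  ⟨hf'.homeomorph.symm.trans ((Homeomorph.Quotient.congr (Homeomorph.refl X) h).trans
    hg'.homeomorph)⟩

/-- A continuous map on a closed subset of a proper space is closed if preimages of bounded sets are
bounded. -/
theorem isClosedMap_restrict_of_isBounded {M Y : Type*} [PseudoMetricSpace M] [ProperSpace M]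
    [MetricSpace Y] {K : Set M} (hK : IsClosed K) {f : M → Y} (hf : ContinuousOn f K)
    (hb : ∀ B : Set Y, Bornology.IsBounded B → Bornology.IsBounded (K ∩ f ⁻¹' B)) :
    IsClosedMap (K.domRestrict f) := by
  -- In a proper space closed bounded sets are compact, so the hypothesis makes preimages of compact
  -- sets compact; proper maps are closed.
  have : IsProperMap (K.domRestrict f) := by
    rw [isProperMap_iff_isCompact_preimage]
    refine ⟨continuousOn_iff_continuous_domRestrict.1 hf, fun B hB => ?_⟩
    rw [Subtype.isCompact_iff]
    have h1 : ((↑) : K → M) '' (K.domRestrict f ⁻¹' B) = K ∩ f ⁻¹' B := by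
      ext x; simp [domRestrict_apply, and_comm]
    rw [h1]
    exact Metric.isCompact_of_isClosed_isBounded (hf.preimage_isClosed_of_isClosed hK hB.isClosed)
      (hb B hB.isBounded)
  exact this.isClosedMap

/-- A surjection from a finite disjoint union is a quotient map if it is continuous and closed on
every summand. -/
theorem isQuotientMap_sigma {ι Y : Type*} [Finite ι] [TopologicalSpace Y] {X : ι → Type*}
    [∀ i, TopologicalSpace (X i)] {f : (Σ i, X i) → Y} (hc : ∀ i, Continuous fun x => f ⟨i, x⟩)
    (hcl : ∀ i, IsClosedMap fun x => f ⟨i, x⟩) (hs : Function.Surjective f) :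
    IsQuotientMap f := by
  refine IsClosedMap.isQuotientMap (fun s hs => ?_) (continuous_sigma hc) hs
  have : f '' s = ⋃ i, (fun x => f ⟨i, x⟩) '' (Sigma.mk i ⁻¹' s) := by
    ext y
    simp only [mem_image, mem_iUnion, mem_preimage]
    constructor
    · rintro ⟨⟨i, x⟩, hx, rfl⟩; exact ⟨i, x, hx, rfl⟩
    · rintro ⟨i, x, hx, rfl⟩; exact ⟨_, hx, rfl⟩
  rw [this]
  exact isClosed_iUnion_of_finite fun i => hcl i _ (hs.preimage continuous_sigmaMk)

/-! ### The model of a cap with its arms: a ball continued by two cylinders. -/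

/-- The sign `±1` encoded by a Boolean. -/
def boolSign (e : Bool) : ℝ := if e then 1 else -1

@[simp] theorem boolSign_true : boolSign true = 1 := rfl
@[simp] theorem boolSign_false : boolSign false = -1 := rfl

theorem abs_boolSign (e : Bool) : |boolSign e| = 1 := by cases e <;> simp

/-- The height of the unit sphere over a point of the equatorial plane. -/
def hemi {H : Type*} [NormedAddCommGroup H] (z : H) : ℝ := √(1 - ‖z‖ ^ 2)

section hemi
variable {H : Type*} [NormedAddCommGroup H]

theorem continuous_hemi : Continuous (hemi : H → ℝ) := by unfold hemi; fun_prop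

theorem hemi_nonneg (z : H) : 0 ≤ hemi z := Real.sqrt_nonneg _

theorem hemi_le_one (z : H) : hemi z ≤ 1 := by
  exact Real.sqrt_le_iff.2 ⟨zero_le_one, by nlinarith [sq_nonneg ‖z‖]⟩

theorem hemi_sq {z : H} (hz : ‖z‖ ^ 2 ≤ 1) : hemi z ^ 2 = 1 - ‖z‖ ^ 2 :=
  Real.sq_sqrt (by linarith)

theorem abs_le_hemi_iff {z : H} (hz : ‖z‖ ^ 2 ≤ 1) {t : ℝ} :
    |t| ≤ hemi z ↔ ‖z‖ ^ 2 + t ^ 2 ≤ 1 := by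
  unfold hemi
  rw [← abs_of_nonneg (Real.sqrt_nonneg (1 - ‖z‖ ^ 2)), ← sq_le_sq, Real.sq_sqrt (by linarith)]
  constructor <;> intro h <;> linarith

theorem le_hemi {z : H} {κ : ℝ} (h : ‖z‖ ^ 2 + κ ^ 2 ≤ 1) : κ ≤ hemi z :=
  Real.le_sqrt_of_sq_le (by linarith)

theorem norm_sq_add_hemi_sq {z : H} (hz : ‖z‖ ^ 2 ≤ 1) : ‖z‖ ^ 2 + hemi z ^ 2 = 1 := by
  rw [hemi_sq hz]; ring

theorem boolSign_hemi_mem_ball {z : H} {κ : ℝ} (hz : ‖z‖ ^ 2 + κ ^ 2 ≤ 1) (e : Bool) :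
    ‖z‖ ^ 2 + (boolSign e * hemi z) ^ 2 ≤ 1 := by
  rw [mul_pow, ← sq_abs (boolSign e), abs_boolSign, one_pow, one_mul,
    norm_sq_add_hemi_sq (by nlinarith [sq_nonneg κ])]

end hemi

/-- A ball with two arms, one for each sign, attached to polar caps of its boundary. The ball is
parametrized by the unit ball of `H × ℝ`, each arm by the product of a ball in `H` with `[0, 1]`
or `[0, ∞)`. -/
structure Bead (H E : Type*) [NormedAddCommGroup H] [TopologicalSpace E] where
  cap : H × ℝ → E
  height : Bool → ℝ
  bounded : Bool → Prop
  arm : Bool → H × ℝ → E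
  height_nonneg : ∀ e, 0 ≤ height e
  height_lt : ∀ e, height e < 1
  cap_continuousOn : ContinuousOn cap {x | ‖x.1‖ ^ 2 + x.2 ^ 2 ≤ 1}
  arm_continuousOn : ∀ e, ContinuousOn (arm e)
    {x | ‖x.1‖ ^ 2 + height e ^ 2 ≤ 1 ∧ 0 ≤ x.2 ∧ (bounded e → x.2 ≤ 1)}
  arm_zero : ∀ e z, ‖z‖ ^ 2 + height e ^ 2 ≤ 1 → arm e (z, 0) = cap (z, boolSign e * hemi z)

namespace Bead

variable {H E : Type*} [NormedAddCommGroup H] [TopologicalSpace E] (P : Bead H E)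

/-- The parameters of an arm. -/
def armDom (e : Bool) : Set (H × ℝ) :=
  {x | ‖x.1‖ ^ 2 + P.height e ^ 2 ≤ 1 ∧ 0 ≤ x.2 ∧ (P.bounded e → x.2 ≤ 1)}

/-- The height, cut off at the rims of the two polar caps. -/
def clamp (t : ℝ) : ℝ := max (-P.height false) (min (P.height true) t)

/-- The common domain of the ball and its arms. -/
def dom : Set (H × ℝ) :=
  {x | ‖x.1‖ ^ 2 + P.clamp x.2 ^ 2 ≤ 1 ∧ ∀ e, P.bounded e → boolSign e * x.2 ≤ 2}

/-- The time on the arm that corresponds to a point of `dom` beyond the unit ball. -/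
def time (z : H) (t : ℝ) : ℝ := (t - hemi z) / (2 - hemi z)

/-- The parametrization of the ball and its arms. -/
def map (x : H × ℝ) : E :=
  if |x.2| ≤ hemi x.1 then P.cap x else P.arm (decide (0 < x.2)) (x.1, time x.1 |x.2|)

theorem continuous_clamp : Continuous P.clamp := by unfold clamp; fun_prop

/-- Past the rim of a polar cap the clamp is constant, so there `dom` continues as a round cylinder
over the disc to which the arm is attached. -/
theorem clamp_of_le {e : Bool} {t : ℝ} (h : P.height e ≤ boolSign e * t) :
    P.clamp t = boolSign e * P.height e := by
  have h1 := P.height_nonneg true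
  have h2 := P.height_nonneg false
  unfold clamp
  cases e
  · simp only [boolSign_false] at *
    rw [min_eq_right (by linarith), max_eq_left (by linarith)]; ring
  · simp only [boolSign_true, one_mul] at *
    rw [min_eq_left h, max_eq_right (by linarith)]

theorem abs_clamp_le (t : ℝ) : |P.clamp t| ≤ |t| := by
  have h1 := P.height_nonneg true
  have h2 := P.height_nonneg false
  have h3 := neg_abs_le t
  have h4 := le_abs_self t
  have h5 := abs_nonneg t
  unfold clamp
  rw [abs_le]
  exact ⟨le_max_of_le_right (le_min (by linarith) h3), max_le (by linarith) (min_le_of_right_le h4)⟩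

/-- Heights below 1 keep every horizontal section of `dom` of positive radius; `Necklace.straighten`
divides by this radius. -/
theorem abs_clamp_lt_one (t : ℝ) : |P.clamp t| < 1 := by
  have h1 := P.height_nonneg true
  have h2 := P.height_nonneg false
  have h3 := P.height_lt true
  have h4 := P.height_lt false
  unfold clamp
  rw [abs_lt]
  exact ⟨lt_max_of_lt_left (by linarith), max_lt (by linarith) (min_lt_of_left_lt h3)⟩

/-- Between the two rims the clamp does nothing, and there `dom` coincides with the unit ball. -/
theorem clamp_eq_of_abs_le {e : Bool} {t : ℝ} (h0 : 0 ≤ boolSign e * t)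
    (h : boolSign e * t ≤ P.height e) : P.clamp t = t := by
  have h1 := P.height_nonneg true
  have h2 := P.height_nonneg false
  unfold clamp
  cases e
  · simp only [boolSign_false] at *
    rw [min_eq_right (by linarith), max_eq_right (by linarith)]
  · simp only [boolSign_true, one_mul] at *
    rw [min_eq_right h, max_eq_right (by linarith)]

theorem isClosed_dom : IsClosed P.dom := by
  have : P.dom = {x | ‖x.1‖ ^ 2 + P.clamp x.2 ^ 2 ≤ 1} ∩
      ⋂ (e) (_ : P.bounded e), {x | boolSign e * x.2 ≤ 2} := by
    ext x; simp [dom]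
  rw [this]
  have := P.continuous_clamp
  refine (isClosed_le (by fun_prop) (by fun_prop)).inter
    (isClosed_iInter fun e => isClosed_iInter fun _ => isClosed_le (by fun_prop) (by fun_prop))

theorem norm_sq_le_one {x : H × ℝ} (hx : x ∈ P.dom) : ‖x.1‖ ^ 2 ≤ 1 := by
  have := hx.1; nlinarith [sq_nonneg (P.clamp x.2)]

/-- The affine map `time z` sends `hemi z` to 0 and 2 to 1: a bounded arm fills the heights between
the sphere and 2. Since `hemi ≤ 1`, its denominator does not vanish. -/
theorem two_sub_hemi_pos (z : H) : 0 < 2 - hemi z := by linarith [hemi_le_one z]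

theorem time_le_one_iff {z : H} {t : ℝ} : time z t ≤ 1 ↔ t ≤ 2 := by
  unfold time; rw [div_le_one (two_sub_hemi_pos z)]; constructor <;> intro h <;> linarith

theorem time_eq_one_iff {z : H} {t : ℝ} : time z t = 1 ↔ t = 2 := by
  unfold time; rw [div_eq_one_iff_eq (two_sub_hemi_pos z).ne']
  constructor <;> intro h <;> linarith

theorem time_pos_iff {z : H} {t : ℝ} : 0 < time z t ↔ hemi z < t := by
  unfold time; rw [div_pos_iff_of_pos_right (two_sub_hemi_pos z), sub_pos]

theorem time_nonneg_iff {z : H} {t : ℝ} : 0 ≤ time z t ↔ hemi z ≤ t := by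
  unfold time
  rw [le_div_iff₀ (two_sub_hemi_pos z), zero_mul, sub_nonneg]

theorem time_injective (z : H) : Function.Injective (time z) := fun s t h => by
  unfold time at h
  have := two_sub_hemi_pos z
  field_simp at h
  linarith

/-- The part of the domain that belongs to an arm. -/
def armRegion (e : Bool) : Set (H × ℝ) :=
  P.dom ∩ {x | hemi x.1 ≤ boolSign e * x.2 ∧ P.height e ≤ boolSign e * x.2}

theorem mem_armDom_of_armRegion {e : Bool} {x : H × ℝ} (hx : x ∈ P.armRegion e) :
    (x.1, time x.1 (boolSign e * x.2)) ∈ P.armDom e := by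
  obtain ⟨⟨h1, h2⟩, h3, h4⟩ := hx
  rw [P.clamp_of_le h4, mul_pow, ← sq_abs (boolSign e), abs_boolSign, one_pow, one_mul] at h1
  exact ⟨h1, time_nonneg_iff.2 h3, fun hb => time_le_one_iff.2 (h2 e hb)⟩

/-- The region contains the seam between ball and arm, where `map` uses the cap. There the time is 0
and `arm_zero` makes both formulas agree; this is what allows pasting over closed pieces. -/
theorem map_of_armRegion {e : Bool} {x : H × ℝ} (hx : x ∈ P.armRegion e) :
    P.map x = P.arm e (x.1, time x.1 (boolSign e * x.2)) := by
  have hm := P.mem_armDom_of_armRegion hx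
  obtain ⟨_, h3, h4⟩ := hx
  have h0 : 0 ≤ boolSign e * x.2 := (P.height_nonneg e).trans h4
  have ha : |x.2| = boolSign e * x.2 := by
    rw [← abs_of_nonneg h0, abs_mul, abs_boolSign, one_mul]
  unfold map
  split_ifs with h
  · have he : boolSign e * x.2 = hemi x.1 := le_antisymm (ha ▸ h) h3
    have ht : time x.1 (boolSign e * x.2) = 0 := by simp [time, he]
    rw [ht, P.arm_zero e x.1 hm.1, ← he, ← mul_assoc]
    have : boolSign e * boolSign e = 1 := by cases e <;> simp
    simp [this]
  · have hpos : 0 < boolSign e * x.2 := by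
      have := (hemi_nonneg x.1).trans_lt (not_le.1 h); rwa [ha] at this
    have : decide (0 < x.2) = e := by
      cases e
      · simp at hpos ⊢; exact hpos.le
      · simpa using hpos
    rw [this, ha]

/-- A point of `dom` outside the ball lies past a rim: before the rim the clamp is the identity, and
the condition defining `dom` would put the point into the ball. -/
theorem mem_armRegion {x : H × ℝ} (hx : x ∈ P.dom) (h : hemi x.1 < |x.2|) :
    x ∈ P.armRegion (decide (0 < x.2)) ∧ |x.2| = boolSign (decide (0 < x.2)) * x.2 := by
  have ha : |x.2| = boolSign (decide (0 < x.2)) * x.2 := by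
    by_cases h0 : 0 < x.2
    · simp [h0, abs_of_pos h0]
    · simp [h0, abs_of_nonpos (not_lt.1 h0)]
  refine ⟨⟨hx, ha ▸ h.le, ?_⟩, ha⟩
  by_contra! hlt
  have h1 := hx.1
  rw [P.clamp_eq_of_abs_le (ha ▸ abs_nonneg _) hlt.le] at h1
  exact absurd ((abs_le_hemi_iff (P.norm_sq_le_one hx)).2 h1) (not_le.2 h)

theorem mem_armDom {x : H × ℝ} (hx : x ∈ P.dom) (h : hemi x.1 < |x.2|) :
    (x.1, time x.1 |x.2|) ∈ P.armDom (decide (0 < x.2)) := by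
  obtain ⟨h1, h2⟩ := P.mem_armRegion hx h
  rw [h2]; exact P.mem_armDom_of_armRegion h1

theorem continuousOn_map : ContinuousOn P.map P.dom := by
  have hcov :
      P.dom ⊆ (P.dom ∩ {x | |x.2| ≤ hemi x.1}) ∪ (P.armRegion true ∪ P.armRegion false) := by
    intro x hx
    by_cases h : |x.2| ≤ hemi x.1
    · exact Or.inl ⟨hx, h⟩
    · have := (P.mem_armRegion hx (not_le.1 h)).1
      revert this
      cases decide (0 < x.2)
      · exact fun h => Or.inr (Or.inr h)
      · exact fun h => Or.inr (Or.inl h)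
  have hh : Continuous fun x : H × ℝ => hemi x.1 := continuous_hemi.comp continuous_fst
  have hcl : ∀ e, IsClosed (P.armRegion e) := fun e => P.isClosed_dom.inter
    ((isClosed_le hh (by fun_prop : Continuous fun x : H × ℝ => boolSign e * x.2)).inter
      (isClosed_le (by fun_prop : Continuous fun _ : H × ℝ => P.height e)
      (by fun_prop)))
  have hc : ∀ e, ContinuousOn P.map (P.armRegion e) := fun e => by
    refine ContinuousOn.congr ?_ fun x hx => P.map_of_armRegion hx
    refine (P.arm_continuousOn e).comp (Continuous.continuousOn ?_)
      fun x hx => P.mem_armDom_of_armRegion hx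
    unfold time
    refine continuous_fst.prodMk (Continuous.div (by fun_prop) (by fun_prop) fun x => ?_)
    exact (two_sub_hemi_pos x.1).ne'
  refine ContinuousOn.mono (ContinuousOn.union_of_isClosed ?_
    ((hc true).union_of_isClosed (hc false) (hcl _) (hcl _)) ?_ ((hcl _).union (hcl _))) hcov
  · refine (P.cap_continuousOn.mono fun x hx => ?_).congr fun x hx => if_pos hx.2
    exact (abs_le_hemi_iff (P.norm_sq_le_one hx.1)).1 hx.2
  · exact P.isClosed_dom.inter (isClosed_le (by fun_prop) hh)

theorem mem_dom_of_ball {x : H × ℝ} (hx : ‖x.1‖ ^ 2 + x.2 ^ 2 ≤ 1) : x ∈ P.dom := by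
  have h1 : P.clamp x.2 ^ 2 ≤ x.2 ^ 2 := sq_le_sq.2 (P.abs_clamp_le _)
  have h2 : |x.2| ≤ 1 := by
    rw [← sq_le_one_iff_abs_le_one]; nlinarith [sq_nonneg ‖x.1‖]
  refine ⟨by linarith, fun e _ => ?_⟩
  have := abs_le.1 h2
  cases e <;> simp <;> linarith

theorem map_of_ball {x : H × ℝ} (hx : ‖x.1‖ ^ 2 + x.2 ^ 2 ≤ 1) : P.map x = P.cap x :=
  if_pos ((abs_le_hemi_iff (by nlinarith [sq_nonneg x.2])).2 hx)

theorem exists_armRegion {e : Bool} {y : H × ℝ} (hy : y ∈ P.armDom e) :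
    ∃ x ∈ P.armRegion e, P.map x = P.arm e y := by
  obtain ⟨h1, h2, h3⟩ := hy
  have hp := two_sub_hemi_pos y.1
  have hq := le_hemi h1
  have hs : boolSign e * boolSign e = 1 := by cases e <;> simp
  -- This height is the preimage of `y.2` under `time y.1`.
  set t := hemi y.1 + y.2 * (2 - hemi y.1) with ht
  have ht1 : hemi y.1 ≤ t := by rw [ht]; nlinarith
  have htime : time y.1 t = y.2 := by unfold time; rw [ht]; field_simp; ring
  have hst : boolSign e * (boolSign e * t) = t := by rw [← mul_assoc, hs, one_mul]
  have hreg : (y.1, boolSign e * t) ∈ P.armRegion e := by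
    refine ⟨⟨?_, fun e' he' => ?_⟩, by simp [hst, ht1], by simp only [hst]; linarith⟩
    · rw [P.clamp_of_le (e := e) (by simp only [hst]; linarith), mul_pow, sq (boolSign e), hs]
      simpa using h1
    · by_cases hee : e' = e
      · subst hee
        simp only [hst]
        rw [← time_le_one_iff (z := y.1), htime]
        exact h3 he'
      · have : boolSign e' = -boolSign e := by cases e <;> cases e' <;> simp_all
        have h0 := (hemi_nonneg y.1).trans ht1
        simp only [this]
        linarith
  refine ⟨_, hreg, ?_⟩
  rw [P.map_of_armRegion hreg]
  simp only [hst, htime]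

theorem image_map : P.map '' P.dom =
    P.cap '' {x | ‖x.1‖ ^ 2 + x.2 ^ 2 ≤ 1} ∪ ⋃ e, P.arm e '' P.armDom e := by
  ext y
  constructor
  · rintro ⟨x, hx, rfl⟩
    by_cases h : |x.2| ≤ hemi x.1
    · have := (abs_le_hemi_iff (P.norm_sq_le_one hx)).1 h
      exact Or.inl ⟨x, this, (P.map_of_ball this).symm⟩
    · exact Or.inr (mem_iUnion.2 ⟨_, _, P.mem_armDom hx (not_le.1 h), (if_neg h).symm⟩)
  · rintro (⟨x, hx, rfl⟩ | h)
    · exact ⟨x, P.mem_dom_of_ball hx, P.map_of_ball hx⟩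
    · obtain ⟨e, y, hy, rfl⟩ := mem_iUnion.1 h
      obtain ⟨x, hx, h⟩ := P.exists_armRegion hy
      exact ⟨x, hx.1, h⟩

end Bead
end

/-! ### Sets parametrized by closed pieces, and the identifications in a chain of beads. -/

noncomputable section

/-- A family of maps on closed pieces, for which preimages of bounded sets are bounded, exhibits the
union of the images as a quotient of the disjoint union of the pieces. -/
theorem isQuotientMap_iUnion_image {ι M Y : Type*} [Finite ι] [PseudoMetricSpace M]
    [ProperSpace M] [MetricSpace Y] {K : ι → Set M} (hK : ∀ i, IsClosed (K i))
    {f : ι → M → Y} (hf : ∀ i, ContinuousOn (f i) (K i))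
    (hfb : ∀ i, ∀ B : Set Y, Bornology.IsBounded B → Bornology.IsBounded (K i ∩ f i ⁻¹' B)) :
    IsQuotientMap (fun x : Σ i, K i =>
      (⟨f x.1 x.2, mem_iUnion.2 ⟨x.1, x.2, x.2.2, rfl⟩⟩ : ↥(⋃ i, f i '' K i))) := by
  refine isQuotientMap_sigma (fun i => ?_) (fun i => ?_) ?_
  · exact (continuousOn_iff_continuous_domRestrict.1 (hf i)).subtype_mk _
  · intro s hs
    have h1 := isClosedMap_restrict_of_isBounded (hK i) (hf i) (hfb i) s hs
    convert h1.preimage continuous_subtype_val using 1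
    ext y
    simp [Subtype.ext_iff, domRestrict_apply]
  · rintro ⟨y, hy⟩
    obtain ⟨i, x, hx, rfl⟩ := mem_iUnion.1 hy
    exact ⟨⟨i, x, hx⟩, rfl⟩

/-- Two families of maps that parametrize two sets by the same closed pieces, with the same
identifications, give a homeomorphism of these sets. -/
theorem nonempty_homeomorph_iUnion_image {ι M Y Z : Type*} [Finite ι] [PseudoMetricSpace M]
    [ProperSpace M] [MetricSpace Y] [MetricSpace Z] {K : ι → Set M} (hK : ∀ i, IsClosed (K i))
    {f : ι → M → Y} {g : ι → M → Z}
    (hf : ∀ i, ContinuousOn (f i) (K i)) (hg : ∀ i, ContinuousOn (g i) (K i))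
    (hfb : ∀ i, ∀ B : Set Y, Bornology.IsBounded B → Bornology.IsBounded (K i ∩ f i ⁻¹' B))
    (hgb : ∀ i, ∀ B : Set Z, Bornology.IsBounded B → Bornology.IsBounded (K i ∩ g i ⁻¹' B))
    (hfib : ∀ i i' x x', x ∈ K i → x' ∈ K i' → (f i x = f i' x' ↔ g i x = g i' x')) :
    Nonempty (↥(⋃ i, f i '' K i) ≃ₜ ↥(⋃ i, g i '' K i)) := by
  refine nonempty_homeomorph_of_same_fibers (isQuotientMap_iUnion_image hK hf hfb)
    (isQuotientMap_iUnion_image hK hg hgb) ?_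
  rintro ⟨i, x, hx⟩ ⟨i', x', hx'⟩
  simpa [Subtype.ext_iff] using hfib i i' x x' hx hx'

/-- A family of beads whose parametrizations overlap at most in the ends of their arms: the end of
the positive arm of one bead can be identified with the end of the negative arm of another, as
prescribed by `mate`. -/
structure Necklace (H E : Type*) [NormedAddCommGroup H] [TopologicalSpace E] (n : ℕ) where
  bead : Fin n → Bead H E
  mate : Fin n → Fin n → H → H → Prop
  cap_inj : ∀ k k' x x', ‖x.1‖ ^ 2 + x.2 ^ 2 ≤ 1 → ‖x'.1‖ ^ 2 + x'.2 ^ 2 ≤ 1 →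
    (bead k).cap x = (bead k').cap x' → k = k' ∧ x = x'
  arm_ne_cap : ∀ k e k' y x, y ∈ (bead k).armDom e → 0 < y.2 → ‖x.1‖ ^ 2 + x.2 ^ 2 ≤ 1 →
    (bead k).arm e y ≠ (bead k').cap x
  arm_inj : ∀ k e y y', y ∈ (bead k).armDom e → y' ∈ (bead k).armDom e → 0 < y.2 → 0 < y'.2 →
    (bead k).arm e y = (bead k).arm e y' → y = y'
  arm_arm : ∀ k e k' e' y y', y ∈ (bead k).armDom e → y' ∈ (bead k').armDom e' →
    0 < y.2 → 0 < y'.2 → (k, e) ≠ (k', e') → (bead k).arm e y = (bead k').arm e' y' →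
    (e = true ∧ e' = false ∧ y.2 = 1 ∧ y'.2 = 1 ∧ mate k k' y.1 y'.1) ∨
    (e = false ∧ e' = true ∧ y.2 = 1 ∧ y'.2 = 1 ∧ mate k' k y'.1 y.1)
  mate_arm : ∀ k k' z z', (z, 1) ∈ (bead k).armDom true → mate k k' z z' →
    (bead k).arm true (z, 1) = (bead k').arm false (z', 1)

namespace Necklace

variable {H E : Type*} [NormedAddCommGroup H]

/-- The end `x` of a positive arm is identified with the end `x'` of a negative arm. -/
def Glued [TopologicalSpace E] {n : ℕ} (N : Necklace H E n) (k k' : Fin n) (x x' : H × ℝ) : Prop :=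
  x.2 = 2 ∧ x'.2 = -2 ∧ N.mate k k' x.1 x'.1

theorem map_eq_of_glued [TopologicalSpace E] {n : ℕ} (N : Necklace H E n) {k k' : Fin n}
    {x x' : H × ℝ} (hx : x ∈ (N.bead k).dom) (h : N.Glued k k' x x') :
    (N.bead k).map x = (N.bead k').map x' := by
  obtain ⟨z, t⟩ := x
  obtain ⟨z', t'⟩ := x'
  obtain ⟨h1, h2, h3⟩ := h
  simp only at h1 h2 h3
  subst h1 h2
  have hz := hemi_le_one z
  have hz' := hemi_le_one z'
  have h4 := (N.bead k).mem_armDom hx (by simp; linarith)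
  simp only [abs_two, Bead.time_eq_one_iff.2 rfl] at h4
  have h5 : ¬ (2 : ℝ) ≤ hemi z := by linarith
  have h6 : ¬ (2 : ℝ) ≤ hemi z' := by linarith
  have := N.mate_arm k k' z z' (by simpa using h4) h3
  have h7 : ¬ (2 : ℝ) < 0 := by norm_num
  simpa [Bead.map, h5, h6, h7, Bead.time_eq_one_iff.2 rfl] using this

/-- Ball points are told apart by `cap_inj`, and open arms avoid all caps. So a nontrivial
coincidence involves two different arms, both at time 1, that is at the heights 2 and -2. -/
theorem map_eq_map_iff [TopologicalSpace E] {n : ℕ} (N : Necklace H E n) {k k' : Fin n}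
    {x x' : H × ℝ} (hx : x ∈ (N.bead k).dom) (hx' : x' ∈ (N.bead k').dom) :
    (N.bead k).map x = (N.bead k').map x' ↔
      (k = k' ∧ x = x') ∨ N.Glued k k' x x' ∨ N.Glued k' k x' x := by
  constructor
  · intro h
    by_cases hc : |x.2| ≤ hemi x.1 <;> by_cases hc' : |x'.2| ≤ hemi x'.1
    · have hb := (abs_le_hemi_iff ((N.bead k).norm_sq_le_one hx)).1 hc
      have hb' := (abs_le_hemi_iff ((N.bead k').norm_sq_le_one hx')).1 hc'
      rw [Bead.map_of_ball _ hb, Bead.map_of_ball _ hb'] at h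
      exact Or.inl (N.cap_inj _ _ _ _ hb hb' h)
    · have hb := (abs_le_hemi_iff ((N.bead k).norm_sq_le_one hx)).1 hc
      have ha' := (N.bead k').mem_armDom hx' (not_le.1 hc')
      rw [Bead.map_of_ball _ hb, Bead.map, if_neg hc'] at h
      exact absurd h.symm (N.arm_ne_cap _ _ _ _ _ ha' (Bead.time_pos_iff.2 (not_le.1 hc')) hb)
    · have hb' := (abs_le_hemi_iff ((N.bead k').norm_sq_le_one hx')).1 hc'
      have ha := (N.bead k).mem_armDom hx (not_le.1 hc)
      rw [Bead.map_of_ball _ hb', Bead.map, if_neg hc] at h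
      exact absurd h (N.arm_ne_cap _ _ _ _ _ ha (Bead.time_pos_iff.2 (not_le.1 hc)) hb')
    · have ha := (N.bead k).mem_armDom hx (not_le.1 hc)
      have ha' := (N.bead k').mem_armDom hx' (not_le.1 hc')
      have hp := Bead.time_pos_iff.2 (not_le.1 hc)
      have hp' := Bead.time_pos_iff.2 (not_le.1 hc')
      have hr := ((N.bead k).mem_armRegion hx (not_le.1 hc)).2
      have hr' := ((N.bead k').mem_armRegion hx' (not_le.1 hc')).2
      rw [Bead.map, if_neg hc, Bead.map, if_neg hc'] at h
      by_cases hke : (k, decide (0 < x.2)) = (k', decide (0 < x'.2))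
      · obtain ⟨hk, he⟩ := Prod.mk.inj hke
        subst hk
        rw [← he] at h ha' hr'
        have h1 := N.arm_inj _ _ _ _ ha ha' hp hp' h
        obtain ⟨h2, h3⟩ := Prod.mk.inj h1
        rw [← h2] at h3
        have h4 := Bead.time_injective _ h3
        rw [hr, hr'] at h4
        refine Or.inl ⟨rfl, Prod.ext h2 (mul_left_cancel₀ ?_ h4)⟩
        intro h0
        have := abs_boolSign (decide (0 < x.2))
        simp [h0] at this
      · refine Or.inr ?_
        rcases N.arm_arm _ _ _ _ _ _ ha ha' hp hp' hke h with ⟨h1, h2, h3, h4, h5⟩ |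
            ⟨h1, h2, h3, h4, h5⟩
        all_goals
          rw [h1, Bead.time_eq_one_iff.1 h3] at hr
          rw [h2, Bead.time_eq_one_iff.1 h4] at hr'
        · simp only [boolSign_true, boolSign_false] at hr hr'
          exact Or.inl ⟨by linarith, by linarith, h5⟩
        · simp only [boolSign_true, boolSign_false] at hr hr'
          exact Or.inr ⟨by linarith, by linarith, h5⟩
  · rintro (⟨rfl, rfl⟩ | h | h)
    · rfl
    · exact N.map_eq_of_glued hx h
    · exact (N.map_eq_of_glued hx' h).symm

end Necklace

/-! ### Straightening a chain of beads to a ball times an interval. -/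

namespace Bead

variable {H E : Type*} [NormedAddCommGroup H] [TopologicalSpace E] (P : Bead H E)

/-- The radius of the horizontal sections of the domain. -/
def width (t : ℝ) : ℝ := √(1 - P.clamp t ^ 2)

theorem clamp_sq_lt_one (t : ℝ) : P.clamp t ^ 2 < 1 :=
  (sq_lt_one_iff_abs_lt_one _).2 (P.abs_clamp_lt_one t)

theorem width_pos (t : ℝ) : 0 < P.width t := Real.sqrt_pos.2 (by linarith [P.clamp_sq_lt_one t])

theorem width_sq (t : ℝ) : P.width t ^ 2 = 1 - P.clamp t ^ 2 :=
  Real.sq_sqrt (by linarith [P.clamp_sq_lt_one t])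

theorem continuous_width : Continuous P.width := by
  have := P.continuous_clamp
  unfold width; fun_prop

/-- The clamp is constant near the ends, so the end disc of an arm has the radius of its foot; feet
of equal height give end discs of equal radius. -/
theorem width_two : P.width 2 = √(1 - P.height true ^ 2) := by
  rw [width, P.clamp_of_le (e := true) (by have := P.height_lt true; simp; linarith)]; simp

theorem width_neg_two : P.width (-2) = √(1 - P.height false ^ 2) := by
  rw [width, P.clamp_of_le (e := false) (by have := P.height_lt false; simp; linarith)]; simp

theorem isBounded_of_snd {s : Set (H × ℝ)} (hs : s ⊆ P.dom)
    {a : ℝ} (ha : ∀ x ∈ s, |x.2| ≤ a) : Bornology.IsBounded s := by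
  refine (Metric.isBounded_closedBall (x := (0 : H × ℝ)) (r := max 1 a)).subset fun x hx => ?_
  rw [mem_closedBall_zero_iff, Prod.norm_def]
  refine max_le_max ?_ (ha x hx)
  have := P.norm_sq_le_one (hs hx)
  exact (sq_le_one_iff₀ (norm_nonneg _)).1 this

theorem norm_inv_width_smul_le [NormedSpace ℝ H] {x : H × ℝ} :
    ‖(P.width x.2)⁻¹ • x.1‖ ≤ 1 ↔ ‖x.1‖ ^ 2 + P.clamp x.2 ^ 2 ≤ 1 := by
  have h := P.width_pos x.2
  have h2 := P.width_sq x.2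
  rw [norm_smul, norm_inv, Real.norm_of_nonneg h.le, inv_mul_le_iff₀ h, mul_one,
    ← sq_le_sq₀ (norm_nonneg _) h.le, h2]
  constructor <;> intro h <;> linarith

end Bead

namespace Necklace

variable {H E : Type*} [NormedAddCommGroup H] [NormedSpace ℝ H]

section straighten

variable [TopologicalSpace E] {n : ℕ} (N : Necklace H E n)

/-- The coordinates that make a chain of beads a product of a ball with an interval. -/
def straighten (k : Fin n) (x : H × ℝ) : H × ℝ :=
  (((N.bead k).width x.2)⁻¹ • x.1, 4 * (k : ℝ) + x.2)

theorem continuous_straighten (k : Fin n) : Continuous (N.straighten k) := by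
  have := (N.bead k).continuous_width
  unfold straighten
  refine Continuous.prodMk (Continuous.smul (Continuous.inv₀ (by fun_prop) fun x => ?_)
    (by fun_prop)) (by fun_prop)
  exact ((N.bead k).width_pos _).ne'

/-- Inner arms end at the heights ±2, so with a spacing of 4 the top of bead `k` and the bottom of
bead `k + 1` lie on the same level `4 * k + 2`, and other levels are not shared. On that level both
sections have the same width by `hh`, hence equality of the rescaled points is equality of the
points. -/
theorem straighten_eq_iff
    (hh : ∀ k k' : Fin n, (k' : ℕ) = k + 1 → (N.bead k).height true = (N.bead k').height false)
    {k k' : Fin n} {x x' : H × ℝ}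
    (hu : (k : ℕ) + 1 < n → x.2 ≤ 2) (hl : 0 < (k : ℕ) → -2 ≤ x.2)
    (hu' : (k' : ℕ) + 1 < n → x'.2 ≤ 2) (hl' : 0 < (k' : ℕ) → -2 ≤ x'.2) :
    N.straighten k x = N.straighten k' x' ↔ (k = k' ∧ x = x') ∨
      (x.2 = 2 ∧ x'.2 = -2 ∧ (k' : ℕ) = k + 1 ∧ x'.1 = x.1) ∨
      (x'.2 = 2 ∧ x.2 = -2 ∧ (k : ℕ) = k' + 1 ∧ x.1 = x'.1) := by
  have key : ∀ {k k' : Fin n} {x x' : H × ℝ}, x.2 = 2 → x'.2 = -2 → (k' : ℕ) = k + 1 →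
      (((N.bead k).width x.2)⁻¹ • x.1 = ((N.bead k').width x'.2)⁻¹ • x'.1 ↔ x'.1 = x.1) := by
    intro k k' x x' h2 h2' hk
    rw [h2, h2', Bead.width_neg_two, ← hh _ _ hk, ← Bead.width_two, eq_comm]
    exact (smul_right_injective H (inv_ne_zero ((N.bead k).width_pos 2).ne')).eq_iff
  -- Equal levels in beads `k < k'` leave no slack in the bounds `x.2 ≤ 2` and `-2 ≤ x'.2`: the
  -- beads are consecutive and both bounds are attained.
  have gap : ∀ {k k' : Fin n} {x x' : H × ℝ}, ((k : ℕ) + 1 < n → x.2 ≤ 2) →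
      (0 < (k' : ℕ) → -2 ≤ x'.2) → (k : ℕ) < k' → 4 * (k : ℝ) + x.2 = 4 * (k' : ℝ) + x'.2 →
      x.2 = 2 ∧ x'.2 = -2 ∧ (k' : ℕ) = k + 1 := by
    intro k k' x x' hu hl' hlt h
    have h1 := hu (by omega)
    have h2 := hl' (by omega)
    have h3 : (k' : ℕ) ≤ k + 1 := by
      by_contra! h4
      have : (k : ℝ) + 2 ≤ k' := by exact_mod_cast h4
      linarith
    have h4 : (k' : ℕ) = k + 1 := by omega
    have h5 : (k' : ℝ) = k + 1 := by exact_mod_cast h4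
    exact ⟨by linarith, by linarith, h4⟩
  rw [straighten, straighten, Prod.mk_inj]
  constructor
  · rintro ⟨h1, h2⟩
    rcases lt_trichotomy (k : ℕ) k' with hlt | heq | hgt
    · obtain ⟨a, b, c⟩ := gap hu hl' hlt h2
      exact Or.inr (Or.inl ⟨a, b, c, (key a b c).1 h1⟩)
    · have hk := Fin.ext heq
      subst hk
      have h3 : x.2 = x'.2 := by linarith
      rw [h3] at h1
      exact Or.inl ⟨rfl, Prod.ext
        (smul_right_injective H (inv_ne_zero ((N.bead k).width_pos x'.2).ne') h1) h3⟩
    · obtain ⟨a, b, c⟩ := gap hu' hl hgt h2.symm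
      exact Or.inr (Or.inr ⟨a, b, c, (key a b c).1 h1.symm⟩)
  · rintro (⟨rfl, rfl⟩ | ⟨a, b, c, h⟩ | ⟨a, b, c, h⟩)
    · exact ⟨rfl, rfl⟩
    · have h5 : (k' : ℝ) = k + 1 := by exact_mod_cast c
      exact ⟨(key a b c).2 h, by rw [a, b, h5]; ring⟩
    · have h5 : (k : ℝ) = k' + 1 := by exact_mod_cast c
      exact ⟨((key a b c).2 h).symm, by rw [a, b, h5]; ring⟩

/-- The bounds on `x.2` are conditional so that the lemma serves both the line, where the extreme
beads are unbounded, and the loop, where `s` stays in `[-2, 4 * n - 2]`. -/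
theorem exists_straighten_eq (hn : 0 < n) {b : H} (hb : ‖b‖ ≤ 1) (s : ℝ) :
    ∃ (k : Fin n) (x : H × ℝ), N.straighten k x = (b, s) ∧
      ‖x.1‖ ^ 2 + (N.bead k).clamp x.2 ^ 2 ≤ 1 ∧
      ((k : ℕ) + 1 < n → x.2 ≤ 2) ∧ (0 < (k : ℕ) → -2 ≤ x.2) ∧
      (-2 ≤ s → -2 ≤ x.2) ∧ (s ≤ 4 * n - 2 → x.2 ≤ 2) := by
  -- Bead `k` covers the levels from `4 * k - 2` to `4 * k + 2`. The natural floor is 0 for negative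
  -- arguments, so levels below the chain go to the first bead; the minimum with `n - 1` sends those
  -- above it to the last one.
  set m : ℕ := ⌊(s + 2) / 4⌋₊ with hm
  have h1 : (s + 2) / 4 < m + 1 := Nat.lt_floor_add_one _
  have h2 : 0 < m → (m : ℝ) ≤ (s + 2) / 4 := fun h =>
    Nat.floor_le (by by_contra! h'; rw [hm, Nat.floor_of_nonpos h'.le] at h; exact lt_irrefl _ h)
  let k : Fin n := ⟨min (n - 1) m, by omega⟩
  have hkm : (k : ℕ) = min (n - 1) m := rfl
  let t : ℝ := s - 4 * k
  have hstr : N.straighten k ((N.bead k).width t • b, t) = (b, s) := by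
    have := ((N.bead k).width_pos t).ne'
    simp [straighten, smul_smul, this, t]
  have hlow : 0 < (k : ℕ) → -2 ≤ t := fun h => by
    have h3 := h2 (by omega)
    have h4 : (k : ℝ) ≤ m := by exact_mod_cast hkm ▸ min_le_right _ _
    simp only [t]; linarith
  have hup : (k : ℕ) + 1 < n → t ≤ 2 := fun h => by
    have h4 : (k : ℕ) = m := by omega
    have h5 : (k : ℝ) = m := by exact_mod_cast h4
    simp only [t, h5]; linarith
  refine ⟨k, _, hstr, ?_, hup, hlow, fun h => ?_, fun h => ?_⟩
  · rw [← Bead.norm_inv_width_smul_le]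
    have := congrArg Prod.fst hstr
    simp only [straighten] at this
    rwa [this]
  · rcases Nat.eq_zero_or_pos (k : ℕ) with h0 | h0
    · simp only [t, h0]; simpa using h
    · exact hlow h0
  · by_cases h0 : (k : ℕ) + 1 < n
    · exact hup h0
    · have : (k : ℕ) + 1 = n := by omega
      have : (k : ℝ) + 1 = n := by exact_mod_cast this
      simp only [t]; linarith

end straighten

/-- A necklace whose beads are joined in a row, with unbounded arms at both ends, is a product of a
ball with a line. -/
theorem nonempty_homeomorph_line [ProperSpace H] [MetricSpace E] {n : ℕ} (N : Necklace H E n)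
    (hn : 0 < n)
    (hmate : ∀ k k' z z', N.mate k k' z z' ↔ (k' : ℕ) = k + 1 ∧ z' = z)
    (hh : ∀ k k' : Fin n, (k' : ℕ) = k + 1 → (N.bead k).height true = (N.bead k').height false)
    (hbt : ∀ k : Fin n, (N.bead k).bounded true ↔ (k : ℕ) + 1 < n)
    (hbf : ∀ k : Fin n, (N.bead k).bounded false ↔ 0 < (k : ℕ))
    (hprop : ∀ k, ∀ B : Set E, Bornology.IsBounded B →
      ∃ a, ∀ x ∈ (N.bead k).dom, (N.bead k).map x ∈ B → |x.2| ≤ a) :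
    Nonempty (↥(⋃ k, (N.bead k).map '' (N.bead k).dom) ≃ₜ
      Metric.closedBall (0 : H) 1 × ℝ) := by
  have hu : ∀ k, ∀ x ∈ (N.bead k).dom, (k : ℕ) + 1 < n → x.2 ≤ 2 := fun k x hx h => by
    simpa using hx.2 true ((hbt k).2 h)
  have hl : ∀ k, ∀ x ∈ (N.bead k).dom, 0 < (k : ℕ) → -2 ≤ x.2 := fun k x hx h => by
    have := hx.2 false ((hbf k).2 h)
    simp at this; linarith
  have h1 := nonempty_homeomorph_iUnion_image (fun k => (N.bead k).isClosed_dom)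
    (f := fun k => (N.bead k).map) (g := N.straighten) (fun k => (N.bead k).continuousOn_map)
    (fun k => (N.continuous_straighten k).continuousOn)
    -- This is where the escape of the unbounded arms to infinity enters: points with image in a
    -- bounded set have bounded height.
    (fun k B hB => by
      obtain ⟨a, ha⟩ := hprop k B hB
      exact (N.bead k).isBounded_of_snd inter_subset_left fun x hx => ha x hx.1 hx.2)
    (fun k B hB => by
      obtain ⟨a, ha⟩ := hB.exists_norm_le
      refine (N.bead k).isBounded_of_snd inter_subset_left (a := a + 4 * n) fun x hx => ?_
      have h1 := (norm_snd_le _).trans (ha _ hx.2)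
      have h2 : (k : ℝ) ≤ n := by exact_mod_cast k.2.le
      have h3 : (0 : ℝ) ≤ k := by positivity
      simp only [straighten, Real.norm_eq_abs] at h1
      rw [abs_le] at *
      constructor <;> linarith)
    (fun k k' x x' hx hx' => by
      rw [N.map_eq_map_iff hx hx', N.straighten_eq_iff hh (hu k x hx) (hl k x hx) (hu k' x' hx')
        (hl k' x' hx')]
      simp only [Glued, hmate])
  have h2 : (⋃ k, N.straighten k '' (N.bead k).dom) = Metric.closedBall (0 : H) 1 ×ˢ univ := by
    ext ⟨b, s⟩
    simp only [mem_iUnion, mem_image, mem_prod, mem_closedBall_zero_iff, mem_univ, and_true]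
    constructor
    · rintro ⟨k, x, hx, h⟩
      obtain rfl : _ = b := congrArg Prod.fst h
      exact (N.bead k).norm_inv_width_smul_le.2 hx.1
    · intro hb
      obtain ⟨k, x, h3, h4, h5, h6, -⟩ := N.exists_straighten_eq hn hb s
      refine ⟨k, x, ⟨h4, fun e he => ?_⟩, h3⟩
      cases e
      · have := h6 ((hbf k).1 he); simp; linarith
      · simpa using h5 ((hbt k).1 he)
  obtain ⟨e⟩ := h1
  exact ⟨e.trans ((Homeomorph.setCongr h2).trans ((Homeomorph.Set.prod _ _).trans
    ((Homeomorph.refl _).prodCongr (Homeomorph.Set.univ ℝ))))⟩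

/-! ### Bending the straightened chain to a loop, with the holonomy undone by a path of isometries.
-/

theorem exp_two_pi_mul_eq_iff {a b : ℝ} (ha0 : 0 ≤ a) (ha1 : a ≤ 1) (hb0 : 0 ≤ b) (hb1 : b ≤ 1) :
    Circle.exp (2 * Real.pi * a) = Circle.exp (2 * Real.pi * b) ↔
      a = b ∨ (a = 1 ∧ b = 0) ∨ (b = 1 ∧ a = 0) := by
  rw [Circle.exp_eq_exp]
  constructor
  · rintro ⟨m, hm⟩
    have h3 : a = b + m := by
      have := Real.pi_pos
      have h4 : 2 * Real.pi * a = 2 * Real.pi * (b + m) := by rw [hm]; ring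
      exact mul_left_cancel₀ (by positivity) h4
    have h5 : m ≤ 1 := by
      have : (m : ℝ) ≤ 1 := by linarith
      exact_mod_cast this
    have h6 : -1 ≤ m := by
      have : (-1 : ℝ) ≤ m := by linarith
      exact_mod_cast this
    -- Both parameters lie in `[0, 1]`, so their difference is -1, 0 or 1, and ±1 occurs only for
    -- the two ends of the interval.
    interval_cases m
    · right; right; push_cast at h3; constructor <;> linarith
    · left; simpa using h3
    · right; left; push_cast at h3; constructor <;> linarith
  · rintro (rfl | ⟨rfl, rfl⟩ | ⟨rfl, rfl⟩)
    · exact ⟨0, by simp⟩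
    · exact ⟨1, by simp⟩
    · exact ⟨-1, by simp⟩

/-- The map that bends a product of a ball with an interval of length `4 * n` to a product with a
circle, with a rotation of the balls by a path of isometries. -/
def wind (S : ℝ → H ≃ₗᵢ[ℝ] H) (n : ℕ) (y : H × ℝ) : H × Circle :=
  (S ((y.2 + 2) / (4 * n)) y.1, Circle.exp (2 * Real.pi * ((y.2 + 2) / (4 * n))))

theorem continuous_wind {S : ℝ → H ≃ₗᵢ[ℝ] H} (hS : Continuous fun x : ℝ × H => S x.1 x.2)
    (n : ℕ) : Continuous (wind S n) := by
  have h : Continuous fun y : H × ℝ => (y.2 + 2) / (4 * (n : ℝ)) := by fun_prop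
  exact (hS.comp (h.prodMk continuous_fst)).prodMk
    (Circle.exp.continuous.comp (continuous_const.mul h))

/-- The circle coordinate identifies only the levels `-2` and `4 * n - 2`. There the rotations are
`S 0 = 1` and `S 1 = Q`, so the end discs are glued by `Q`: the path `S` trivializes the mapping
torus of `Q`. -/
theorem wind_eq_wind_iff {S : ℝ → H ≃ₗᵢ[ℝ] H} {Q : H ≃ₗᵢ[ℝ] H} (hS0 : S 0 = 1) (hS1 : S 1 = Q)
    {n : ℕ} (hn : 0 < n) {y y' : H × ℝ} (hl : -2 ≤ y.2) (hu : y.2 ≤ 4 * n - 2)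
    (hl' : -2 ≤ y'.2) (hu' : y'.2 ≤ 4 * n - 2) :
    wind S n y = wind S n y' ↔ y = y' ∨ (y.2 = 4 * n - 2 ∧ y'.2 = -2 ∧ Q y.1 = y'.1) ∨
      (y'.2 = 4 * n - 2 ∧ y.2 = -2 ∧ Q y'.1 = y.1) := by
  have hn' : (0 : ℝ) < n := by exact_mod_cast hn
  have h0 : ∀ s : ℝ, (s + 2) / (4 * n) = 0 ↔ s = -2 := fun s => by
    rw [div_eq_zero_iff, or_iff_left (by positivity)]; constructor <;> intro h <;> linarith
  have h1 : ∀ s : ℝ, (s + 2) / (4 * n) = 1 ↔ s = 4 * n - 2 := fun s => by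
    rw [div_eq_one_iff_eq (by positivity)]; constructor <;> intro h <;> linarith
  have h01 : ∀ s : ℝ, -2 ≤ s → s ≤ 4 * n - 2 →
      0 ≤ (s + 2) / (4 * n) ∧ (s + 2) / (4 * n) ≤ 1 := fun s h h' =>
    ⟨div_nonneg (by linarith) (by positivity), by rw [div_le_one (by positivity)]; linarith⟩
  unfold wind
  rw [Prod.mk_inj, exp_two_pi_mul_eq_iff (h01 _ hl hu).1 (h01 _ hl hu).2 (h01 _ hl' hu').1
    (h01 _ hl' hu').2]
  constructor
  · rintro ⟨h, hs | ⟨hs, hs'⟩ | ⟨hs, hs'⟩⟩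
    · rw [hs] at h
      rw [div_left_inj' (by positivity)] at hs
      exact Or.inl (Prod.ext ((S _).injective h) (by linarith))
    · rw [hs, hs', hS0, hS1] at h
      exact Or.inr (Or.inl ⟨(h1 _).1 hs, (h0 _).1 hs', h⟩)
    · rw [hs, hs', hS0, hS1] at h
      exact Or.inr (Or.inr ⟨(h1 _).1 hs, (h0 _).1 hs', h.symm⟩)
  · rintro (h | ⟨a, b, h⟩ | ⟨a, b, h⟩)
    · rw [h]; exact ⟨rfl, Or.inl rfl⟩
    · rw [(h1 _).2 a, (h0 _).2 b, hS0, hS1]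
      exact ⟨h, Or.inr (Or.inl ⟨rfl, rfl⟩)⟩
    · rw [(h1 _).2 a, (h0 _).2 b, hS0, hS1]
      exact ⟨h.symm, Or.inr (Or.inr ⟨rfl, rfl⟩)⟩

theorem exists_wind_eq (S : ℝ → H ≃ₗᵢ[ℝ] H) {n : ℕ} (hn : 0 < n) {b : H} (hb : ‖b‖ ≤ 1)
    (c : Circle) :
    ∃ y : H × ℝ, ‖y.1‖ ≤ 1 ∧ -2 ≤ y.2 ∧ y.2 ≤ 4 * n - 2 ∧ wind S n y = (b, c) := by
  have hn' : (0 : ℝ) < n := by exact_mod_cast hn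
  -- The angle of `c` in full turns, normalized to `[0, 1)`.
  set θ := Int.fract (Complex.arg c / (2 * Real.pi)) with hθdef
  have hθ0 : 0 ≤ θ := Int.fract_nonneg _
  have hθ1 : θ < 1 := Int.fract_lt_one _
  have hθ : Circle.exp (2 * Real.pi * θ) = c := by
    rw [← Circle.exp_arg c, Circle.exp_eq_exp]
    refine ⟨-⌊Complex.arg c / (2 * Real.pi)⌋, ?_⟩
    have := Real.pi_pos
    rw [hθdef, Int.fract]
    push_cast
    field_simp
    ring
  have hs : (4 * n * θ - 2 + 2) / (4 * n) = θ := by field_simp; ring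
  refine ⟨((S θ).symm b, 4 * n * θ - 2), by simpa using hb, ?_, ?_, ?_⟩
  · simp only; nlinarith [mul_nonneg hn'.le hθ0]
  · simp only; nlinarith
  · simp only [wind, hs, hθ, LinearIsometryEquiv.apply_symm_apply]

/-- A necklace whose beads are joined in a circle, such that the holonomy is isotopic to the
identity, is a product of a ball with a circle. -/
theorem nonempty_homeomorph_circle [ProperSpace H] [MetricSpace E] {n : ℕ} (N : Necklace H E n)
    (hn : 0 < n) (Q : H ≃ₗᵢ[ℝ] H)
    (hmate : ∀ k k' z z', N.mate k k' z z' ↔ ((k' : ℕ) = k + 1 ∧ z' = z) ∨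
      ((k : ℕ) + 1 = n ∧ (k' : ℕ) = 0 ∧ z' = Q z))
    (hh : ∀ k k' : Fin n, (k' : ℕ) = k + 1 → (N.bead k).height true = (N.bead k').height false)
    (hh' : ∀ k k' : Fin n, (k : ℕ) + 1 = n → (k' : ℕ) = 0 →
      (N.bead k).height true = (N.bead k').height false)
    (hb : ∀ k e, (N.bead k).bounded e)
    (S : ℝ → H ≃ₗᵢ[ℝ] H) (hS : Continuous fun x : ℝ × H => S x.1 x.2)
    (hS0 : S 0 = 1) (hS1 : S 1 = Q) :
    Nonempty (↥(⋃ k, (N.bead k).map '' (N.bead k).dom) ≃ₜ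
      Metric.closedBall (0 : H) 1 × Circle) := by
  have hu : ∀ k, ∀ x ∈ (N.bead k).dom, x.2 ≤ 2 := fun k x hx => by
    simpa using hx.2 true (hb k _)
  have hl : ∀ k, ∀ x ∈ (N.bead k).dom, -2 ≤ x.2 := fun k x hx => by
    have := hx.2 false (hb k _)
    simp at this; linarith
  have hbd : ∀ k, ∀ s ⊆ (N.bead k).dom, Bornology.IsBounded s := fun k s hs =>
    (N.bead k).isBounded_of_snd hs (a := 2) fun x hx =>
      abs_le.2 ⟨hl k x (hs hx), hu k x (hs hx)⟩
  have hlast : ∀ (k : Fin n) (x), x ∈ (N.bead k).dom → (N.straighten k x).2 ≤ 4 * n - 2 ∧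
      ((N.straighten k x).2 = 4 * n - 2 ↔ (k : ℕ) + 1 = n ∧ x.2 = 2) := fun k x hx => by
    have h1 := hu k x hx
    have h2 : (k : ℝ) + 1 ≤ n := by exact_mod_cast k.2
    simp only [straighten]
    refine ⟨by linarith, fun h => ⟨?_, by linarith⟩, fun ⟨h, h'⟩ => ?_⟩
    · have : (n : ℝ) ≤ k + 1 := by linarith
      have : n ≤ k + 1 := by exact_mod_cast this
      omega
    · have : (k : ℝ) + 1 = n := by exact_mod_cast h
      linarith
  have hfirst : ∀ (k : Fin n) (x), x ∈ (N.bead k).dom → -2 ≤ (N.straighten k x).2 ∧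
      ((N.straighten k x).2 = -2 ↔ (k : ℕ) = 0 ∧ x.2 = -2) := fun k x hx => by
    have h1 := hl k x hx
    have h2 : (0 : ℝ) ≤ k := by positivity
    simp only [straighten]
    refine ⟨by linarith, fun h => ⟨?_, by linarith⟩, fun ⟨h, h'⟩ => ?_⟩
    · have : (k : ℝ) ≤ 0 := by linarith
      have : (k : ℕ) ≤ 0 := by exact_mod_cast this
      omega
    · rw [h, h']; norm_num
  -- The last end disc and the first one have the same width by `hh'`, and the linear map `Q`
  -- commutes with the rescaling by it.
  have hseam : ∀ (k k' : Fin n) (x x' : H × ℝ), (k : ℕ) + 1 = n → x.2 = 2 → (k' : ℕ) = 0 →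
      x'.2 = -2 → (Q (N.straighten k x).1 = (N.straighten k' x').1 ↔ x'.1 = Q x.1) := by
    intro k k' x x' hk h2 hk' h2'
    simp only [straighten]
    rw [h2, h2', Bead.width_neg_two, ← hh' _ _ hk hk', ← Bead.width_two, map_smul, eq_comm]
    exact (smul_right_injective H (inv_ne_zero ((N.bead k).width_pos 2).ne')).eq_iff
  have hfib : ∀ k k' x x', x ∈ (N.bead k).dom → x' ∈ (N.bead k').dom →
      ((N.bead k).map x = (N.bead k').map x' ↔
        wind S n (N.straighten k x) = wind S n (N.straighten k' x')) := by
    intro k k' x x' hx hx'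
    rw [N.map_eq_map_iff hx hx', wind_eq_wind_iff hS0 hS1 hn (hfirst k x hx).1 (hlast k x hx).1
      (hfirst k' x' hx').1 (hlast k' x' hx').1,
      N.straighten_eq_iff hh (fun _ => hu k x hx) (fun _ => hl k x hx)
        (fun _ => hu k' x' hx') (fun _ => hl k' x' hx'),
      (hlast k x hx).2, (hfirst k' x' hx').2, (hlast k' x' hx').2, (hfirst k x hx).2]
    simp only [Glued, hmate]
    have h1 := hseam k k' x x'
    have h2 := hseam k' k x' x
    constructor
    · rintro (h | ⟨a, b, h | ⟨c, d, h⟩⟩ | ⟨a, b, h | ⟨c, d, h⟩⟩)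
      · exact Or.inl (Or.inl h)
      · exact Or.inl (Or.inr (Or.inl ⟨a, b, h⟩))
      · exact Or.inr (Or.inl ⟨⟨c, a⟩, ⟨d, b⟩, (h1 c a d b).2 h⟩)
      · exact Or.inl (Or.inr (Or.inr ⟨a, b, h⟩))
      · exact Or.inr (Or.inr ⟨⟨c, a⟩, ⟨d, b⟩, (h2 c a d b).2 h⟩)
    · rintro ((h | ⟨a, b, h⟩ | ⟨a, b, h⟩) | ⟨⟨c, a⟩, ⟨d, b⟩, h⟩ | ⟨⟨c, a⟩, ⟨d, b⟩, h⟩)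
      · exact Or.inl h
      · exact Or.inr (Or.inl ⟨a, b, Or.inl h⟩)
      · exact Or.inr (Or.inr ⟨a, b, Or.inl h⟩)
      · exact Or.inr (Or.inl ⟨a, b, Or.inr ⟨c, d, (h1 c a d b).1 h⟩⟩)
      · exact Or.inr (Or.inr ⟨a, b, Or.inr ⟨c, d, (h2 c a d b).1 h⟩⟩)
  have h1 := nonempty_homeomorph_iUnion_image (fun k => (N.bead k).isClosed_dom)
    (f := fun k => (N.bead k).map) (g := fun k x => wind S n (N.straighten k x))
    (fun k => (N.bead k).continuousOn_map)
    (fun k => ((continuous_wind hS n).comp (N.continuous_straighten k)).continuousOn)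
    (fun k B _ => hbd k _ inter_subset_left) (fun k B _ => hbd k _ inter_subset_left) hfib
  have h2 : (⋃ k, (fun x => wind S n (N.straighten k x)) '' (N.bead k).dom) =
      Metric.closedBall (0 : H) 1 ×ˢ univ := by
    ext ⟨b, c⟩
    simp only [mem_iUnion, mem_image, mem_prod, mem_closedBall_zero_iff, mem_univ, and_true]
    constructor
    · rintro ⟨k, x, hx, h⟩
      obtain rfl : _ = b := congrArg Prod.fst h
      simp only [wind, LinearIsometryEquiv.norm_map]
      exact (N.bead k).norm_inv_width_smul_le.2 hx.1
    · intro hb'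
      obtain ⟨y, hy1, hy2, hy3, hy⟩ := exists_wind_eq S hn hb' c
      obtain ⟨k, x, h3, h4, -, -, h5, h6⟩ := N.exists_straighten_eq hn hy1 y.2
      refine ⟨k, x, ⟨h4, fun e _ => ?_⟩, by rw [h3]; exact hy⟩
      have h7 := h5 hy2
      have h8 := h6 hy3
      cases e <;> simp <;> linarith
  obtain ⟨e⟩ := h1
  exact ⟨e.trans ((Homeomorph.setCongr h2).trans ((Homeomorph.Set.prod _ _).trans
    ((Homeomorph.refl _).prodCongr (Homeomorph.Set.univ Circle))))⟩

end Necklace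
end

/-! ### Paths of isometries, reflections and determinants. -/

noncomputable section

section isotopy

open Submodule

variable {H : Type*} [NormedAddCommGroup H] [InnerProductSpace ℝ H]

/-- There is a path of linear isometries from the identity to `Q`. -/
def IsotopicToId (Q : H ≃ₗᵢ[ℝ] H) : Prop :=
  ∃ S : ℝ → H ≃ₗᵢ[ℝ] H, (Continuous fun x : ℝ × H => S x.1 x.2) ∧ S 0 = 1 ∧ S 1 = Q

theorem isotopicToId_one : IsotopicToId (1 : H ≃ₗᵢ[ℝ] H) :=
  ⟨fun _ => 1, continuous_snd, rfl, rfl⟩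

theorem IsotopicToId.mul {Q Q' : H ≃ₗᵢ[ℝ] H} (h : IsotopicToId Q) (h' : IsotopicToId Q') :
    IsotopicToId (Q * Q') := by
  obtain ⟨S, hS, h0, h1⟩ := h
  obtain ⟨S', hS', h0', h1'⟩ := h'
  exact ⟨fun t => S t * S' t, hS.comp (continuous_fst.prodMk hS'), by simp [h0, h0'],
    by simp [h1, h1']⟩

/-- The explicit formula shows continuity in `v ≠ 0`; for `v = 0` it gives the identity. -/
theorem reflection_orthogonal_singleton_apply (v x : H) :
    (ℝ ∙ v)ᗮ.reflection x = x - (2 * (inner ℝ v x / ‖v‖ ^ 2)) • v := by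
  rw [reflection_orthogonal_apply, reflection_singleton_apply]
  simp [two_smul, two_mul, add_smul]

/-- Move the vector of the left reflection from `v` to `u` along a segment. The segment avoids 0 if
the vectors are linearly independent, and at its start the two reflections cancel. For parallel
vectors the reflections coincide and the product is already the identity. -/
theorem isotopicToId_reflection_mul_reflection {u v : H} (hu : u ≠ 0) (hv : v ≠ 0) :
    IsotopicToId ((ℝ ∙ u)ᗮ.reflection * (ℝ ∙ v)ᗮ.reflection) := by
  by_cases hd : ∃ c : ℝ, v = c • u
  · obtain ⟨c, rfl⟩ := hd
    have hc : c ≠ 0 := fun h => hv (by simp [h])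
    have : (ℝ ∙ (c • u)) = ℝ ∙ u := span_singleton_smul_eq (IsUnit.mk0 c hc) u
    have h1 : (ℝ ∙ u)ᗮ.reflection * (ℝ ∙ (c • u))ᗮ.reflection = 1 := by
      simp only [this]
      exact reflection_mul_reflection _
    rw [h1]
    exact isotopicToId_one
  · let w : ℝ → H := fun t => (1 - t) • v + t • u
    have hw : ∀ t, w t ≠ 0 := fun t ht => by
      by_cases h1 : 1 - t = 0
      · have : t = 1 := by linarith
        subst this
        simp only [w, sub_self, zero_smul, one_smul, zero_add] at ht
        exact hu ht
      · refine hd ⟨-(t / (1 - t)), ?_⟩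
        have h2 : (1 - t) • v = -(t • u) := eq_neg_of_add_eq_zero_left ht
        rw [← inv_smul_smul₀ h1 v, h2, smul_neg, smul_smul, neg_smul, div_eq_inv_mul]
    have hwc : Continuous w := by simp only [w]; fun_prop
    have hw0 : w 0 = v := by simp [w]
    have hw1 : w 1 = u := by simp [w]
    clear_value w
    let S : ℝ → H ≃ₗᵢ[ℝ] H := fun t => (ℝ ∙ w t)ᗮ.reflection * (ℝ ∙ v)ᗮ.reflection
    refine ⟨S, ?_, ?_, ?_⟩
    · have h1 : Continuous fun x : ℝ × H => (ℝ ∙ w x.1)ᗮ.reflection x.2 := by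
        simp only [reflection_orthogonal_singleton_apply]
        refine continuous_snd.sub ((continuous_const.mul ?_).smul (hwc.comp continuous_fst))
        exact Continuous.div ((hwc.comp continuous_fst).inner continuous_snd)
          ((hwc.comp continuous_fst).norm.pow 2)
          fun x => pow_ne_zero 2 (norm_ne_zero_iff.2 (hw x.1))
      have h2 : Continuous fun x : ℝ × H => (x.1, (ℝ ∙ v)ᗮ.reflection x.2) :=
        continuous_fst.prodMk ((LinearIsometryEquiv.continuous _).comp continuous_snd)
      refine (h1.comp h2).congr fun x => ?_
      simp only [S, Function.comp_apply, LinearIsometryEquiv.coe_mul]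
    · simp only [S, hw0]
      exact reflection_mul_reflection _
    · simp only [S, hw1]

theorem isotopicToId_list_prod :
    ∀ l : List H, (∀ v ∈ l, v ≠ 0) → Even l.length →
      IsotopicToId (l.map fun v => (ℝ ∙ v)ᗮ.reflection).prod
  | [], _, _ => isotopicToId_one
  | [_], _, h => by simp at h
  | u :: v :: l, h0, h => by
    rw [List.map_cons, List.map_cons, List.prod_cons, List.prod_cons, ← mul_assoc]
    refine (isotopicToId_reflection_mul_reflection (h0 u (by simp)) (h0 v (by simp))).mul
      (isotopicToId_list_prod l (fun w hw => h0 w (by simp [hw])) ?_)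
    simpa [Nat.even_add_one] using h

/-- Cartan–Dieudonné. Zero vectors contribute the identity and are dropped, so that every factor has
determinant -1 and the determinant records the parity of the length. -/
theorem exists_list_reflection [FiniteDimensional ℝ H] (Q : H ≃ₗᵢ[ℝ] H) :
    ∃ l : List H, (∀ v ∈ l, v ≠ 0) ∧ Q = (l.map fun v => (ℝ ∙ v)ᗮ.reflection).prod := by
  obtain ⟨l, -, hl⟩ := Q.reflections_generate_dim
  have key : ∀ l : List H, ∃ l' : List H, (∀ v ∈ l', v ≠ 0) ∧
      (l.map fun v => (ℝ ∙ v)ᗮ.reflection).prod = (l'.map fun v => (ℝ ∙ v)ᗮ.reflection).prod := by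
    intro l
    induction l with
    | nil => exact ⟨[], by simp, rfl⟩
    | cons v l ih =>
      obtain ⟨l', h0, h⟩ := ih
      by_cases hv : v = 0
      · refine ⟨l', h0, ?_⟩
        rw [List.map_cons, List.prod_cons, h]
        ext x
        rw [hv, LinearIsometryEquiv.coe_mul, Function.comp_apply,
          reflection_orthogonal_singleton_apply, smul_zero, sub_zero]
      · exact ⟨v :: l', by simpa [hv] using h0, by simp [h]⟩
  obtain ⟨l', h0, h⟩ := key l
  exact ⟨l', h0, hl.trans h⟩

/-- The determinant of a linear isometry. -/
def isoDet (A : H ≃ₗᵢ[ℝ] H) : ℝ := LinearMap.det (A.toLinearEquiv : H →ₗ[ℝ] H)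

theorem isoDet_mul (A B : H ≃ₗᵢ[ℝ] H) : isoDet (A * B) = isoDet A * isoDet B := by
  unfold isoDet
  rw [← LinearMap.det_comp]; rfl

theorem isoDet_one : isoDet (1 : H ≃ₗᵢ[ℝ] H) = 1 := LinearMap.det_id

theorem isoDet_inv (A : H ≃ₗᵢ[ℝ] H) : isoDet A * isoDet A.symm = 1 := by
  rw [← isoDet_mul, ← isoDet_one (H := H)]
  congr 1
  ext x; simp

theorem isoDet_reflection [FiniteDimensional ℝ H] {v : H} (hv : v ≠ 0) :
    isoDet (ℝ ∙ v)ᗮ.reflection = -1 := by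
  have := det_reflection (𝕜 := ℝ) (ℝ ∙ v)ᗮ
  rw [orthogonal_orthogonal, finrank_span_singleton hv, pow_one] at this
  exact this

theorem isoDet_list_prod [FiniteDimensional ℝ H] (l : List H) (h0 : ∀ v ∈ l, v ≠ 0) :
    isoDet (l.map fun v => (ℝ ∙ v)ᗮ.reflection).prod = (-1) ^ l.length := by
  induction l with
  | nil => exact isoDet_one
  | cons v l ih =>
    rw [List.map_cons, List.prod_cons, isoDet_mul, isoDet_reflection (h0 v (by simp)),
      ih fun w hw => h0 w (by simp [hw]), List.length_cons, pow_succ, mul_comm]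

variable {E : Type*} [NormedAddCommGroup E] [InnerProductSpace ℝ E] [FiniteDimensional ℝ E]

/-- An isometry with determinant one of an ambient space, that is the identity on the orthogonal
complement of a subspace, restricts on that subspace to an isometry isotopic to the identity. -/
theorem isotopicToId_of_isoDet [FiniteDimensional ℝ H] (j : H →ₗᵢ[ℝ] E) (Q' : E ≃ₗᵢ[ℝ] E)
    (hdet : isoDet Q' = 1) (hfix : ∀ x, (∀ z, inner ℝ (j z) x = 0) → Q' x = x) :
    ∃ Q : H ≃ₗᵢ[ℝ] H, IsotopicToId Q ∧ ∀ z, Q' (j z) = j (Q z) := by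
  let R : Submodule ℝ E := LinearMap.range j.toLinearMap
  have hfixR : ∀ x ∈ Rᗮ, Q' x = x := fun x hx =>
    hfix x fun z => (mem_orthogonal _ _).1 hx _ ⟨z, rfl⟩
  -- `Q'` fixes the complement of the range pointwise and preserves inner products, so it maps the
  -- range into the double complement, which is the range itself.
  have hmem : ∀ z, ∃ z', j z' = Q' (j z) := fun z => by
    have : Q' (j z) ∈ Rᗮᗮ := by
      rw [mem_orthogonal]
      intro x hx
      rw [← hfixR x hx, Q'.inner_map_map, real_inner_comm]
      exact (mem_orthogonal _ _).1 hx _ ⟨z, rfl⟩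
    rw [orthogonal_orthogonal] at this
    exact this
  choose f hf using hmem
  let F : H →ₗᵢ[ℝ] H :=
    { toFun := f
      map_add' := fun x y => j.injective (by simp [hf])
      map_smul' := fun c x => j.injective (by simp [hf])
      norm_map' := fun x => by
        have := congrArg norm (hf x)
        simpa using this }
  let Q : H ≃ₗᵢ[ℝ] H := F.toLinearIsometryEquiv rfl
  have hQ : ∀ z, Q' (j z) = j (Q z) := fun z => (hf z).symm
  refine ⟨Q, ?_, hQ⟩
  obtain ⟨l, h0, hl⟩ := exists_list_reflection Q
  have hj0 : ∀ v ∈ l.map j, v ≠ 0 := by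
    intro v hv
    obtain ⟨w, hw, rfl⟩ := List.mem_map.1 hv
    exact fun h => h0 w hw (j.injective (by simpa using h))
  -- The reflections that compose `Q`, taken in the ambient space, compose `Q'`: they act alike on
  -- the range, and they fix its complement. So the determinant of `Q'` decides the parity for `Q`.
  have hQ' : Q' = ((l.map j).map fun v => (ℝ ∙ v)ᗮ.reflection).prod := by
    have h1 : ∀ (l : List H) z, ((l.map j).map fun v => (ℝ ∙ v)ᗮ.reflection).prod (j z) =
        j ((l.map fun v => (ℝ ∙ v)ᗮ.reflection).prod z) := by
      intro l
      induction l with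
      | nil => intro z; rfl
      | cons v l ih =>
        intro z
        simp only [List.map_cons, List.prod_cons, LinearIsometryEquiv.coe_mul, Function.comp_apply,
          ih, reflection_orthogonal_singleton_apply]
        simp
    have h2 : ∀ (l : List H) x, x ∈ Rᗮ →
        ((l.map j).map fun v => (ℝ ∙ v)ᗮ.reflection).prod x = x := by
      intro l x hx
      induction l with
      | nil => rfl
      | cons v l ih =>
        simp only [List.map_cons, List.prod_cons, LinearIsometryEquiv.coe_mul, Function.comp_apply,
          ih, reflection_orthogonal_singleton_apply]
        have : inner ℝ (j v) x = 0 := (mem_orthogonal _ _).1 hx _ ⟨v, rfl⟩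
        simp [this]
    ext1 x
    obtain ⟨y, hy, z, hz, rfl⟩ := R.exists_add_mem_mem_orthogonal x
    obtain ⟨w, rfl⟩ := hy
    rw [map_add, map_add, hfixR z hz, h2 l z hz]
    congr 1
    have h3 := h1 l w
    rw [← hl, ← hQ w] at h3
    exact h3.symm
  rw [hl]
  refine isotopicToId_list_prod l h0 ?_
  rw [hQ', isoDet_list_prod _ hj0, List.length_map] at hdet
  by_contra hodd
  rw [(Nat.not_even_iff_odd.1 hodd).neg_one_pow] at hdet
  norm_num at hdet

end isotopy
end

/-! ### Coordinates on a cap and on its rim. -/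

noncomputable section

namespace HyperCap

variable {d : ℕ} (C : HyperCap d)

theorem radius_pos : 0 < C.sphere.radius := by linarith [C.size_pos, C.size_lt]

theorem apex_sub_center : C.apex - C.sphere.center = C.sphere.radius • C.normal := by
  rw [normal, smul_inv_smul₀ C.radius_pos.ne']

theorem norm_normal : ‖C.normal‖ = 1 := by
  have h : ‖C.apex - C.sphere.center‖ = C.sphere.radius := by
    rw [← dist_eq_norm]; exact C.apex_mem
  rw [normal, norm_smul, h, norm_inv, Real.norm_of_nonneg C.radius_pos.le,
    inv_mul_cancel₀ C.radius_pos.ne']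

theorem size_div_lt_one : C.size / (2 * C.sphere.radius) < 1 := by
  have := C.radius_pos
  rw [div_lt_one (by positivity)]; exact C.size_lt

/-- The bound `size < 2 * radius` keeps the chord of length `size * r` shorter than the diameter;
hence the coefficient of `y` in `param` does not vanish. -/
theorem one_sub_pos {r : ℝ} (h0 : 0 ≤ r) (h1 : r ≤ 1) :
    0 < 1 - (C.size * r / (2 * C.sphere.radius)) ^ 2 := by
  have hR := C.radius_pos
  have hs := C.size_pos
  have h2 : C.size * r / (2 * C.sphere.radius) ≤ C.size / (2 * C.sphere.radius) := by
    gcongr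
    nlinarith
  have h3 : 0 ≤ C.size * r / (2 * C.sphere.radius) := by positivity
  nlinarith [C.size_div_lt_one]

theorem rimRadius_pos : 0 < C.rimRadius := by
  have := C.one_sub_pos zero_le_one le_rfl
  rw [mul_one] at this
  exact mul_pos C.size_pos (Real.sqrt_pos.2 this)

/-- The (equal area) parametrization of a cap by the unit ball of the hyperplane orthogonal to its
normal. -/
def param (y : Euc d) : Euc d :=
  C.apex - (C.size ^ 2 * ‖y‖ ^ 2 / (2 * C.sphere.radius)) • C.normal +
    (C.size * √(1 - (C.size * ‖y‖ / (2 * C.sphere.radius)) ^ 2)) • y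

theorem continuous_param : Continuous C.param := by unfold param; fun_prop

theorem param_of_norm_eq_one {y : Euc d} (h : ‖y‖ = 1) :
    C.param y = C.rimCenter + C.rimRadius • y := by
  simp [param, rimCenter, rimRadius, h]

theorem norm_sq_smul_add_smul {u y : Euc d} (hu : ‖u‖ = 1) (hy : inner ℝ u y = 0) (a b : ℝ) :
    ‖a • u + b • y‖ ^ 2 = a ^ 2 + b ^ 2 * ‖y‖ ^ 2 := by
  rw [norm_add_sq_real, inner_smul_left, inner_smul_right, hy, norm_smul, norm_smul, hu]
  simp [mul_pow]

/-- A chord of length `a` from the apex of a sphere of radius `R` descends by `a² / (2R)` along the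
normal, so its horizontal part has length `a √(1 - (a / 2R)²)`. The map `param` realizes this with
`a = size * ‖y‖`. -/
theorem dist_param_apex {C : HyperCap d} {y : Euc d} (hy : inner ℝ C.normal y = 0) (h1 : ‖y‖ ≤ 1) :
    dist (C.param y) C.apex = C.size * ‖y‖ := by
  have hR := C.radius_pos
  have hs := C.size_pos
  have h : C.param y - C.apex = (-(C.size ^ 2 * ‖y‖ ^ 2 / (2 * C.sphere.radius))) • C.normal +
      (C.size * √(1 - (C.size * ‖y‖ / (2 * C.sphere.radius)) ^ 2)) • y := by
    unfold param; module
  rw [dist_eq_norm, ← sq_eq_sq₀ (norm_nonneg _) (by positivity), h,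
    norm_sq_smul_add_smul C.norm_normal hy, mul_pow C.size (√_),
    Real.sq_sqrt (C.one_sub_pos (norm_nonneg y) h1).le]
  field_simp
  ring

theorem param_mem_sphere {C : HyperCap d} {y : Euc d} (hy : inner ℝ C.normal y = 0) (h1 : ‖y‖ ≤ 1) :
    C.param y ∈ C.sphere := by
  have hR := C.radius_pos
  have h : C.param y - C.sphere.center =
      (C.sphere.radius - C.size ^ 2 * ‖y‖ ^ 2 / (2 * C.sphere.radius)) • C.normal +
      (C.size * √(1 - (C.size * ‖y‖ / (2 * C.sphere.radius)) ^ 2)) • y := by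
    rw [sub_smul, ← apex_sub_center]; unfold param; module
  rw [EuclideanGeometry.mem_sphere, dist_eq_norm, ← sq_eq_sq₀ (norm_nonneg _) hR.le, h,
    norm_sq_smul_add_smul C.norm_normal hy, mul_pow C.size (√_),
    Real.sq_sqrt (C.one_sub_pos (norm_nonneg y) h1).le]
  field_simp
  ring

theorem param_mem_carrier {C : HyperCap d} {y : Euc d} (hy : inner ℝ C.normal y = 0)
    (h1 : ‖y‖ ≤ 1) :
    C.param y ∈ C.carrier :=
  ⟨param_mem_sphere hy h1, by
    rw [dist_param_apex hy h1]; nlinarith [C.size_pos, norm_nonneg y]⟩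

/-- The distance to the apex determines `‖y‖`, and then `param` is affine in `y` with a nonzero
coefficient. -/
theorem eq_of_param_eq {C : HyperCap d} {y : Euc d} (hy : inner ℝ C.normal y = 0) (h1 : ‖y‖ ≤ 1)
    {y' : Euc d} (hy' : inner ℝ C.normal y' = 0) (h1' : ‖y'‖ ≤ 1)
    (h : C.param y = C.param y') : y = y' := by
  have hn : ‖y‖ = ‖y'‖ := by
    have := dist_param_apex hy h1
    rw [h, dist_param_apex hy' h1'] at this
    exact (mul_left_cancel₀ C.size_pos.ne' this).symm
  have hb : C.size * √(1 - (C.size * ‖y‖ / (2 * C.sphere.radius)) ^ 2) ≠ 0 :=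
    (mul_pos C.size_pos (Real.sqrt_pos.2 (C.one_sub_pos (norm_nonneg y) h1))).ne'
  unfold param at h
  rw [← hn] at h
  exact smul_right_injective _ hb (add_left_cancel h)

theorem exists_param_eq {p : Euc d} (hp : p ∈ C.carrier) :
    ∃ y, inner ℝ C.normal y = 0 ∧ ‖y‖ = dist p C.apex / C.size ∧ ‖y‖ ≤ 1 ∧ C.param y = p := by
  have hR := C.radius_pos
  have hs := C.size_pos
  obtain ⟨hp1, hp2⟩ := hp
  set r := dist p C.apex with hr
  have hr0 : 0 ≤ r := dist_nonneg
  have hq0 : 0 ≤ r / C.size := by positivity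
  have hq1 : r / C.size ≤ 1 := (div_le_one hs).2 hp2
  have hsr : C.size * (r / C.size) = r := by field_simp
  have hpos := C.one_sub_pos hq0 hq1
  rw [hsr] at hpos
  set b := C.size * √(1 - (r / (2 * C.sphere.radius)) ^ 2) with hb
  have hb0 : 0 < b := mul_pos hs (Real.sqrt_pos.2 hpos)
  have hb2 : b ^ 2 = C.size ^ 2 * (1 - (r / (2 * C.sphere.radius)) ^ 2) := by
    rw [hb, mul_pow, Real.sq_sqrt hpos.le]
  set w := p - C.apex with hw
  have hwn : ‖w‖ = r := by rw [hr, dist_eq_norm]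
  -- Squaring the equation `‖w + R u‖ = R` of the sphere gives the component of the chord along the
  -- normal.
  have hin : inner ℝ C.normal w = -(r ^ 2 / (2 * C.sphere.radius)) := by
    have h1 : ‖w + C.sphere.radius • C.normal‖ = C.sphere.radius := by
      rw [← apex_sub_center, hw, sub_add_sub_cancel, ← dist_eq_norm]; exact hp1
    have h2 : ‖w + C.sphere.radius • C.normal‖ ^ 2 = C.sphere.radius ^ 2 := by rw [h1]
    rw [norm_add_sq_real, inner_smul_right, norm_smul, C.norm_normal, hwn, mul_one,
        Real.norm_eq_abs,
      sq_abs, real_inner_comm] at h2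
    field_simp
    linarith
  -- The horizontal part of the chord, divided by the factor that `param` applies.
  set y := b⁻¹ • (w + (r ^ 2 / (2 * C.sphere.radius)) • C.normal) with hy
  have hyu : inner ℝ C.normal y = 0 := by
    rw [hy, inner_smul_right, inner_add_right, inner_smul_right, hin, real_inner_self_eq_norm_sq,
      C.norm_normal]
    ring
  have hyn : ‖y‖ = r / C.size := by
    rw [← sq_eq_sq₀ (norm_nonneg _) hq0, hy, norm_smul, mul_pow, norm_add_sq_real, inner_smul_right,
      real_inner_comm, hin, norm_smul, C.norm_normal, hwn, mul_one, Real.norm_eq_abs, sq_abs,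
      Real.norm_eq_abs, sq_abs, inv_pow, hb2]
    have h3 : C.size ^ 2 * (1 - (r / (2 * C.sphere.radius)) ^ 2) ≠ 0 := (by positivity)
    rw [inv_mul_eq_div, div_eq_iff h3]
    field_simp
    ring
  refine ⟨y, hyu, hyn, hyn ▸ hq1, ?_⟩
  unfold param
  rw [hyn, hsr, ← hb, hy, smul_inv_smul₀ hb0.ne', ← mul_pow, hsr, hw]
  module

/-- On unit vectors `param` is the similarity `y ↦ rimCenter + rimRadius • y`, so a foot corresponds
to a polar cap of the unit sphere, independently of the size of the rim. -/
theorem foot_carrier_eq {C : HyperCap d} (F : Foot C) : F.carrier =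
    C.param '' {y | inner ℝ C.normal y = 0 ∧ ‖y‖ = 1 ∧ F.height ≤ inner ℝ F.pole y} := by
  have hρ := C.rimRadius_pos
  have key : ∀ y : Euc d, ‖y‖ = 1 → (F.height * C.rimRadius ≤
      inner ℝ F.pole (C.param y - C.rimCenter) ↔ F.height ≤ inner ℝ F.pole y) := fun y h => by
    rw [C.param_of_norm_eq_one h, add_sub_cancel_left, inner_smul_right, mul_comm]
    exact mul_le_mul_iff_right₀ hρ
  ext p
  constructor
  · rintro ⟨⟨hp1, hp2⟩, hp3⟩
    obtain ⟨y, h1, h2, -, rfl⟩ := C.exists_param_eq ⟨hp1, hp2.le⟩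
    rw [hp2, div_self C.size_pos.ne'] at h2
    exact ⟨y, ⟨h1, h2, (key y h2).1 hp3⟩, rfl⟩
  · rintro ⟨y, ⟨h1, h2, h3⟩, rfl⟩
    refine ⟨⟨param_mem_sphere h1 h2.le, ?_⟩, (key y h2).2 h3⟩
    rw [dist_param_apex h1 h2.le, h2, mul_one]

end HyperCap

/-- In the coordinates of the caps the scaling of the rims disappears, and the gluing of a link is a
linear isometry. -/
theorem Link.glue_param {d : ℕ} {C C' : HyperCap d} (L : Link C C') {y : Euc d} (h : ‖y‖ = 1) :
    L.glue (C.param y) = C'.param (L.frame y) := by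
  have h' : ‖L.frame y‖ = 1 := by rw [LinearIsometryEquiv.norm_map, h]
  rw [glue, C.param_of_norm_eq_one h, C'.param_of_norm_eq_one h', add_sub_cancel_left, map_smul,
    smul_smul, div_mul_cancel₀ _ C.rimRadius_pos.ne']

/-! ### Splitting off normal and pole, and the beads formed by caps with arms. -/

/-- An orthogonal decomposition of a Euclidean space into two lines, spanned by the unit vectors
`u` and `h`, and the image of a space `H`. -/
structure Splitting (H E : Type*) [NormedAddCommGroup H] [InnerProductSpace ℝ H]
    [NormedAddCommGroup E] [InnerProductSpace ℝ E] where
  u : E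
  h : E
  j : H →ₗᵢ[ℝ] E
  norm_u : ‖u‖ = 1
  norm_h : ‖h‖ = 1
  inner_u_h : inner ℝ u h = 0
  inner_u_j : ∀ z, inner ℝ u (j z) = 0
  inner_h_j : ∀ z, inner ℝ h (j z) = 0
  exists_j : ∀ x, inner ℝ u x = 0 → inner ℝ h x = 0 → ∃ z, j z = x

namespace Splitting

variable {H E : Type*} [NormedAddCommGroup H] [InnerProductSpace ℝ H]
    [NormedAddCommGroup E] [InnerProductSpace ℝ E] (M : Splitting H E)

/-- The points of the hyperplane orthogonal to `u`. -/
def pt (x : H × ℝ) : E := x.2 • M.h + M.j x.1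

theorem continuous_pt : Continuous M.pt := by
  have := M.j.continuous
  unfold pt; fun_prop

theorem inner_u_pt (x : H × ℝ) : inner ℝ M.u (M.pt x) = 0 := by
  simp [pt, inner_add_right, inner_smul_right, M.inner_u_h, M.inner_u_j]

theorem inner_h_pt (x : H × ℝ) : inner ℝ M.h (M.pt x) = x.2 := by
  simp [pt, inner_add_right, inner_smul_right, M.inner_h_j, M.norm_h]

theorem norm_pt_sq (x : H × ℝ) : ‖M.pt x‖ ^ 2 = ‖x.1‖ ^ 2 + x.2 ^ 2 := by
  rw [pt, norm_add_sq_real, inner_smul_left, M.inner_h_j, norm_smul, M.norm_h,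
    LinearIsometry.norm_map]
  simp [add_comm]

theorem pt_injective : Function.Injective M.pt := fun x x' h => by
  have h2 : x.2 = x'.2 := by rw [← M.inner_h_pt, h, M.inner_h_pt]
  unfold pt at h
  rw [h2] at h
  exact Prod.ext (M.j.injective (add_left_cancel h)) h2

theorem exists_pt_eq {y : E} (hy : inner ℝ M.u y = 0) : ∃ x, M.pt x = y := by
  obtain ⟨z, hz⟩ := M.exists_j (y - (inner ℝ M.h y) • M.h)
    (by rw [inner_sub_right, inner_smul_right, M.inner_u_h, hy]; simp)
    (by rw [inner_sub_right, inner_smul_right]; simp [M.norm_h])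
  exact ⟨(z, inner ℝ M.h y), by simp [pt, hz]⟩

theorem norm_pt_hemi {z : H} (hz : ‖z‖ ^ 2 ≤ 1) (e : Bool) :
    ‖M.pt (z, boolSign e * hemi z)‖ = 1 := by
  have h : ‖M.pt (z, boolSign e * hemi z)‖ ^ 2 = 1 := by
    rw [norm_pt_sq, mul_pow, ← sq_abs (boolSign e), abs_boolSign, one_pow, one_mul]
    exact norm_sq_add_hemi_sq hz
  exact (pow_eq_one_iff_of_nonneg (norm_nonneg _) two_ne_zero).1 h

end Splitting

/-- The third summand is the orthogonal complement of the plane of `u` and `h`, identified with `Euc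
(d - 2)` by an orthonormal basis. Two orthonormal vectors force `2 ≤ d`, so the subtraction is not
truncated. -/
theorem nonempty_splitting {d : ℕ} {u h : Euc d} (hu : ‖u‖ = 1)
    (hh : ‖h‖ = 1) (huh : inner ℝ u h = 0) :
    ∃ M : Splitting (Euc (d - 2)) (Euc d), M.u = u ∧ M.h = h := by
  let S : Submodule ℝ (Euc d) := Submodule.span ℝ (range ![u, h])
  have ho : Orthonormal ℝ ![u, h] := by
    constructor
    · intro i; fin_cases i <;> simp [hu, hh]
    · intro i k hik
      fin_cases i <;> fin_cases k <;> simp_all [real_inner_comm]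
  have hf : Module.finrank ℝ S = 2 := by
    rw [finrank_span_eq_card ho.linearIndependent]; simp
  have hK : Module.finrank ℝ Sᗮ = d - 2 := by
    have := S.finrank_add_finrank_orthogonal
    rw [hf, finrank_euclideanSpace_fin] at this
    omega
  let b := (stdOrthonormalBasis ℝ Sᗮ).reindex (finCongr hK)
  have hmem : ∀ x, x ∈ Sᗮ ↔ inner ℝ u x = 0 ∧ inner ℝ h x = 0 := fun x => by
    rw [Submodule.mem_orthogonal]
    constructor
    · intro hx
      exact ⟨hx u (Submodule.subset_span ⟨0, rfl⟩), hx h (Submodule.subset_span ⟨1, rfl⟩)⟩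
    · rintro ⟨h1, h2⟩ v hv
      induction hv using Submodule.span_induction with
      | mem v hv =>
        obtain ⟨i, rfl⟩ := hv
        fin_cases i
        · exact h1
        · exact h2
      | zero => simp
      | add v w _ _ hv hw => rw [inner_add_left, hv, hw, add_zero]
      | smul c v _ hv => rw [inner_smul_left, hv, mul_zero]
  refine ⟨⟨u, h, Sᗮ.subtypeₗᵢ.comp b.repr.symm.toLinearIsometry, hu, hh, huh, fun z => ?_,
    fun z => ?_, fun x h1 h2 => ?_⟩, rfl, rfl⟩
  · exact ((hmem _).1 (b.repr.symm z).2).1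
  · exact ((hmem _).1 (b.repr.symm z).2).2
  · exact ⟨b.repr ⟨x, (hmem x).2 ⟨h1, h2⟩⟩, by simp⟩

/-- The times at which an arm is defined: `[0, 1]` or `[0, ∞)`. -/
def armTimes (b : Prop) : Set ℝ := {s | 0 ≤ s ∧ (b → s ≤ 1)}

/-- An embedded strip that is attached to a foot on a cap. -/
structure Arm {d : ℕ} (C : HyperCap d) where
  foot : Foot C
  bounded : Prop
  toFun : Euc d × ℝ → Euc d
  continuousOn : ContinuousOn toFun (foot.carrier ×ˢ armTimes bounded)
  injOn : InjOn toFun (foot.carrier ×ˢ armTimes bounded)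
  zero : ∀ p ∈ foot.carrier, toFun (p, 0) = p

section beads

variable {d : ℕ} {H : Type*} [NormedAddCommGroup H] [InnerProductSpace ℝ H]
  (M : Splitting H (Euc d)) {C : HyperCap d} {g : Euc d ≃ₗᵢ[ℝ] Euc d}

/-- The parametrization of a cap by the unit ball of `H × ℝ`. -/
def capParam (C : HyperCap d) (g : Euc d ≃ₗᵢ[ℝ] Euc d) (x : H × ℝ) : Euc d := C.param (g (M.pt x))

/-- The parametrization of one half of the rim by the unit ball of `H`. -/
def rimParam (C : HyperCap d) (g : Euc d ≃ₗᵢ[ℝ] Euc d) (e : Bool) (z : H) : Euc d :=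
  capParam M C g (z, boolSign e * hemi z)

theorem continuous_capParam (C : HyperCap d) (g : Euc d ≃ₗᵢ[ℝ] Euc d) :
    Continuous (capParam M C g) :=
  C.continuous_param.comp (g.continuous.comp M.continuous_pt)

theorem continuous_rimParam (C : HyperCap d) (g : Euc d ≃ₗᵢ[ℝ] Euc d) (e : Bool) :
    Continuous (rimParam M C g e) :=
  (continuous_capParam M C g).comp
    (continuous_id.prodMk (continuous_const.mul continuous_hemi))

variable {M}

theorem inner_normal_frame_pt (hg : g M.u = C.normal) (x : H × ℝ) :
    inner ℝ C.normal (g (M.pt x)) = 0 := by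
  rw [← hg, g.inner_map_map, M.inner_u_pt]

theorem capParam_mem (hg : g M.u = C.normal) {x : H × ℝ} (hx : ‖x.1‖ ^ 2 + x.2 ^ 2 ≤ 1) :
    capParam M C g x ∈ C.carrier := by
  refine HyperCap.param_mem_carrier (inner_normal_frame_pt hg x) ?_
  rw [g.norm_map, ← sq_le_one_iff₀ (norm_nonneg _), M.norm_pt_sq]
  exact hx

theorem capParam_injOn (hg : g M.u = C.normal) :
    InjOn (capParam M C g) {x | ‖x.1‖ ^ 2 + x.2 ^ 2 ≤ 1} := by
  have h1 : ∀ x ∈ {x : H × ℝ | ‖x.1‖ ^ 2 + x.2 ^ 2 ≤ 1}, ‖g (M.pt x)‖ ≤ 1 := fun x hx => by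
    rw [g.norm_map, ← sq_le_one_iff₀ (norm_nonneg _), M.norm_pt_sq]
    exact hx
  intro x hx x' hx' h
  exact M.pt_injective (g.injective (HyperCap.eq_of_param_eq (inner_normal_frame_pt hg x) (h1 x hx)
    (inner_normal_frame_pt hg x') (h1 x' hx') h))

theorem image_capParam (hg : g M.u = C.normal) :
    capParam M C g '' {x | ‖x.1‖ ^ 2 + x.2 ^ 2 ≤ 1} = C.carrier := by
  refine Subset.antisymm ?_ fun p hp => ?_
  · rintro _ ⟨x, hx, rfl⟩
    exact capParam_mem hg hx
  · obtain ⟨y, h1, -, h2, rfl⟩ := C.exists_param_eq hp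
    obtain ⟨x, hx⟩ := M.exists_pt_eq (y := g.symm y)
      (by rw [← g.inner_map_map, hg, g.apply_symm_apply, h1])
    refine ⟨x, ?_, by simp [capParam, hx]⟩
    simp only [mem_ofPred_eq]
    rw [← M.norm_pt_sq, hx, g.symm.norm_map]
    exact (sq_le_one_iff₀ (norm_nonneg _)).2 h2

/-- Over the ball of radius `√(1 - κ²)` the unit hemisphere on the side `e` is the polar cap above
the height `κ`, which is the foot in the coordinates of the cap. -/
theorem image_rimParam (hg : g M.u = C.normal) (F : Foot C) (e : Bool)
    (hF : F.pole = boolSign e • g M.h) :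
    rimParam M C g e '' {z | ‖z‖ ^ 2 + F.height ^ 2 ≤ 1} = F.carrier := by
  have hs : boolSign e * boolSign e = 1 := by cases e <;> simp
  have hin : ∀ x, inner ℝ F.pole (g (M.pt x)) = boolSign e * x.2 := fun x => by
    rw [hF, inner_smul_left, g.inner_map_map, M.inner_h_pt]; rfl
  rw [HyperCap.foot_carrier_eq]
  ext p
  constructor
  · rintro ⟨z, hz, rfl⟩
    have hz1 : ‖z‖ ^ 2 ≤ 1 := by have := hz.out; nlinarith [sq_nonneg F.height]
    refine ⟨_, ⟨inner_normal_frame_pt hg _, ?_, ?_⟩, rfl⟩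
    · rw [g.norm_map, M.norm_pt_hemi hz1]
    · rw [hin, ← mul_assoc, hs, one_mul]
      exact le_hemi hz
  · rintro ⟨y, ⟨h1, h2, h3⟩, rfl⟩
    obtain ⟨⟨z, t⟩, hx⟩ := M.exists_pt_eq (y := g.symm y)
      (by rw [← g.inner_map_map, hg, g.apply_symm_apply, h1])
    have hy : y = g (M.pt (z, t)) := by rw [hx, g.apply_symm_apply]
    rw [hy, hin] at h3
    have hn := M.norm_pt_sq (z, t)
    rw [hx, g.symm.norm_map, h2, one_pow] at hn
    simp only at hn h3
    have h0 : 0 ≤ boolSign e * t := F.height_nonneg.trans h3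
    have hst : (boolSign e * t) ^ 2 = t ^ 2 := by rw [mul_pow, sq (boolSign e), hs, one_mul]
    -- The point lies on the unit sphere, on the side `e` because the height of a foot is
    -- nonnegative.
    have hhemi : hemi z = boolSign e * t := by
      rw [hemi, Real.sqrt_eq_iff_mul_self_eq (by nlinarith) h0]; nlinarith
    refine ⟨z, ?_, ?_⟩
    · simp only [mem_ofPred_eq]
      nlinarith [F.height_nonneg]
    · rw [rimParam, hhemi, ← mul_assoc, hs, one_mul, capParam, ← hy]

theorem rimParam_injOn (hg : g M.u = C.normal) (κ : ℝ) (e : Bool) :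
    InjOn (rimParam M C g e) {z | ‖z‖ ^ 2 + κ ^ 2 ≤ 1} := fun _ hz _ hz' h =>
  congrArg Prod.fst
      (capParam_injOn hg (boolSign_hemi_mem_ball hz e) (boolSign_hemi_mem_ball hz' e) h)

/-- The bead formed by a cap and two opposite arms. -/
def capBead (hg : g M.u = C.normal) (arm : Bool → Arm C)
    (harm : ∀ e, (arm e).foot.pole = boolSign e • g M.h) :
    Bead H (Euc d) where
  cap := capParam M C g
  height e := (arm e).foot.height
  bounded e := (arm e).bounded
  arm e x := (arm e).toFun (rimParam M C g e x.1, x.2)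
  height_nonneg e := (arm e).foot.height_nonneg
  height_lt e := (arm e).foot.height_lt
  cap_continuousOn := (continuous_capParam M C g).continuousOn
  arm_continuousOn e := by
    refine (arm e).continuousOn.comp (Continuous.continuousOn
      (((continuous_rimParam M C g e).comp continuous_fst).prodMk continuous_snd)) fun x hx => ?_
    refine ⟨?_, hx.2⟩
    rw [← image_rimParam hg _ e (harm e)]
    exact ⟨_, hx.1, rfl⟩
  arm_zero e z hz := by
    rw [(arm e).zero]
    · rfl
    · rw [← image_rimParam hg _ e (harm e)]
      exact ⟨_, hz, rfl⟩

theorem rimParam_mem_of_armDom (hg : g M.u = C.normal) (arm : Bool → Arm C)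
    (harm : ∀ e, (arm e).foot.pole = boolSign e • g M.h) {e : Bool} {y : H × ℝ}
    (hy : y ∈ (capBead hg arm harm).armDom e) :
    (rimParam M C g e y.1, y.2) ∈ (arm e).foot.carrier ×ˢ armTimes (arm e).bounded := by
  refine ⟨?_, hy.2⟩
  rw [← image_rimParam hg _ e (harm e)]
  exact ⟨_, hy.1, rfl⟩

theorem image_capBead_arm (hg : g M.u = C.normal) (arm : Bool → Arm C)
    (harm : ∀ e, (arm e).foot.pole = boolSign e • g M.h) (e : Bool) :
    (capBead hg arm harm).arm e '' (capBead hg arm harm).armDom e =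
      (arm e).toFun '' ((arm e).foot.carrier ×ˢ armTimes (arm e).bounded) := by
  refine Subset.antisymm ?_ ?_
  · rintro _ ⟨y, hy, rfl⟩
    exact ⟨_, rimParam_mem_of_armDom hg arm harm hy, rfl⟩
  · rintro _ ⟨⟨p, s⟩, ⟨hp, hs⟩, rfl⟩
    simp only at hp hs
    rw [← image_rimParam hg _ e (harm e)] at hp
    obtain ⟨z, hz, rfl⟩ := hp
    exact ⟨(z, s), ⟨hz, hs⟩, rfl⟩

theorem image_capBead_map (hg : g M.u = C.normal) (arm : Bool → Arm C)
    (harm : ∀ e, (arm e).foot.pole = boolSign e • g M.h) :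
    (capBead hg arm harm).map '' (capBead hg arm harm).dom =
      C.carrier ∪ ⋃ e, (arm e).toFun '' ((arm e).foot.carrier ×ˢ armTimes (arm e).bounded) := by
  rw [Bead.image_map]
  simp only [image_capBead_arm]
  congr 1
  exact image_capParam hg

end beads

/-- The necklace formed by disjoint caps with arms, where the end of the positive arm of a cap is
identified by `glue` with the end of the negative arm of the next cap. -/
def capNecklace {d n : ℕ} {H : Type*} [NormedAddCommGroup H] [InnerProductSpace ℝ H]
    (M : Splitting H (Euc d)) (C : Fin n → HyperCap d)
    (hC : ∀ k k', k ≠ k' → Disjoint (C k).carrier (C k').carrier)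
    (g : Fin n → Euc d ≃ₗᵢ[ℝ] Euc d) (hg : ∀ k, g k M.u = (C k).normal)
    (arm : ∀ k, Bool → Arm (C k))
    (harm : ∀ k e, (arm k e).foot.pole = boolSign e • g k M.h)
    (next : Fin n → Fin n → Prop) (Q : Fin n → H ≃ₗᵢ[ℝ] H) (glue : Fin n → Euc d → Euc d)
    (hglue : ∀ k k', next k k' → ∀ z, ‖z‖ ^ 2 ≤ 1 →
      glue k (rimParam M (C k) (g k) true z) = rimParam M (C k') (g k') false (Q k z))
    (hcap : ∀ k e k', ∀ p ∈ (arm k e).foot.carrier, ∀ s ∈ armTimes (arm k e).bounded, 0 < s →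
      (arm k e).toFun (p, s) ∉ (C k').carrier)
    (harms : ∀ k e k' e', ∀ p ∈ (arm k e).foot.carrier, ∀ s ∈ armTimes (arm k e).bounded,
      ∀ p' ∈ (arm k' e').foot.carrier, ∀ s' ∈ armTimes (arm k' e').bounded, 0 < s → 0 < s' →
      (k, e) ≠ (k', e') → (arm k e).toFun (p, s) = (arm k' e').toFun (p', s') →
      (e = true ∧ e' = false ∧ s = 1 ∧ s' = 1 ∧ next k k' ∧ p' = glue k p) ∨
      (e = false ∧ e' = true ∧ s = 1 ∧ s' = 1 ∧ next k' k ∧ p = glue k' p'))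
    (hnext : ∀ k k', next k k' → ∀ p ∈ (arm k true).foot.carrier,
      (arm k true).toFun (p, 1) = (arm k' false).toFun (glue k p, 1)) :
    Necklace H (Euc d) n where
  bead k := capBead (hg k) (arm k) (harm k)
  mate k k' z z' := next k k' ∧ z' = Q k z
  cap_inj k k' x x' hx hx' h := by
    have hk : k = k' := by
      by_contra hne
      exact (hC k k' hne).le_bot ⟨capParam_mem (hg k) hx, by
        have := capParam_mem (hg k') hx'
        rwa [show capParam M (C k) (g k) x = capParam M (C k') (g k') x' from h]⟩
    subst hk
    exact ⟨rfl, capParam_injOn (hg k) hx hx' h⟩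
  arm_ne_cap k e k' y x hy hs hx h := by
    have hm := rimParam_mem_of_armDom (hg k) (arm k) (harm k) hy
    refine hcap k e k' _ hm.1 _ hm.2 hs ?_
    have := capParam_mem (hg k') hx
    rwa [show capParam M (C k') (g k') x = _ from h.symm] at this
  arm_inj k e y y' hy hy' _ _ h := by
    have h1 := (arm k e).injOn (rimParam_mem_of_armDom (hg k) (arm k) (harm k) hy)
      (rimParam_mem_of_armDom (hg k) (arm k) (harm k) hy') h
    obtain ⟨h2, h3⟩ := Prod.mk.inj h1
    exact Prod.ext (rimParam_injOn (hg k) _ e hy.1 hy'.1 h2) h3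
  arm_arm k e k' e' y y' hy hy' hs hs' hne h := by
    have hm := rimParam_mem_of_armDom (hg k) (arm k) (harm k) hy
    have hm' := rimParam_mem_of_armDom (hg k') (arm k') (harm k') hy'
    -- By `hglue` a pair of rim points matched by `glue k` has ball coordinates matched by `Q k`,
    -- since the rim coordinates are injective.
    have key : ∀ (k k' : Fin n) (z z' : H) (κ κ' : ℝ), next k k' → ‖z‖ ^ 2 + κ ^ 2 ≤ 1 →
        ‖z'‖ ^ 2 + κ' ^ 2 ≤ 1 → rimParam M (C k') (g k') false z' =
          glue k (rimParam M (C k) (g k) true z) → z' = Q k z := by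
      intro k k' z z' κ κ' hn hz hz' h
      have hz1 : ‖z‖ ^ 2 ≤ 1 := by nlinarith [sq_nonneg κ]
      have hz1' : ‖z'‖ ^ 2 ≤ 1 := by nlinarith [sq_nonneg κ']
      rw [hglue k k' hn z hz1] at h
      refine rimParam_injOn (hg k') 0 false ?_ ?_ h
      · simpa using hz1'
      · simpa using hz1
    rcases harms k e k' e' _ hm.1 _ hm.2 _ hm'.1 _ hm'.2 hs hs' hne h with
      ⟨rfl, rfl, h1, h2, h3, h4⟩ | ⟨rfl, rfl, h1, h2, h3, h4⟩
    · exact Or.inl ⟨rfl, rfl, h1, h2, h3, key k k' _ _ _ _ h3 hy.1 hy'.1 h4⟩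
    · exact Or.inr ⟨rfl, rfl, h1, h2, h3, key k' k _ _ _ _ h3 hy'.1 hy.1 h4⟩
  mate_arm k k' z z' hz h := by
    obtain ⟨h1, rfl⟩ := h
    have hm := rimParam_mem_of_armDom (hg k) (arm k) (harm k) hz
    have hz1 : ‖z‖ ^ 2 ≤ 1 := by
      have h2 := hz.1
      simp only at h2
      nlinarith [sq_nonneg ((capBead (hg k) (arm k) (harm k)).height true)]
    have := hnext k k' h1 _ hm.1
    rw [hglue k k' h1 z hz1] at this
    exact this
end

/-! ### The graph of the chain is a path. -/

noncomputable section

/-- A connected graph on `n` vertices with two vertices of degree one and all others of degree two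
is a path. -/
theorem exists_path_of_degree {n : ℕ} (G : SimpleGraph (Fin n)) (hG : G.Connected)
    {ia ib : Fin n} (hne : ia ≠ ib)
    (hdeg : ∀ i, (G.neighborSet i).ncard = if i = ia ∨ i = ib then 1 else 2) :
    ∃ c : ℕ → Fin n, c 0 = ia ∧ c (n - 1) = ib ∧ (∀ k l, k < n → l < n → c k = c l → k = l) ∧
      (∀ i, ∃ k, k < n ∧ c k = i) ∧
      (∀ k, k + 1 < n → G.Adj (c k) (c (k + 1))) ∧
      ∀ i j, G.Adj i j → ∃ k,
          k + 1 < n ∧ ((i = c k ∧ j = c (k + 1)) ∨ (j = c k ∧ i = c (k + 1))) := by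
  obtain ⟨p, hp⟩ := (hG.preconnected ia ib).exists_isPath
  have hinj : ∀ {k l}, k ≤ p.length → l ≤ p.length → p.getVert k = p.getVert l → k = l :=
    fun hk hl h => hp.getVert_injOn hk hl h
  have hadj : ∀ k, k < p.length → G.Adj (p.getVert k) (p.getVert (k + 1)) :=
    fun k hk => p.adj_getVert_succ hk
  have hlen : 0 < p.length := by
    rw [Nat.pos_iff_ne_zero]
    intro h0
    exact hne (SimpleGraph.Walk.eq_of_length_eq_zero h0)
  have hfin : ∀ v, (G.neighborSet v).Finite := fun v => Set.toFinite _
  -- The neighbours on the path already exhaust the degree: one at each end, two at every inner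
  -- vertex.
  have hnb : ∀ k, k ≤ p.length → ∀ w, G.Adj (p.getVert k) w →
      (k < p.length ∧ w = p.getVert (k + 1)) ∨ (0 < k ∧ w = p.getVert (k - 1)) := by
    intro k hk w hw
    rcases Nat.eq_zero_or_pos k with rfl | hk0
    · have hsub : {p.getVert 1} ⊆ G.neighborSet (p.getVert 0) := by
        simpa using hadj 0 hlen
      have hcard := hdeg (p.getVert 0)
      rw [if_pos (Or.inl p.getVert_zero)] at hcard
      have h1 := Set.eq_of_subset_of_ncard_le hsub (by rw [hcard, ncard_singleton]) (hfin _)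
      have : w ∈ ({p.getVert 1} : Set _) := h1 ▸ hw
      exact Or.inl ⟨hlen, this⟩
    · have hprev : G.Adj (p.getVert k) (p.getVert (k - 1)) := by
        have := (hadj (k - 1) (by omega)).symm
        rwa [Nat.sub_add_cancel hk0] at this
      rcases hk.lt_or_eq with hlt | rfl
      · have hsub : {p.getVert (k - 1), p.getVert (k + 1)} ⊆ G.neighborSet (p.getVert k) := by
          rintro v (rfl | rfl)
          · exact hprev
          · exact hadj k hlt
        have hcard := hdeg (p.getVert k)
        rw [if_neg] at hcard
        · have h2 : p.getVert (k - 1) ≠ p.getVert (k + 1) := fun h => by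
            have := hinj (by omega) (by omega) h
            omega
          have h1 := Set.eq_of_subset_of_ncard_le hsub (by rw [hcard, ncard_pair h2]) (hfin _)
          have : w ∈ ({p.getVert (k - 1), p.getVert (k + 1)} : Set _) := h1 ▸ hw
          rcases this with h | h
          · exact Or.inr ⟨hk0, h⟩
          · exact Or.inl ⟨hlt, h⟩
        · rintro (h | h)
          · have := hinj hk (Nat.zero_le _) (h.trans p.getVert_zero.symm)
            omega
          · have := hinj hk le_rfl (h.trans p.getVert_length.symm)
            omega
      · have hsub : {p.getVert (p.length - 1)} ⊆ G.neighborSet (p.getVert p.length) := by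
          simpa using hprev
        have hcard := hdeg (p.getVert p.length)
        rw [if_pos (Or.inr p.getVert_length)] at hcard
        have h1 := Set.eq_of_subset_of_ncard_le hsub (by rw [hcard, ncard_singleton]) (hfin _)
        have : w ∈ ({p.getVert (p.length - 1)} : Set _) := h1 ▸ hw
        exact Or.inr ⟨hk0, this⟩
  -- So the vertices of the path form a set closed under adjacency, which by connectedness is
  -- everything.
  have hcl : ∀ u v (q : G.Walk u v), (∃ k ≤ p.length, p.getVert k = u) →
      ∃ k ≤ p.length, p.getVert k = v := by
    intro u v q
    induction q with
    | nil => exact id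
    | cons h _ ih =>
      rintro ⟨k, hk, rfl⟩
      rcases hnb k hk _ h with ⟨h1, rfl⟩ | ⟨h1, rfl⟩
      · exact ih ⟨_, h1, rfl⟩
      · exact ih ⟨k - 1, by omega, rfl⟩
  have hsurj : ∀ v, ∃ k ≤ p.length, p.getVert k = v := fun v => by
    obtain ⟨q⟩ := hG.preconnected ia v
    exact hcl _ _ q ⟨0, Nat.zero_le _, p.getVert_zero⟩
  have hn : p.length + 1 = n := by
    have hb : Function.Bijective fun k : Fin (p.length + 1) => p.getVert k := by
      constructor
      · intro k l h
        exact Fin.ext (hinj (by omega) (by omega) h)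
      · intro v
        obtain ⟨k, hk, h⟩ := hsurj v
        exact ⟨⟨k, by omega⟩, h⟩
    simpa using Fintype.card_of_bijective hb
  have hn' : n - 1 = p.length := by omega
  refine ⟨p.getVert, p.getVert_zero, hn' ▸ p.getVert_length,
    fun k l hk hl h => hinj (by omega) (by omega) h, fun i => ?_, fun k hk => hadj k (by omega),
    fun i j hij => ?_⟩
  · obtain ⟨k, hk, h⟩ := hsurj i
    exact ⟨k, by omega, h⟩
  · obtain ⟨k, hk, rfl⟩ := hsurj i
    rcases hnb k hk j hij with ⟨h1, h2⟩ | ⟨h1, h2⟩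
    · exact ⟨k, by omega, Or.inl ⟨rfl, h2⟩⟩
    · exact ⟨k - 1, by omega, Or.inr ⟨h2, by rw [Nat.sub_add_cancel h1]⟩⟩

/-! ### Links and connectors, their reversal and their halves. -/

namespace Link

variable {d : ℕ} {C C' : HyperCap d} (L : Link C C')

/-- The link in the opposite direction. -/
def symm : Link C' C where
  source := L.target
  target := L.source
  frame := L.frame.symm
  frame_normal := by rw [← L.frame_normal, L.frame.symm_apply_apply]
  frame_pole := by rw [← L.frame_pole, L.frame.symm_apply_apply]
  height_eq := L.height_eq.symm

theorem symm_glue_glue (p : Euc d) : L.symm.glue (L.glue p) = p := by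
  have h := C.rimRadius_pos.ne'
  have h' := C'.rimRadius_pos.ne'
  simp only [glue, symm, add_sub_cancel_left, map_smul, LinearIsometryEquiv.symm_apply_apply,
    smul_smul]
  rw [div_mul_div_cancel₀ h', div_self h, one_smul, add_sub_cancel]

theorem glue_mem {p : Euc d} (hp : p ∈ L.source.carrier) : L.glue p ∈ L.target.carrier := by
  rw [HyperCap.foot_carrier_eq] at hp ⊢
  obtain ⟨y, ⟨h1, h2, h3⟩, rfl⟩ := hp
  refine ⟨L.frame y, ⟨?_, ?_, ?_⟩, (L.glue_param h2).symm⟩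
  · rw [← L.frame_normal, L.frame.inner_map_map, h1]
  · rw [L.frame.norm_map, h2]
  · rw [← L.frame_pole, L.frame.inner_map_map, ← L.height_eq]; exact h3

theorem continuous_glue : Continuous L.glue := by
  have := L.frame.continuous
  unfold glue
  fun_prop

end Link

/-- An embedded strip along a link. -/
structure Connector {d : ℕ} (C C' : HyperCap d) where
  link : Link C C'
  toFun : Euc d × ℝ → Euc d
  continuousOn : ContinuousOn toFun (link.source.carrier ×ˢ Icc 0 1)
  injOn : InjOn toFun (link.source.carrier ×ˢ Icc 0 1)
  zero : ∀ p ∈ link.source.carrier, toFun (p, 0) = p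
  one : ∀ p ∈ link.source.carrier, toFun (p, 1) = link.glue p

namespace Connector

variable {d : ℕ} {C C' : HyperCap d} (K : Connector C C')

/-- The connector as a set of points. -/
def carrier : Set (Euc d) := K.toFun '' (K.link.source.carrier ×ˢ Icc 0 1)

/-- The reversed parameters. -/
def reverse (x : Euc d × ℝ) : Euc d × ℝ := (K.link.symm.glue x.1, 1 - x.2)

theorem reverse_mapsTo : MapsTo K.reverse (K.link.target.carrier ×ˢ Icc 0 1)
    (K.link.source.carrier ×ˢ Icc 0 1) := fun x hx =>
  ⟨K.link.symm.glue_mem hx.1, by have := hx.2.2; simp only [reverse]; linarith,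
    by have := hx.2.1; simp only [reverse]; linarith⟩

theorem reverse_injective : Function.Injective K.reverse := fun x x' h => by
  obtain ⟨h1, h2⟩ := Prod.mk.inj h
  refine Prod.ext ?_ (by linarith)
  rw [← K.link.symm.symm_glue_glue x.1, h1, K.link.symm.symm_glue_glue]

/-- The connector in the opposite direction. -/
def symm : Connector C' C where
  link := K.link.symm
  toFun x := K.toFun (K.reverse x)
  continuousOn := K.continuousOn.comp (Continuous.continuousOn
    ((K.link.symm.continuous_glue.comp continuous_fst).prodMk
      (continuous_const.sub continuous_snd))) K.reverse_mapsTo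
  injOn := K.injOn.comp K.reverse_injective.injOn K.reverse_mapsTo
  zero p hp := by
    rw [reverse, sub_zero, K.one _ (K.link.symm.glue_mem hp)]
    exact K.link.symm.symm_glue_glue p
  one p hp := by
    rw [reverse, sub_self, K.zero _ (K.link.symm.glue_mem hp)]

theorem symm_toFun_glue (p : Euc d) (t : ℝ) :
    K.symm.toFun (K.link.glue p, 1 - t) = K.toFun (p, t) := by
  simp [symm, reverse, K.link.symm_glue_glue]

theorem carrier_symm : K.symm.carrier = K.carrier := by
  refine Subset.antisymm ?_ ?_
  · rintro _ ⟨x, hx, rfl⟩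
    exact ⟨_, K.reverse_mapsTo hx, rfl⟩
  · rintro _ ⟨⟨p, t⟩, ⟨hp, ht0, ht1⟩, rfl⟩
    simp only at hp ht0 ht1
    exact ⟨(K.link.glue p, 1 - t), mk_mem_prod (K.link.glue_mem hp) ⟨by linarith, by linarith⟩,
      K.symm_toFun_glue p t⟩

/-- Halving the time makes the midpoint of a connector the end, at time 1, of a bounded arm. -/
theorem half_mapsTo : MapsTo (fun x : Euc d × ℝ => (x.1, x.2 / 2))
    (K.link.source.carrier ×ˢ armTimes True) (K.link.source.carrier ×ˢ Icc 0 1) := fun x hx => by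
  have h1 := hx.2.1
  have h2 := hx.2.2 trivial
  exact mk_mem_prod hx.1 ⟨by linarith, by linarith⟩

/-- The half of the connector at its source. -/
def firstHalf : Arm C where
  foot := K.link.source
  bounded := True
  toFun x := K.toFun (x.1, x.2 / 2)
  continuousOn := K.continuousOn.comp (f := fun x : Euc d × ℝ => (x.1, x.2 / 2))
    (by fun_prop) K.half_mapsTo
  injOn := K.injOn.comp (f := fun x : Euc d × ℝ => (x.1, x.2 / 2)) (fun x _ x' _ h => by
    obtain ⟨h4, h5⟩ := Prod.mk.inj h
    exact Prod.ext h4 (by linarith)) K.half_mapsTo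
  zero p hp := by simp only [zero_div]; exact K.zero p hp

/-- An arm as a set of points. -/
def _root_.Arm.carrier (a : Arm C) :
    Set (Euc d) := a.toFun '' (a.foot.carrier ×ˢ armTimes a.bounded)

theorem firstHalf_carrier_subset : K.firstHalf.carrier ⊆ K.carrier := by
  rintro _ ⟨⟨p, s⟩, ⟨hp, h0, h1⟩, rfl⟩
  have h2 := h1 trivial
  simp only at h0 h2
  exact ⟨(p, s / 2), mk_mem_prod hp ⟨by linarith, by linarith⟩, rfl⟩

/-- The second half of a connector is the first half of the reversed one; the two share the middle
section. -/
theorem carrier_eq_union : K.carrier = K.firstHalf.carrier ∪ K.symm.firstHalf.carrier := by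
  refine Subset.antisymm ?_ (union_subset K.firstHalf_carrier_subset
    (K.carrier_symm ▸ K.symm.firstHalf_carrier_subset))
  rintro _ ⟨⟨p, t⟩, ⟨hp, h0, h1⟩, rfl⟩
  simp only at hp h0 h1
  rcases le_total t (1 / 2) with h | h
  · refine Or.inl ⟨(p, 2 * t), mk_mem_prod hp ⟨by linarith, fun _ => by linarith⟩, ?_⟩
    simp [firstHalf]
  · refine Or.inr ⟨(K.link.glue p, 2 * (1 - t)), mk_mem_prod (K.link.glue_mem hp)
      ⟨by linarith, fun _ => by linarith⟩, ?_⟩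
    simp only [firstHalf]
    rw [← K.symm_toFun_glue p t]
    congr 2
    ring

end Connector

/-! ### Networks: caps with connectors, and where the halves of connectors can meet. -/

/-- Disjoint caps and connectors between some of them; `dir i j` says that there is a connector from
the cap `i` to the cap `j`. -/
structure Network (d n : ℕ) where
  cap : Fin n → HyperCap d
  cap_disjoint : ∀ i j, i ≠ j → Disjoint (cap i).carrier (cap j).carrier
  dir : Fin n → Fin n → Prop
  dir_asymm : ∀ i j, dir i j → ¬ dir j i
  conn : ∀ i j, dir i j → Connector (cap i) (cap j)
  inter_source : ∀ i j h, (conn i j h).carrier ∩ (cap i).carrier ⊆ (conn i j h).link.source.carrier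
  inter_target : ∀ i j h, (conn i j h).carrier ∩ (cap j).carrier ⊆ (conn i j h).link.target.carrier
  disjoint_cap : ∀ i j h k, k ≠ i → k ≠ j → Disjoint (conn i j h).carrier (cap k).carrier
  inter_conn : ∀ i j h k l h', (i, j) ≠ (k, l) →
    (conn i j h).carrier ∩ (conn k l h').carrier ⊆ ⋃ m, (cap m).carrier
  opposite_out_out : ∀ i j k h h', j ≠ k →
    (conn i j h).link.source.Opposite (conn i k h').link.source
  opposite_in_in : ∀ i j k h h', j ≠ k →
    (conn j i h).link.target.Opposite (conn k i h').link.target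
  opposite_in_out : ∀ i j k h h',
    (conn j i h).link.target.Opposite (conn i k h').link.source

namespace Network

variable {d n : ℕ} (N : Network d n)

/-- The caps `i` and `j` are joined by a connector. -/
def Adj (i j : Fin n) : Prop := N.dir i j ∨ N.dir j i

theorem adj_iff {i j : Fin n} : N.Adj i j ↔ N.dir i j ∨ N.dir j i := Iff.rfl

theorem adj_symm {i j : Fin n} (h : N.Adj i j) : N.Adj j i := h.symm

open Classical in
/-- The connector between two caps, in the direction from `i` to `j`. -/
def between (i j : Fin n) (h : N.Adj i j) : Connector (N.cap i) (N.cap j) :=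
  if h' : N.dir i j then N.conn i j h' else (N.conn j i (h.resolve_left h')).symm

theorem between_of_dir {i j : Fin n} (h : N.Adj i j) (h' : N.dir i j) :
    N.between i j h = N.conn i j h' := dif_pos h'

theorem between_of_dir_symm {i j : Fin n} (h : N.Adj i j) (h' : N.dir j i) :
    N.between i j h = (N.conn j i h').symm := dif_neg fun h => N.dir_asymm _ _ h h'

theorem between_symm_toFun {i j : Fin n} (h : N.Adj i j) (h' : N.Adj j i) (p : Euc d) (t : ℝ) :
    (N.between j i h').toFun ((N.between i j h).link.glue p, 1 - t) =
      (N.between i j h).toFun (p, t) := by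
  rcases N.adj_iff.1 h with hd | hd
  · rw [N.between_of_dir _ hd, N.between_of_dir_symm _ hd, Connector.symm_toFun_glue]
  · rw [N.between_of_dir_symm _ hd, N.between_of_dir _ hd]; rfl

theorem between_symm_source {i j : Fin n} (h : N.Adj i j) (h' : N.Adj j i) :
    (N.between j i h').link.source = (N.between i j h).link.target := by
  rcases N.adj_iff.1 h with hd | hd
  · rw [N.between_of_dir _ hd, N.between_of_dir_symm _ hd]; rfl
  · rw [N.between_of_dir_symm _ hd, N.between_of_dir _ hd]; rfl

theorem carrier_conn_eq_union {i j : Fin n} (h : N.dir i j) :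
    (N.conn i j h).carrier = (N.between i j (N.adj_iff.2 (Or.inl h))).firstHalf.carrier ∪
      (N.between j i (N.adj_iff.2 (Or.inr h))).firstHalf.carrier := by
  rw [N.between_of_dir _ h, N.between_of_dir_symm _ h, Connector.carrier_eq_union]

theorem between_inter_source {i j : Fin n} (h : N.Adj i j) :
    (N.between i j h).carrier ∩ (N.cap i).carrier ⊆ (N.between i j h).link.source.carrier := by
  rcases N.adj_iff.1 h with hd | hd
  · rw [N.between_of_dir _ hd]; exact N.inter_source i j hd
  · rw [N.between_of_dir_symm _ hd, Connector.carrier_symm]; exact N.inter_target j i hd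

theorem between_disjoint_cap {i j : Fin n} (h : N.Adj i j) (k : Fin n) (hi : k ≠ i) (hj : k ≠ j) :
    Disjoint (N.between i j h).carrier (N.cap k).carrier := by
  rcases N.adj_iff.1 h with hd | hd
  · rw [N.between_of_dir _ hd]; exact N.disjoint_cap i j hd k hi hj
  · rw [N.between_of_dir_symm _ hd, Connector.carrier_symm]; exact N.disjoint_cap j i hd k hj hi

theorem between_opposite {i j k : Fin n} (h : N.Adj i j) (h' : N.Adj i k) (hjk : j ≠ k) :
    (N.between i k h').link.source.pole = -(N.between i j h).link.source.pole := by
  rcases N.adj_iff.1 h with hd | hd <;> rcases N.adj_iff.1 h' with hd' | hd'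
  · rw [N.between_of_dir _ hd, N.between_of_dir _ hd']; exact N.opposite_out_out i j k hd hd' hjk
  · rw [N.between_of_dir _ hd, N.between_of_dir_symm _ hd', eq_comm, neg_eq_iff_eq_neg]
    exact N.opposite_in_out i k j hd' hd
  · rw [N.between_of_dir_symm _ hd, N.between_of_dir _ hd']; exact N.opposite_in_out i j k hd hd'
  · rw [N.between_of_dir_symm _ hd, N.between_of_dir_symm _ hd']
    exact N.opposite_in_in i j k hd hd' hjk

theorem between_inter {i j k l : Fin n} (h : N.Adj i j) (h' : N.Adj k l)
    (hne : (i, j) ≠ (k, l)) (hne' : (i, j) ≠ (l, k)) :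
    (N.between i j h).carrier ∩ (N.between k l h').carrier ⊆ ⋃ m, (N.cap m).carrier := by
  rcases N.adj_iff.1 h with hd | hd <;> rcases N.adj_iff.1 h' with hd' | hd'
  · rw [N.between_of_dir _ hd, N.between_of_dir _ hd']
    exact N.inter_conn _ _ _ _ _ _ hne
  · rw [N.between_of_dir _ hd, N.between_of_dir_symm _ hd', Connector.carrier_symm]
    exact N.inter_conn _ _ _ _ _ _ hne'
  · rw [N.between_of_dir_symm _ hd, N.between_of_dir _ hd', Connector.carrier_symm]
    exact N.inter_conn _ _ _ _ _ _ fun h => hne' (by simp_all)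
  · rw [N.between_of_dir_symm _ hd, N.between_of_dir_symm _ hd', Connector.carrier_symm,
      Connector.carrier_symm]
    exact N.inter_conn _ _ _ _ _ _ fun h => hne (by simp_all)

/-- A point of the connector on its source cap is a foot point, hence a value at time 0, and
injectivity excludes positive times. The target cap is treated in the same way after reversal. -/
theorem between_notMem_cap {i j : Fin n} (h : N.Adj i j) {p : Euc d}
    (hp : p ∈ (N.between i j h).link.source.carrier) {t : ℝ} (h0 : 0 < t) (h1 : t < 1)
    (k : Fin n) : (N.between i j h).toFun (p, t) ∉ (N.cap k).carrier := by
  intro hk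
  have h' := N.adj_symm h
  have key : ∀ {i j : Fin n} (h : N.Adj i j) {p : Euc d},
      p ∈ (N.between i j h).link.source.carrier → ∀ {t : ℝ}, 0 < t → t < 1 →
      (N.between i j h).toFun (p, t) ∉ (N.cap i).carrier := by
    intro i j h p hp t h0 h1 hk
    have hm := N.between_inter_source h ⟨⟨(p, t), mk_mem_prod hp ⟨h0.le, h1.le⟩, rfl⟩, hk⟩
    have h2 := (N.between i j h).zero _ hm
    have h3 := (N.between i j h).injOn (mk_mem_prod hm (left_mem_Icc.2 zero_le_one))
      (mk_mem_prod hp ⟨h0.le, h1.le⟩) h2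
    exact h0.ne (Prod.mk.inj h3).2
  by_cases hi : k = i
  · subst hi; exact key h hp h0 h1 hk
  by_cases hj : k = j
  · subst hj
    rw [← N.between_symm_toFun h h'] at hk
    refine key h' ?_ (by linarith) (by linarith) hk
    rw [N.between_symm_source h h']
    exact Link.glue_mem _ hp
  · exact
      (N.between_disjoint_cap h k hi hj).le_bot ⟨⟨(p, t), mk_mem_prod hp ⟨h0.le, h1.le⟩, rfl⟩, hk⟩

theorem firstHalf_notMem_cap {i j : Fin n} (h : N.Adj i j) {p : Euc d} {s : ℝ}
    (hp : p ∈ (N.between i j h).firstHalf.foot.carrier)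
    (hs : s ∈ armTimes (N.between i j h).firstHalf.bounded) (h0 : 0 < s)
    (k : Fin n) : (N.between i j h).firstHalf.toFun (p, s) ∉ (N.cap k).carrier :=
  N.between_notMem_cap h hp (by linarith) (by have := hs.2 trivial; linarith) k

/-- Halves of connectors meet off the caps only at the midpoint of a connector. -/
theorem firstHalf_eq_firstHalf {i j k l : Fin n} (h : N.Adj i j) (h' : N.Adj k l)
    {p p' : Euc d} {s s' : ℝ}
    (hp : p ∈ (N.between i j h).firstHalf.foot.carrier)
    (hs : s ∈ armTimes (N.between i j h).firstHalf.bounded)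
    (hp' : p' ∈ (N.between k l h').firstHalf.foot.carrier)
    (hs' : s' ∈ armTimes (N.between k l h').firstHalf.bounded)
    (h0 : 0 < s) (h0' : 0 < s')
    (heq : (N.between i j h).firstHalf.toFun (p, s) = (N.between k l h').firstHalf.toFun (p', s')) :
    (i = k ∧ j = l) ∨ (i = l ∧ j = k ∧ s = 1 ∧ s' = 1 ∧ p' = (N.between i j h).link.glue p) := by
  have h1 := hs.2 trivial
  have h1' := hs'.2 trivial
  by_cases hne : (i, j) = (k, l)
  · exact Or.inl (Prod.mk.inj hne)
  by_cases hne' : (i, j) = (l, k)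
  · obtain ⟨rfl, rfl⟩ := Prod.mk.inj hne'
    refine Or.inr ⟨rfl, rfl, ?_⟩
    simp only [Connector.firstHalf] at heq
    rw [← N.between_symm_toFun h h'] at heq
    have hg := Link.glue_mem (N.between i j h).link hp
    rw [← N.between_symm_source h h'] at hg
    -- Both points now lie on one connector, at the times `1 - s / 2` and `s' / 2`. Equality of
    -- these with `s, s' ≤ 1` forces `s = s' = 1`.
    have h2 := (N.between j i h').injOn (mk_mem_prod hg ⟨by linarith, by linarith⟩)
      (mk_mem_prod hp' ⟨by linarith, by linarith⟩) heq
    obtain ⟨h3, h4⟩ := Prod.mk.inj h2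
    exact ⟨by linarith, by linarith, h3.symm⟩
  · have hm := N.between_inter h h' hne hne'
      ⟨(N.between i j h).firstHalf_carrier_subset ⟨_, mk_mem_prod hp hs, rfl⟩,
        heq ▸ (N.between k l h').firstHalf_carrier_subset ⟨_, mk_mem_prod hp' hs', rfl⟩⟩
    obtain ⟨m, hm⟩ := mem_iUnion.1 hm
    exact absurd hm (N.firstHalf_notMem_cap h hp hs h0 m)

theorem firstHalf_one {i j : Fin n} (h : N.Adj i j) (h' : N.Adj j i) (p : Euc d) :
    (N.between i j h).firstHalf.toFun (p, 1) =
      (N.between j i h').firstHalf.toFun ((N.between i j h).link.glue p, 1) := by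
  simp only [Connector.firstHalf]
  rw [← N.between_symm_toFun h h']
  norm_num

end Network
end

/-! ### Transport of frames, the holonomy, and the closed chain. -/

noncomputable section

open Submodule in
/-- Frames transported along a chain of isometries, each followed by a reflection. -/
theorem exists_frames {E : Type*} [NormedAddCommGroup E] [InnerProductSpace ℝ E]
    (u h : ℕ → E) (A : ℕ → E ≃ₗᵢ[ℝ] E) (m : ℕ) (huh : inner ℝ (u 0) (h 0) = 0)
    (hA : ∀ k < m, A k (u k) = u (k + 1)) (hA' : ∀ k < m, A k (h k) = -h (k + 1)) :
    ∃ g : ℕ → E ≃ₗᵢ[ℝ] E, g 0 = 1 ∧ (∀ k, g (k + 1) = A k * (g k * (ℝ ∙ h 0)ᗮ.reflection)) ∧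
      ∀ k ≤ m, g k (u 0) = u k ∧ g k (h 0) = h k := by
  refine ⟨fun k => Nat.rec 1 (fun k gk => A k * (gk * (ℝ ∙ h 0)ᗮ.reflection)) k, rfl,
    fun _ => rfl, fun k hk => ?_⟩
  induction k with
  | zero => exact ⟨rfl, rfl⟩
  | succ k ih =>
    obtain ⟨h1, h2⟩ := ih (by omega)
    have hu : (ℝ ∙ h 0)ᗮ.reflection (u 0) = u 0 := by
      rw [reflection_orthogonal_singleton_apply, real_inner_comm, huh]; simp
    -- This sign cancels the one in `hA'`, so that the transported frame again carries `h 0` to the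
    -- outgoing pole.
    have hh : (ℝ ∙ h 0)ᗮ.reflection (h 0) = -h 0 :=
      reflection_orthogonalComplement_singleton_eq_neg _
    simp only [LinearIsometryEquiv.coe_mul, Function.comp_apply, hu, hh, map_neg]
    exact ⟨by rw [← hA k hk]; exact congrArg _ h1,
      by rw [neg_eq_iff_eq_neg, ← hA' k hk]; exact congrArg _ h2⟩

namespace Splitting

variable {H E : Type*} [NormedAddCommGroup H] [InnerProductSpace ℝ H]
    [NormedAddCommGroup E] [InnerProductSpace ℝ E] (M : Splitting H E)

theorem reflection_pt (z : H) (t : ℝ) :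
    (Submodule.span ℝ {M.h})ᗮ.reflection (M.pt (z, t)) = M.pt (z, -t) := by
  rw [reflection_orthogonal_singleton_apply, M.inner_h_pt, M.norm_h, pt, pt]
  module

/-- In transported coordinates the gluing changes only the sign of the height: the upper half of one
rim goes to the lower half of the next one, over the same point `z`. -/
theorem apply_frame_pt {A g g' : E ≃ₗᵢ[ℝ] E}
    (h : g' = A * (g * (Submodule.span ℝ {M.h})ᗮ.reflection)) (z : H) (t : ℝ) :
    A (g (M.pt (z, t))) = g' (M.pt (z, -t)) := by
  rw [h, LinearIsometryEquiv.coe_mul, LinearIsometryEquiv.coe_mul, Function.comp_apply,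
    Function.comp_apply, reflection_pt, neg_neg]

/-- What remains after removing the components along `u` and `h` lies in the image of `j` and is
orthogonal to that image, so it vanishes. -/
theorem eq_smul_add_smul {x : E} (hx : ∀ z, inner ℝ (M.j z) x = 0) :
    x = (inner ℝ M.u x) • M.u + (inner ℝ M.h x) • M.h := by
  have hhu : inner ℝ M.h M.u = 0 := by rw [real_inner_comm, M.inner_u_h]
  obtain ⟨z, hz⟩ := M.exists_j (x - ((inner ℝ M.u x) • M.u + (inner ℝ M.h x) • M.h))
    (by simp [inner_sub_right, inner_add_right, inner_smul_right, M.inner_u_h, M.norm_u])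
    (by simp [inner_sub_right, inner_add_right, inner_smul_right, hhu, M.norm_h])
  have h0 : inner ℝ (M.j z) (M.j z) = 0 := by
    nth_rw 2 [hz]
    rw [inner_sub_right, inner_add_right, inner_smul_right, inner_smul_right, hx,
      real_inner_comm M.u, M.inner_u_j, real_inner_comm M.h, M.inner_h_j]
    simp
  rw [inner_self_eq_zero.1 h0] at hz
  exact (sub_eq_zero.1 hz.symm)

end Splitting

namespace Network

variable {d n : ℕ} (N : Network d n)

/-- The union of all caps and connectors. -/
def union : Set (Euc d) :=
  (⋃ i, (N.cap i).carrier) ∪ ⋃ (i) (j) (h : N.dir i j), (N.conn i j h).carrier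

/-- All numbers are ±1, and reversal inverts the frame, so the condition does not depend on the
direction of a connector. -/
theorem isoDet_frame_between {s : Fin n → ℝ} (hs : ∀ i, s i = 1 ∨ s i = -1)
    (hun : ∀ i j h, (N.conn i j h).link.Untwisted (s i) (s j)) {i j : Fin n} (h : N.Adj i j) :
    isoDet (N.between i j h).link.frame = -(s i * s j) := by
  have key : ∀ a b D : ℝ, (a = 1 ∨ a = -1) → (b = 1 ∨ b = -1) → a * b * D = -1 → D = -(a * b) := by
    rintro a b D (rfl | rfl) (rfl | rfl) h <;> linarith
  rcases N.adj_iff.1 h with hd | hd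
  · rw [N.between_of_dir _ hd]
    exact key _ _ _ (hs i) (hs j) (hun i j hd)
  · rw [N.between_of_dir_symm _ hd]
    have h1 : isoDet (N.conn j i hd).link.frame = _ := key _ _ _ (hs j) (hs i) (hun j i hd)
    have h2 := isoDet_inv (N.conn j i hd).link.frame
    rw [h1] at h2
    change isoDet (N.conn j i hd).link.frame.symm = _
    rcases hs i with hi | hi <;> rcases hs j with hj | hj <;> rw [hi, hj] at h2 ⊢ <;> linarith

/-- A closed chain of caps and untwisted connectors is a product of a ball with a circle. -/
theorem nonempty_homeomorph_loop (hn : 3 ≤ n) (c : ℕ → Fin n)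
    (hc : ∀ k l, k < n → l < n → c k = c l → k = l) (hsurj : ∀ i, ∃ k, k < n ∧ c k = i)
    (hadj : ∀ k, k + 1 < n → N.Adj (c k) (c (k + 1))) (hadj' : N.Adj (c (n - 1)) (c 0))
    (hall : ∀ i j, N.dir i j → (∃ k, k + 1 < n ∧
      ((i = c k ∧ j = c (k + 1)) ∨ (j = c k ∧ i = c (k + 1)))) ∨
      (i = c (n - 1) ∧ j = c 0) ∨ (i = c 0 ∧ j = c (n - 1)))
    (s : Fin n → ℝ) (hs : ∀ i, s i = 1 ∨ s i = -1)
    (hun : ∀ i j h, (N.conn i j h).link.Untwisted (s i) (s j)) :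
    Nonempty (N.union ≃ₜ Metric.closedBall (0 : Euc (d - 2)) 1 × Circle) := by
  -- Cyclic successor and predecessor of a position in the chain.
  let nx : ℕ → ℕ := fun k => if k + 1 = n then 0 else k + 1
  let pv : ℕ → ℕ := fun k => if k = 0 then n - 1 else k - 1
  have hnx : ∀ k < n, nx k < n := fun k hk => by simp only [nx]; split_ifs <;> omega
  have hpv : ∀ k < n, pv k < n := fun k hk => by simp only [pv]; split_ifs <;> omega
  have hpvnx : ∀ k < n, pv (nx k) = k := fun k hk => by
    by_cases h : k + 1 = n
    · rw [show nx k = 0 from if_pos h, show pv 0 = n - 1 from if_pos rfl]; omega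
    · rw [show nx k = k + 1 from if_neg h, show pv (k + 1) = k from if_neg k.succ_ne_zero]
  have hnxpv : ∀ k < n, nx (pv k) = k := fun k hk => by
    simp only [nx, pv]; split_ifs <;> omega
  -- Three caps are needed here: the two neighbours of a cap are different, so its two arms belong
  -- to different connectors and have opposite feet.
  have hne : ∀ k < n, nx k ≠ pv k := fun k hk => by
    simp only [nx, pv]; split_ifs <;> omega
  have hadjn : ∀ k < n, N.Adj (c k) (c (nx k)) := fun k hk => by
    simp only [nx]
    split_ifs with h
    · obtain rfl : k = n - 1 := by omega
      exact hadj'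
    · exact hadj k (by omega)
  have hadjp : ∀ k < n, N.Adj (c k) (c (pv k)) := fun k hk => by
    have := N.adj_symm (hadjn (pv k) (hpv k hk))
    rwa [hnxpv k hk] at this
  let nb : ℕ → Bool → ℕ := fun k e => if e then nx k else pv k
  have hadjb : ∀ (k : Fin n) e, N.Adj (c k) (c (nb k e)) := fun k e => by
    cases e
    · exact hadjp k k.2
    · exact hadjn k k.2
  have hnb : ∀ (k : Fin n) e, nb k e < n := fun k e => by
    cases e
    · exact hpv k k.2
    · exact hnx k k.2
  let arm : ∀ (k : Fin n) (_ : Bool), Arm (N.cap (c k)) := fun k e =>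
    (N.between _ _ (hadjb k e)).firstHalf
  have hopp : ∀ k, (arm k false).foot.pole = -(arm k true).foot.pole := fun k =>
    N.between_opposite (hadjb k true) (hadjb k false)
      fun h => hne k k.2 (hc _ _ (hnx k k.2) (hpv k k.2) h)
  have hpos : 0 < n := by omega
  -- Normals and poles take at position `n` their values at position 0, so the frames can be
  -- transported once around the loop; `g n` is then the holonomy.
  let u : ℕ → Euc d := fun k => if hk : k < n then (N.cap (c k)).normal else (N.cap (c 0)).normal
  let h : ℕ → Euc d := fun k => if hk : k < n then (arm ⟨k, hk⟩ true).foot.pole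
    else (arm ⟨0, hpos⟩ true).foot.pole
  let A : ℕ → Euc d ≃ₗᵢ[ℝ] Euc d := fun k => if hk : k < n then
    (N.between _ _ (hadjb ⟨k, hk⟩ true)).link.frame else 1
  have hu : ∀ k < n, u k = (N.cap (c k)).normal := fun k hk => dif_pos hk
  have hh : ∀ k (hk : k < n), h k = (arm ⟨k, hk⟩ true).foot.pole := fun k hk => dif_pos hk
  have hAk : ∀ k (hk : k < n), A k = (N.between _ _ (hadjb ⟨k, hk⟩ true)).link.frame :=
    fun k hk => dif_pos hk
  have hun1 : ∀ k < n, u (k + 1) = u (nx k) := fun k hk => by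
    simp only [nx]
    split_ifs with h1
    · rw [h1, hu 0 hpos]; exact dif_neg (lt_irrefl n)
    · rfl
  have hhn1 : ∀ k < n, h (k + 1) = h (nx k) := fun k hk => by
    simp only [nx]
    split_ifs with h1
    · rw [h1, hh 0 hpos]; exact dif_neg (lt_irrefl n)
    · rfl
  -- The foot where a link arrives carries the negative arm of the next cap, opposite to its
  -- positive arm.
  have hpole : ∀ k (hk : k < n), (N.between _ _ (hadjb ⟨k, hk⟩ true)).link.target.pole =
      -h (nx k) := fun k hk => by
    rw [← N.between_symm_source (hadjb ⟨k, hk⟩ true) (N.adj_symm (hadjb ⟨k, hk⟩ true)),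
      hh _ (hnx k hk), ← hopp]
    have h1 : c (nb (nx k) false) = c k := congrArg c (hpvnx k hk)
    have key : ∀ (i j j' : Fin n) (h : N.Adj i j) (h' : N.Adj i j'), j = j' →
        (N.between i j h).link.source.pole = (N.between i j' h').link.source.pole := by
      rintro i j _ h h' rfl; rfl
    exact key _ _ _ _ _ h1.symm
  have huh : inner ℝ (u 0) (h 0) = 0 := by
    rw [hu 0 hpos, hh 0 hpos, real_inner_comm]; exact (arm ⟨0, hpos⟩ true).foot.pole_normal
  obtain ⟨g, hg0, hgs, hg⟩ := exists_frames u h A n huh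
    (fun k hk => by
      rw [hAk k hk, hun1 k hk, hu k hk, hu _ (hnx k hk)]
      exact (N.between _ _ (hadjb ⟨k, hk⟩ true)).link.frame_normal)
    (fun k hk => by
      rw [hAk k hk, hhn1 k hk, hh k hk, ← hpole k hk]
      exact (N.between _ _ (hadjb ⟨k, hk⟩ true)).link.frame_pole)
  have hh0 : ‖h 0‖ = 1 := by rw [hh 0 hpos]; exact (arm ⟨0, hpos⟩ true).foot.norm_pole
  have hu0 : ‖u 0‖ = 1 := by rw [hu 0 hpos]; exact HyperCap.norm_normal _
  obtain ⟨M, hMu, hMh⟩ := nonempty_splitting hu0 hh0 huh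
  rw [← hMh] at hgs
  have hstep := fun k => M.apply_frame_pt (hgs k)
  -- In every step the factor -1 of the reflection cancels the sign in the determinant of the frame,
  -- so `isoDet (g k)` is the product of the signs of the first cap and the current one. After a
  -- full turn this is 1.
  have hdet : ∀ k ≤ n, isoDet (g k) * s (c 0) = s (if k = n then c 0 else c k) := by
    intro k
    induction k with
    | zero => intro _; rw [hg0, isoDet_one, one_mul, if_neg hpos.ne]
    | succ k ih =>
      intro hk
      have h1 := ih (by omega)
      rw [if_neg (by omega)] at h1
      have h2 := N.isoDet_frame_between hs hun (hadjb ⟨k, hk⟩ true)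
      have h3 : s (if k + 1 = n then c 0 else c (k + 1)) = s (c (nx k)) := by
        simp only [nx]; split_ifs <;> rfl
      rw [hgs, isoDet_mul, isoDet_mul,
          isoDet_reflection (norm_ne_zero_iff.1 (by rw [M.norm_h]; simp)),
        hAk k hk, h2, h3]
      change -(s (c k) * s (c (nx k))) * (isoDet (g k) * -1) * s (c 0) = s (c (nx k))
      have h4 : s (c k) * s (c k) = 1 := by rcases hs (c k) with h | h <;> rw [h] <;> norm_num
      calc _ = s (c k) * s (c (nx k)) * (isoDet (g k) * s (c 0)) := by ring
        _ = (s (c k) * s (c k)) * s (c (nx k)) := by rw [h1]; ring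
        _ = _ := by rw [h4, one_mul]
  have hdetn : isoDet (g n) = 1 := by
    have := hdet n le_rfl
    rw [if_pos rfl] at this
    rcases hs (c 0) with h | h <;> rw [h] at this <;> linarith
  have hgnu : g n M.u = M.u := by
    rw [hMu, (hg n le_rfl).1]
    have := hun1 (n - 1) (by omega)
    have h2 : nx (n - 1) = 0 := by simp only [nx]; rw [if_pos (by omega)]
    rwa [h2, Nat.sub_add_cancel hpos] at this
  have hgnh : g n M.h = M.h := by
    rw [hMh, (hg n le_rfl).2]
    have := hhn1 (n - 1) (by omega)
    have h2 : nx (n - 1) = 0 := by simp only [nx]; rw [if_pos (by omega)]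
    rwa [h2, Nat.sub_add_cancel hpos] at this
  -- The holonomy fixes the normal and the pole of the starting cap, so it only acts on the summand
  -- ℝ^(d-2).
  obtain ⟨Q, ⟨S, hS, hS0, hS1⟩, hQ⟩ := isotopicToId_of_isoDet M.j (g n) hdetn fun x hx => by
    rw [M.eq_smul_add_smul hx, map_add, map_smul, map_smul, hgnu, hgnh]
  have hQpt : ∀ z t, g n (M.pt (z, t)) = M.pt (Q z, t) := fun z t => by
    rw [Splitting.pt, Splitting.pt, map_add, map_smul, hgnh, hQ]
  have hgu : ∀ k : Fin n, g k M.u = (N.cap (c k)).normal := fun k => by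
    rw [hMu, (hg k k.2.le).1, hu k k.2]
  have hgh : ∀ k : Fin n, g k M.h = (arm k true).foot.pole := fun k => by
    rw [hMh, (hg k k.2.le).2, hh k k.2]
  -- All gluings are trivial except at the seam, where the first bead uses the frame `g 0 = 1`
  -- instead of `g n`.
  have hglue : ∀ k k' : Fin n, (k' : ℕ) = nx k → ∀ z : Euc (d - 2), ‖z‖ ^ 2 ≤ 1 →
      (N.between _ _ (hadjb k true)).link.glue (rimParam M (N.cap (c k)) (g k) true z) =
        rimParam M (N.cap (c k')) (g k') false ((if (k : ℕ) + 1 = n then Q else 1) z) := by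
    intro k k' hk z hz
    rw [rimParam, capParam, Link.glue_param _ (by
      rw [(g k).norm_map]; exact M.norm_pt_hemi hz true), ← hAk k k.2, hstep, rimParam, capParam]
    have h1 : c (nb k true) = c k' := congrArg c hk.symm
    rw [h1]
    congr 1
    split_ifs with h2
    · have h3 : (k' : ℕ) = 0 := by rw [hk]; simp only [nx]; rw [if_pos h2]
      have h4 : hemi (Q z) = hemi z := by simp [hemi]
      rw [h2, h3, hg0, hQpt, h4]
      simp
    · have h3 : (k' : ℕ) = k + 1 := by rw [hk]; simp only [nx]; rw [if_neg h2]
      rw [h3]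
      simp
  have harm : ∀ (k : Fin n) e, (arm k e).foot.pole = boolSign e • g k M.h := fun k e => by
    rw [hgh]
    cases e
    · rw [hopp]; simp
    · simp
  let P : Necklace (Euc (d - 2)) (Euc d) n := capNecklace M (fun k => N.cap (c k))
    (fun k k' hk => N.cap_disjoint _ _ fun h => hk (Fin.ext (hc _ _ k.2 k'.2 h)))
    (fun k => g k) hgu arm
    harm
    (fun k k' => (k' : ℕ) = nx k) (fun k => if (k : ℕ) + 1 = n then Q else 1)
    (fun k => (N.between _ _ (hadjb k true)).link.glue) hglue
    (fun k e k' p hp t ht h0 => N.firstHalf_notMem_cap _ hp ht h0 _)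
    (fun k e k' e' p hp t ht p' hp' t' ht' h0 h0' hne' heq => by
      rcases N.firstHalf_eq_firstHalf (hadjb k e) (hadjb k' e') hp ht hp' ht' h0 h0' heq with
        ⟨h1, h2⟩ | ⟨h1, h2, h3, h4, h5⟩
      · have hk : k = k' := Fin.ext (hc _ _ k.2 k'.2 h1)
        subst hk
        have h6 := hc _ _ (hnb k e) (hnb k e') h2
        have h7 := hne k k.2
        cases e <;> cases e'
        · exact absurd rfl hne'
        · exact absurd h6.symm h7
        · exact absurd h6 h7
        · exact absurd rfl hne'
      · have h6 := hc _ _ k.2 (hnb k' e') h1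
        have h7 := hc _ _ (hnb k e) k'.2 h2
        have h8 := hne k k.2
        have h9 := hne k' k'.2
        cases e <;> cases e'
        -- Two negative arms meeting at their ends would make `k'` both the predecessor and the
        -- successor of `k`.
        · exfalso
          have h10 := hnxpv k' k'.2
          change (k : ℕ) = pv k' at h6
          change pv k = k' at h7
          rw [← h6] at h10
          exact h8 (h10.trans h7.symm)
        -- With the two arms exchanged, the same lemma expresses `p` through the gluing of the
        -- positive arm, which is the direction required here.
        · rcases N.firstHalf_eq_firstHalf (hadjb k' true) (hadjb k false) hp' ht' hp ht h0' h0
            heq.symm with ⟨h11, -⟩ | ⟨-, -, -, -, h12⟩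
          · exfalso
            have hk := hc _ _ k'.2 k.2 h11
            change (k : ℕ) = nx k' at h6
            simp only [nx] at h6
            split_ifs at h6 <;> omega
          · exact Or.inr ⟨rfl, rfl, h3, h4, h6, h12⟩
        · exact Or.inl ⟨rfl, rfl, h3, h4, h7.symm, h5⟩
        · exfalso
          have h10 := hpvnx k' k'.2
          change (k : ℕ) = nx k' at h6
          change nx k = k' at h7
          rw [← h6] at h10
          exact h8 (h7.trans h10.symm))
    (fun k k' hk p hp => by
      have h1 : nb k true = k' := hk.symm
      have h2 : nb k' false = k := by
        change pv k' = k
        rw [hk, hpvnx k k.2]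
      have h3 := N.firstHalf_one (hadjb k true) (N.adj_symm (hadjb k true)) p
      refine h3.trans ?_
      have key : ∀ (i i' j j' : Fin n) (h : N.Adj i j) (h' : N.Adj i' j'), i = i' → j = j' →
          (N.between i j h).firstHalf.toFun = (N.between i' j' h').firstHalf.toFun := by
        rintro i _ j _ h h' rfl rfl; rfl
      exact congrFun (key _ _ _ _ _ _ (congrArg c h1) (congrArg c h2.symm)) _)
  have hheight : ∀ k k' : Fin n, (k' : ℕ) = nx k →
      (P.bead k).height true = (P.bead k').height false := by
    intro k k' hk
    change (N.between _ _ (hadjb k true)).link.source.height =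
      (N.between _ _ (hadjb k' false)).link.source.height
    rw [(N.between _ _ (hadjb k true)).link.height_eq,
      ← N.between_symm_source (hadjb k true) (N.adj_symm (hadjb k true))]
    have key : ∀ (i i' j j' : Fin n) (h : N.Adj i j) (h' : N.Adj i' j'), i = i' → j = j' →
        (N.between i j h).link.source.height = (N.between i' j' h').link.source.height := by
      rintro i _ j _ h h' rfl rfl; rfl
    have h1 : nb k true = k' := hk.symm
    have h2 : nb k' false = k := by
      change pv k' = k
      rw [hk, hpvnx k k.2]
    exact key _ _ _ _ _ _ (congrArg c h1) (congrArg c h2.symm)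
  have hmate : ∀ k k' z z', P.mate k k' z z' ↔ ((k' : ℕ) = k + 1 ∧ z' = z) ∨
      ((k : ℕ) + 1 = n ∧ (k' : ℕ) = 0 ∧ z' = Q z) := by
    intro k k' z z'
    change ((k' : ℕ) = nx k ∧ z' = (if (k : ℕ) + 1 = n then Q else 1) z) ↔ _
    have := k'.2
    simp only [nx]
    split_ifs with h1
    · constructor
      · exact fun h => Or.inr ⟨h1, h⟩
      · rintro (h | h)
        · omega
        · exact h.2
    · constructor
      · exact fun h => Or.inl h
      · rintro (h | h)
        · exact h
        · exact absurd h.1 h1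
  have hres := P.nonempty_homeomorph_circle hpos Q hmate
    (fun k k' hk => hheight k k' (by
      have := k'.2
      simp only [nx]; rw [if_neg (by omega)]; exact hk))
    (fun k k' hk hk' => hheight k k' (by simp only [nx]; rw [if_pos hk]; exact hk'))
    (fun _ _ => trivial) S hS hS0 hS1
  have himg : (⋃ k, (P.bead k).map '' (P.bead k).dom) = N.union := by
    have h1 : ∀ k, (P.bead k).map '' (P.bead k).dom =
        (N.cap (c k)).carrier ∪ ⋃ e, (arm k e).carrier := fun k =>
      image_capBead_map (hgu k) (arm k) (harm k)
    simp only [h1]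
    refine Subset.antisymm (iUnion_subset fun k => union_subset ?_ (iUnion_subset fun e => ?_))
      (union_subset (iUnion_subset fun i => ?_) (iUnion_subset fun i => iUnion_subset fun j =>
        iUnion_subset fun hij => ?_))
    · exact (subset_iUnion (fun i => (N.cap i).carrier) (c k)).trans subset_union_left
    · refine (Connector.firstHalf_carrier_subset _).trans (Subset.trans ?_ subset_union_right)
      rcases N.adj_iff.1 (hadjb k e) with hd | hd
      · rw [N.between_of_dir _ hd]
        exact subset_iUnion_of_subset _ (subset_iUnion_of_subset _ (subset_iUnion_of_subset hd
          subset_rfl))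
      · rw [N.between_of_dir_symm _ hd, Connector.carrier_symm]
        exact subset_iUnion_of_subset _ (subset_iUnion_of_subset _ (subset_iUnion_of_subset hd
          subset_rfl))
    · obtain ⟨k, hk, rfl⟩ := hsurj i
      exact subset_iUnion_of_subset ⟨k, hk⟩ subset_union_left
    · have key : ∀ i j (h : N.Adj i j), (∃ k < n, ∃ e, i = c k ∧ j = c (nb k e)) →
          (N.between i j h).firstHalf.carrier ⊆
            ⋃ k : Fin n, (N.cap (c k)).carrier ∪ ⋃ e, (arm k e).carrier := by
        rintro _ _ h ⟨k, hk, e, rfl, rfl⟩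
        exact subset_iUnion_of_subset ⟨k, hk⟩ (Subset.trans
          (subset_iUnion (fun e => (arm ⟨k, hk⟩ e).carrier) e) subset_union_right)
      rw [N.carrier_conn_eq_union hij]
      have hboth : ∃ k < n, (i = c k ∧ j = c (nx k)) ∨ (j = c k ∧ i = c (nx k)) := by
        rcases hall i j hij with ⟨k, hk, h⟩ | ⟨rfl, rfl⟩ | ⟨rfl, rfl⟩
        · refine ⟨k, by omega, ?_⟩
          have : nx k = k + 1 := if_neg (by omega)
          rwa [this]
        · have : nx (n - 1) = 0 := if_pos (by omega)
          exact ⟨n - 1, by omega, Or.inl ⟨rfl, by rw [this]⟩⟩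
        · have : nx (n - 1) = 0 := if_pos (by omega)
          exact ⟨n - 1, by omega, Or.inr ⟨rfl, by rw [this]⟩⟩
      obtain ⟨k, hk, hk'⟩ := hboth
      have h2 : c k = c (nb (nx k) false) := congrArg c (hpvnx k hk).symm
      rcases hk' with ⟨rfl, rfl⟩ | ⟨rfl, rfl⟩
      · exact union_subset (key _ _ _ ⟨k, hk, true, rfl, rfl⟩)
          (key _ _ _ ⟨nx k, hnx k hk, false, rfl, h2⟩)
      · exact union_subset (key _ _ _ ⟨nx k, hnx k hk, false, rfl, h2⟩)
          (key _ _ _ ⟨k, hk, true, rfl, rfl⟩)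
  rw [himg] at hres
  exact hres

end Network
end

/-! ### The open chain with two unbounded ends. -/

noncomputable section

/-- Preimages of bounded sets in a bead are bounded if this holds for its arms. -/
theorem exists_abs_le_of_capBead {d : ℕ} {H : Type*} [NormedAddCommGroup H] [InnerProductSpace ℝ H]
    {M : Splitting H (Euc d)} {C : HyperCap d} {g : Euc d ≃ₗᵢ[ℝ] Euc d} (hg : g M.u = C.normal)
    (arm : Bool → Arm C) (harm : ∀ e, (arm e).foot.pole = boolSign e • g M.h) (B : Set (Euc d))
    (hB : ∀ e, ∃ a, ∀ p ∈ (arm e).foot.carrier, ∀ s ∈ armTimes (arm e).bounded,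
      (arm e).toFun (p, s) ∈ B → s ≤ a) :
    ∃ a, ∀ x ∈ (capBead hg arm harm).dom, (capBead hg arm harm).map x ∈ B → |x.2| ≤ a := by
  choose a ha using hB
  -- On an arm the height is `hemi z + time * (2 - hemi z)`, at most `1 + 2 * time` because `0 ≤
  -- hemi ≤ 1` and the time is nonnegative.
  refine ⟨1 + 2 * (|a true| + |a false|), fun x hx hxB => ?_⟩
  have hq := hemi_le_one x.1
  have hq0 := hemi_nonneg x.1
  have h1 := abs_nonneg (a true)
  have h2 := abs_nonneg (a false)
  by_cases h : |x.2| ≤ hemi x.1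
  · linarith
  · have hm := rimParam_mem_of_armDom hg arm harm
      ((capBead hg arm harm).mem_armDom hx (not_le.1 h))
    rw [Bead.map, if_neg h] at hxB
    have h3 := ha _ _ hm.1 _ hm.2 hxB
    have h4 : a (decide (0 < x.2)) ≤ |a true| + |a false| := by
      cases decide (0 < x.2)
      · linarith [le_abs_self (a false)]
      · linarith [le_abs_self (a true)]
    have h5 := h3.trans h4
    rw [Bead.time, div_le_iff₀ (Bead.two_sub_hemi_pos _)] at h5
    nlinarith

namespace Network

variable {d n : ℕ} (N : Network d n)

/-- An open chain of caps and connectors, with two unbounded arms at its ends, is a product of a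
ball with a line. -/
theorem nonempty_homeomorph_strip (hn : 2 ≤ n) (c : ℕ → Fin n)
    (hc : ∀ k l, k < n → l < n → c k = c l → k = l) (hsurj : ∀ i, ∃ k, k < n ∧ c k = i)
    (hadj : ∀ k, k + 1 < n → N.Adj (c k) (c (k + 1)))
    (hall : ∀ i j, N.dir i j → ∃ k, k + 1 < n ∧
      ((i = c k ∧ j = c (k + 1)) ∨ (j = c k ∧ i = c (k + 1))))
    (tail : ∀ e : Bool, Arm (N.cap (c (if e then n - 1 else 0))))
    (hbdd : ∀ e, ¬ (tail e).bounded)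
    (hfree : ∀ e j (h : N.Adj (c (if e then n - 1 else 0)) j),
      (tail e).foot.pole = -(N.between _ j h).link.source.pole)
    (hcap : ∀ e, ∀ p ∈ (tail e).foot.carrier, ∀ s, 0 < s → ∀ i,
      (tail e).toFun (p, s) ∉ (N.cap i).carrier)
    (hconn : ∀ e i j h, (tail e).carrier ∩ (N.conn i j h).carrier ⊆ ⋃ m, (N.cap m).carrier)
    (hdisj : Disjoint (tail true).carrier (tail false).carrier)
    (hprop : ∀ e, ∀ B : Set (Euc d), Bornology.IsBounded B → ∃ a, ∀ p ∈ (tail e).foot.carrier,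
      ∀ s, 0 ≤ s → (tail e).toFun (p, s) ∈ B → s ≤ a) :
    Nonempty (↥(N.union ∪ (tail true).carrier ∪ (tail false).carrier) ≃ₜ
      Metric.closedBall (0 : Euc (d - 2)) 1 × ℝ) := by
  have hpos : 0 < n := by omega
  -- Neighbouring positions; they are meaningful only on the sides where `inner` holds, the other
  -- two sides carry the tails.
  let nb : ℕ → Bool → ℕ := fun k e => if e then k + 1 else k - 1
  let inner : ℕ → Bool → Prop := fun k e => if e then k + 1 < n else 0 < k
  have hnb : ∀ k e, k < n → inner k e → nb k e < n := fun k e hk h => by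
    cases e
    · change k - 1 < n; omega
    · exact h
  have hadjb : ∀ (k : Fin n) e, inner k e → N.Adj (c k) (c (nb k e)) := fun k e h => by
    cases e
    · change 0 < (k : ℕ) at h
      have := N.adj_symm (hadj (k - 1) (by omega))
      rwa [Nat.sub_add_cancel h] at this
    · exact hadj k h
  have hend : ∀ (k : Fin n) e, ¬ inner k e → (k : ℕ) = if e then n - 1 else 0 := fun k e h => by
    have := k.2
    cases e
    · change ¬ 0 < (k : ℕ) at h; simp; omega
    · change ¬ (k : ℕ) + 1 < n at h; simp; omega
  have hexists : ∀ (k : Fin n) e, ∃ a : Arm (N.cap (c k)),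
      (∀ h : inner k e, a = (N.between _ _ (hadjb k e h)).firstHalf) ∧
      (¬ inner k e → a.toFun = (tail e).toFun ∧ a.foot.carrier = (tail e).foot.carrier ∧
        a.foot.pole = (tail e).foot.pole ∧ a.bounded = (tail e).bounded) := fun k e => by
    by_cases h : inner k e
    · exact ⟨(N.between _ _ (hadjb k e h)).firstHalf, fun _ => rfl, fun h' => absurd h h'⟩
    · have key : ∀ m, m = (if e then n - 1 else 0) → ∃ a : Arm (N.cap (c m)),
          a.toFun = (tail e).toFun ∧ a.foot.carrier = (tail e).foot.carrier ∧
          a.foot.pole = (tail e).foot.pole ∧ a.bounded = (tail e).bounded := by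
        rintro _ rfl
        exact ⟨tail e, rfl, rfl, rfl, rfl⟩
      obtain ⟨a, ha⟩ := key k (hend k e h)
      exact ⟨a, fun h' => absurd h' h, fun _ => ha⟩
  choose arm harmi harmo using hexists
  have htail : ∀ {k : Fin n} {e}, ¬ inner k e → ∀ {p s}, p ∈ (arm k e).foot.carrier →
      s ∈ armTimes (arm k e).bounded → p ∈ (tail e).foot.carrier ∧ 0 ≤ s ∧
        (arm k e).toFun (p, s) ∈ (tail e).carrier ∧
        (arm k e).toFun (p, s) = (tail e).toFun (p, s) := fun {k e} h {p s} hp hs => by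
    obtain ⟨h1, h2, -, h4⟩ := harmo k e h
    rw [h2] at hp
    rw [h4] at hs
    rw [h1]
    exact ⟨hp, hs.1, ⟨_, mk_mem_prod hp hs, rfl⟩, rfl⟩
  have hfreeb : ∀ (k : Fin n) e e', ¬ inner k e → inner k e' →
      (arm k e).foot.pole = -(arm k e').foot.pole := fun k e e' h h' => by
    rw [(harmo k e h).2.2.1, harmi k e' h']
    have key : ∀ m j (hm : m = if e then n - 1 else 0) (h : N.Adj (c m) j),
        (tail e).foot.pole = -(N.between (c m) j h).link.source.pole := by
      rintro _ j rfl h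
      exact hfree e j h
    exact key k _ (hend k e h) _
  have hopp : ∀ k, (arm k false).foot.pole = -(arm k true).foot.pole := fun k => by
    by_cases h : inner k true <;> by_cases h' : inner k false
    · rw [harmi k true h, harmi k false h']
      refine N.between_opposite (hadjb k true h) (hadjb k false h') fun heq => ?_
      have := hc _ _ (hnb k true k.2 h) (hnb k false k.2 h') heq
      change (k : ℕ) + 1 = k - 1 at this
      omega
    · exact hfreeb k false true h' h
    · rw [hfreeb k true false h h', neg_neg]
    -- A cap with both tails would be at the positions 0 and `n - 1` at once, which `2 ≤ n`
    -- excludes.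
    · have h1 := hend k true h
      have h2 := hend k false h'
      simp only [if_true] at h1
      simp at h2
      omega
  have hcapb : ∀ (k : Fin n) e (i : Fin n), ∀ p ∈ (arm k e).foot.carrier,
      ∀ s ∈ armTimes (arm k e).bounded, 0 < s → (arm k e).toFun (p, s) ∉ (N.cap i).carrier := by
    intro k e i p hp s hs h0
    by_cases h : inner k e
    · rw [harmi k e h] at hp hs ⊢
      exact N.firstHalf_notMem_cap _ hp hs h0 _
    · obtain ⟨h1, -, -, h2⟩ := htail h hp hs
      rw [h2]
      exact hcap e p h1 s h0 i
  let u : ℕ → Euc d := fun k => (N.cap (c k)).normal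
  let h : ℕ → Euc d := fun k => if hk : k < n then (arm ⟨k, hk⟩ true).foot.pole else 0
  let A : ℕ → Euc d ≃ₗᵢ[ℝ] Euc d := fun k => if hk : k + 1 < n then
    (N.between _ _ (hadj k hk)).link.frame else 1
  have hh : ∀ k (hk : k < n), h k = (arm ⟨k, hk⟩ true).foot.pole := fun k hk => dif_pos hk
  have hAk : ∀ k (hk : k + 1 < n), A k = (N.between _ _ (hadj k hk)).link.frame :=
    fun k hk => dif_pos hk
  have harmt : ∀ k (hk : k + 1 < n), arm ⟨k, by omega⟩ true =
      (N.between _ _ (hadj k hk)).firstHalf := fun k hk => harmi ⟨k, by omega⟩ true hk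
  have harmf : ∀ k (hk : k + 1 < n), arm ⟨k + 1, hk⟩ false =
      (N.between _ _ (N.adj_symm (hadj k hk))).firstHalf :=
    fun k hk => harmi ⟨k + 1, hk⟩ false (Nat.succ_pos k)
  have huh : Inner.inner ℝ (u 0) (h 0) = 0 := by
    rw [hh 0 hpos, real_inner_comm]; exact (arm ⟨0, hpos⟩ true).foot.pole_normal
  -- An open chain never returns to its first cap, so all gluings become the identity and no
  -- condition on determinants arises.
  obtain ⟨g, hg0, hgs, hg⟩ := exists_frames u h A (n - 1) huh
    (fun k hk => by
      rw [hAk k (by omega)]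
      exact (N.between _ _ (hadj k (by omega))).link.frame_normal)
    (fun k hk => by
      rw [hAk k (by omega), hh k (by omega), hh (k + 1) (by omega), ← hopp, harmt k (by omega),
        harmf k (by omega)]
      change _ = (N.between _ _ (N.adj_symm (hadj k (by omega)))).link.source.pole
      rw [N.between_symm_source (hadj k (by omega))]
      exact (N.between _ _ (hadj k (by omega))).link.frame_pole)
  have hh0 : ‖h 0‖ = 1 := by rw [hh 0 hpos]; exact (arm ⟨0, hpos⟩ true).foot.norm_pole
  obtain ⟨M, hMu, hMh⟩ := nonempty_splitting (HyperCap.norm_normal _) hh0 huh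
  rw [← hMh] at hgs
  have hstep := fun k => M.apply_frame_pt (hgs k)
  have hgu : ∀ k : Fin n, g k M.u = (N.cap (c k)).normal := fun k => by
    rw [hMu]; exact (hg k (by omega)).1
  have hgh : ∀ k : Fin n, g k M.h = (arm k true).foot.pole := fun k => by
    rw [hMh, (hg k (by omega)).2, hh k k.2]
  have harm : ∀ (k : Fin n) e, (arm k e).foot.pole = boolSign e • g k M.h := fun k e => by
    rw [hgh]
    cases e
    · rw [hopp]; simp
    · simp
  -- The value at the last cap is arbitrary, since that cap has no successor.
  let glue : Fin n → Euc d → Euc d := fun k => if hk : (k : ℕ) + 1 < n then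
    (N.between _ _ (hadj k hk)).link.glue else id
  have hgk : ∀ k (hk : k + 1 < n), glue ⟨k, by omega⟩ = (N.between _ _ (hadj k hk)).link.glue :=
    fun k hk => dif_pos hk
  let P : Necklace (Euc (d - 2)) (Euc d) n := capNecklace M (fun k => N.cap (c k))
    (fun k k' hk => N.cap_disjoint _ _ fun h => hk (Fin.ext (hc _ _ k.2 k'.2 h)))
    (fun k => g k) hgu arm harm (fun k k' => (k' : ℕ) = k + 1) (fun _ => 1) glue
    (fun k k' hk z hz => by
      obtain ⟨k, hk1⟩ := k
      obtain ⟨k', hk2⟩ := k'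
      obtain rfl : k' = k + 1 := hk
      rw [hgk k hk2, rimParam, capParam, Link.glue_param _ (by
        rw [(g k).norm_map]; exact M.norm_pt_hemi hz true), ← hAk k hk2, hstep, rimParam, capParam]
      simp)
    (fun k e k' => hcapb k e (c k'))
    (fun k e k' e' p hp t ht p' hp' t' ht' h0 h0' hne heq => by
      -- A tail meets connectors only on caps, and at positive times it lies on no cap.
      have mixed : ∀ {k : Fin n} {e} {k' : Fin n} {e'}, inner k e → ¬ inner k' e' →
          ∀ {p t p' t'}, p ∈ (arm k e).foot.carrier → t ∈ armTimes (arm k e).bounded →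
          p' ∈ (arm k' e').foot.carrier → t' ∈ armTimes (arm k' e').bounded → 0 < t' →
          (arm k e).toFun (p, t) ≠ (arm k' e').toFun (p', t') := by
        intro k e k' e' h h' p t p' t' hp ht hp' ht' h0' heq
        have h1 := (htail h' hp' ht').2.2.1
        have h2 : (arm k' e').toFun (p', t') ∈ ⋃ m, (N.cap m).carrier := by
          rw [harmi k e h] at hp ht heq
          have h3 := (N.between _ _ (hadjb k e h)).firstHalf_carrier_subset
            ⟨_, mk_mem_prod hp ht, rfl⟩
          rw [heq] at h3
          rcases N.adj_iff.1 (hadjb k e h) with hd | hd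
          · rw [N.between_of_dir _ hd] at h3
            exact hconn e' _ _ hd ⟨h1, h3⟩
          · rw [N.between_of_dir_symm _ hd, Connector.carrier_symm] at h3
            exact hconn e' _ _ hd ⟨h1, h3⟩
        obtain ⟨m, hm⟩ := mem_iUnion.1 h2
        exact hcapb k' e' m p' hp' t' ht' h0' hm
      by_cases hi : inner k e <;> by_cases hi' : inner k' e'
      · have h1 := hp
        have h2 := hp'
        have h3 := ht
        have h4 := ht'
        have h5 := heq
        rw [harmi k e hi] at h1 h3 h5
        rw [harmi k' e' hi'] at h2 h4 h5
        rcases N.firstHalf_eq_firstHalf _ _ h1 h3 h2 h4 h0 h0' h5 with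
          ⟨h6, h7⟩ | ⟨h6, h7, h8, h9, h10⟩
        · exfalso
          have hk : k = k' := Fin.ext (hc _ _ k.2 k'.2 h6)
          subst hk
          have h11 := hc _ _ (hnb k e k.2 hi) (hnb k e' k.2 hi') h7
          cases e <;> cases e'
          · exact absurd rfl hne
          · change (k : ℕ) - 1 = k + 1 at h11; omega
          · change (k : ℕ) + 1 = k - 1 at h11; omega
          · exact absurd rfl hne
        · have h11 := hc _ _ k.2 (hnb k' e' k'.2 hi') h6
          have h12 := hc _ _ (hnb k e k.2 hi) k'.2 h7
          cases e <;> cases e'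
          · exfalso
            change (k : ℕ) = k' - 1 at h11
            change (k : ℕ) - 1 = k' at h12
            change 0 < (k : ℕ) at hi
            omega
          · rcases N.firstHalf_eq_firstHalf _ _ h2 h4 h1 h3 h0' h0 h5.symm with
              ⟨h13, -⟩ | ⟨-, -, -, -, h14⟩
            · exfalso
              have hk := hc _ _ k'.2 k.2 h13
              change (k : ℕ) = k' + 1 at h11
              omega
            · refine Or.inr ⟨rfl, rfl, h8, h9, h11, ?_⟩
              rw [show glue k' = _ from hgk k' hi']
              exact h14
          · refine Or.inl ⟨rfl, rfl, h8, h9, h12.symm, ?_⟩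
            rw [show glue k = _ from hgk k hi]
            exact h10
          · exfalso
            change (k : ℕ) = k' + 1 at h11
            change (k : ℕ) + 1 = k' at h12
            omega
      · exact absurd heq (mixed hi hi' hp ht hp' ht' h0')
      · exact absurd heq.symm (mixed hi' hi hp' ht' hp ht h0)
      · exfalso
        have h1 := (htail hi hp ht).2.2.1
        have h2 := (htail hi' hp' ht').2.2.1
        rw [← heq] at h2
        have h3 := hend k e hi
        have h4 := hend k' e' hi'
        cases e <;> cases e'
        · exact hne (by rw [Fin.ext (h3.trans h4.symm)])
        · exact hdisj.le_bot ⟨h2, h1⟩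
        · exact hdisj.le_bot ⟨h1, h2⟩
        · exact hne (by rw [Fin.ext (h3.trans h4.symm)]))
    (fun k k' hk p hp => by
      obtain ⟨k, hk1⟩ := k
      obtain ⟨k', hk2⟩ := k'
      obtain rfl : k' = k + 1 := hk
      rw [hgk k hk2, harmt k hk2, harmf k hk2]
      exact N.firstHalf_one (hadj k hk2) _ p)
  have hres := P.nonempty_homeomorph_line hpos
    (fun k k' z z' => by
      change (k' : ℕ) = k + 1 ∧ z' = z ↔ _
      rfl)
    (fun k k' hk => by
      obtain ⟨k, hk1⟩ := k
      obtain ⟨k', hk2⟩ := k'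
      obtain rfl : k' = k + 1 := hk
      change (arm _ true).foot.height = (arm _ false).foot.height
      rw [harmt k hk2, harmf k hk2]
      change (N.between _ _ (hadj k hk2)).link.source.height =
        (N.between _ _ (N.adj_symm (hadj k hk2))).link.source.height
      rw [N.between_symm_source (hadj k hk2)]
      exact (N.between _ _ (hadj k hk2)).link.height_eq)
    (fun k => by
      change (arm k true).bounded ↔ inner k true
      by_cases hi : inner k true
      · rw [harmi k true hi]; exact iff_of_true trivial hi
      · rw [(harmo k true hi).2.2.2]; exact iff_of_false (hbdd true) hi)
    (fun k => by
      change (arm k false).bounded ↔ inner k false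
      by_cases hi : inner k false
      · rw [harmi k false hi]; exact iff_of_true trivial hi
      · rw [(harmo k false hi).2.2.2]; exact iff_of_false (hbdd false) hi)
    (fun k B hB => by
      refine exists_abs_le_of_capBead (hgu k) (arm k) (harm k) B fun e => ?_
      by_cases hi : inner k e
      · refine ⟨1, fun p hp s hs _ => ?_⟩
        rw [harmi k e hi] at hs
        exact hs.2 trivial
      · obtain ⟨a, ha⟩ := hprop e B hB
        refine ⟨a, fun p hp s hs hsB => ?_⟩
        obtain ⟨h1, h2, -, h3⟩ := htail hi hp hs
        rw [h3] at hsB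
        exact ha p h1 s h2 hsB)
  have himg : (⋃ k, (P.bead k).map '' (P.bead k).dom) =
      N.union ∪ (tail true).carrier ∪ (tail false).carrier := by
    have h1 : ∀ k, (P.bead k).map '' (P.bead k).dom =
        (N.cap (c k)).carrier ∪ ⋃ e, (arm k e).carrier := fun k =>
      image_capBead_map (hgu k) (arm k) (harm k)
    simp only [h1]
    have htails : ∀ e, (tail e).carrier ⊆ N.union ∪ (tail true).carrier ∪ (tail false).carrier := by
      rintro (_ | _)
      · exact subset_union_right
      · exact subset_union_right.trans subset_union_left
    have hu : N.union ⊆ N.union ∪ (tail true).carrier ∪ (tail false).carrier :=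
      subset_union_left.trans subset_union_left
    have harmc :
        ∀ (k : Fin n) e, ¬ inner k e → (arm k e).carrier = (tail e).carrier := fun k e hi => by
      obtain ⟨h1, h2, -, h4⟩ := harmo k e hi
      rw [Arm.carrier, Arm.carrier, h1, h2, h4]
    have hsub : ∀ (k : Fin n) e, (arm k e).carrier ⊆
        ⋃ k : Fin n, (N.cap (c k)).carrier ∪ ⋃ e, (arm k e).carrier := fun k e =>
      subset_iUnion_of_subset k (Subset.trans
        (subset_iUnion (fun e => (arm k e).carrier) e) subset_union_right)
    have htsub : ∀ e, (tail e).carrier ⊆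
        ⋃ k : Fin n, (N.cap (c k)).carrier ∪ ⋃ e, (arm k e).carrier := by
      rintro (_ | _)
      · rw [← harmc ⟨0, hpos⟩ false (lt_irrefl 0)]
        exact hsub _ _
      · rw [← harmc ⟨n - 1, by omega⟩ true (by change ¬ n - 1 + 1 < n; omega)]
        exact hsub _ _
    refine Subset.antisymm (iUnion_subset fun k => union_subset ?_ (iUnion_subset fun e => ?_))
      (union_subset (union_subset (union_subset (iUnion_subset fun i => ?_)
        (iUnion_subset fun i => iUnion_subset fun j => iUnion_subset fun hij => ?_))
        (htsub true)) (htsub false))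
    · exact ((subset_iUnion (fun i => (N.cap i).carrier) (c k)).trans subset_union_left).trans hu
    · by_cases hi : inner k e
      · rw [harmi k e hi]
        refine (Connector.firstHalf_carrier_subset _).trans
          (Subset.trans (Subset.trans ?_ subset_union_right) hu)
        rcases N.adj_iff.1 (hadjb k e hi) with hd | hd
        · rw [N.between_of_dir _ hd]
          exact subset_iUnion_of_subset _ (subset_iUnion_of_subset _
            (subset_iUnion_of_subset hd subset_rfl))
        · rw [N.between_of_dir_symm _ hd, Connector.carrier_symm]
          exact subset_iUnion_of_subset _ (subset_iUnion_of_subset _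
            (subset_iUnion_of_subset hd subset_rfl))
      · rw [harmc k e hi]; exact htails e
    · obtain ⟨k, hk, rfl⟩ := hsurj i
      exact subset_iUnion_of_subset ⟨k, hk⟩ subset_union_left
    · rw [N.carrier_conn_eq_union hij]
      obtain ⟨k, hk, ⟨rfl, rfl⟩ | ⟨rfl, rfl⟩⟩ := hall i j hij
      · exact union_subset (harmt k hk ▸ hsub _ _) (harmf k hk ▸ hsub _ _)
      · exact union_subset (harmf k hk ▸ hsub _ _) (harmt k hk ▸ hsub _ _)
  rw [himg] at hres
  exact hres

end Network
end

/-! ### Application to the two constructions. -/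

noncomputable section

theorem Foot.Opposite.symm {d : ℕ} {C : HyperCap d} {F G : Foot C} (h : F.Opposite G) :
    G.Opposite F := (neg_eq_iff_eq_neg.2 h).symm

/-- The foot contains the rim point in the direction of its pole, whose relative height 1 exceeds
`height`. -/
theorem Foot.carrier_nonempty {d : ℕ} {C : HyperCap d} (F : Foot C) : F.carrier.Nonempty := by
  rw [HyperCap.foot_carrier_eq]
  refine Nonempty.image _ ⟨F.pole, ?_, F.norm_pole, ?_⟩
  · rw [real_inner_comm]; exact F.pole_normal
  · rw [real_inner_self_eq_norm_sq, F.norm_pole, one_pow]; exact F.height_lt.le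

/-- The straight connector along a link. -/
def Connector.ofLink {d : ℕ} {C C' : HyperCap d} (L : Link C C')
    (h : InjOn L.ruling (L.source.carrier ×ˢ Icc 0 1)) : Connector C C' where
  link := L
  toFun := L.ruling
  continuousOn := by
    have := L.continuous_glue
    unfold Link.ruling
    fun_prop
  injOn := h
  zero p _ := by simp [Link.ruling]
  one p _ := by simp [Link.ruling]

namespace CapChain

variable {d n : ℕ} (X : CapChain d n)

/-- Asymmetry also excludes loops, so the condition `i ≠ j` in the graph is automatic. -/
theorem adj_iff {i j : Fin n} : (SimpleGraph.fromRel fun i j => (i, j) ∈ X.edges).Adj i j ↔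
    (i, j) ∈ X.edges ∨ (j, i) ∈ X.edges := by
  rw [SimpleGraph.fromRel_adj]
  refine and_iff_right_of_imp ?_
  rintro h rfl
  exact X.edges_asymm _ _ (or_self_iff.1 h) (or_self_iff.1 h)

/-- The caps of a chain in their order. -/
theorem exists_order : ∃ c : ℕ → Fin n, c 0 = X.ia ∧ c (n - 1) = X.ib ∧
    (∀ k l, k < n → l < n → c k = c l → k = l) ∧ (∀ i, ∃ k, k < n ∧ c k = i) ∧
    (∀ k, k + 1 < n → (c k, c (k + 1)) ∈ X.edges ∨ (c (k + 1), c k) ∈ X.edges) ∧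
    ∀ i j, (i, j) ∈ X.edges → ∃ k, k + 1 < n ∧
      ((i = c k ∧ j = c (k + 1)) ∨ (j = c k ∧ i = c (k + 1))) := by
  obtain ⟨c, h0, h1, h2, h3, h4, h5⟩ :=
    exists_path_of_degree _ X.edges_connected X.ia_ne_ib X.edges_degree
  exact ⟨c, h0, h1, h2, h3, fun k hk => X.adj_iff.1 (h4 k hk),
    fun i j h => h5 i j (X.adj_iff.2 (Or.inl h))⟩

/-- The two ends of a chain of at least three caps are not neighbours. -/
theorem notMem_edges (hn : 3 ≤ n) : (X.ia, X.ib) ∉ X.edges ∧ (X.ib, X.ia) ∉ X.edges := by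
  obtain ⟨c, h0, h1, h2, -, -, h5⟩ := X.exists_order
  rw [← h0, ← h1]
  constructor <;> intro h <;> obtain ⟨k, hk, ⟨h6, h7⟩ | ⟨h6, h7⟩⟩ := h5 _ _ h <;>
  · have h8 := h2 _ _ (by omega) (by omega) h6
    have h9 := h2 _ _ (by omega) (by omega) h7
    omega

/-- The network of the caps and the partial hyper-cylinders. -/
def network : Network d n where
  cap := X.cap
  cap_disjoint := X.cap_disjoint
  dir i j := (i, j) ∈ X.edges
  dir_asymm := X.edges_asymm
  conn i j h := Connector.ofLink (X.link i j h) (X.link_injOn i j h)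
  inter_source i j h := (X.link_inter_source i j h).subset
  inter_target i j h := (X.link_inter_target i j h).subset
  disjoint_cap := X.link_disjoint_cap
  inter_conn := X.link_inter_link
  opposite_out_out := X.opposite_out_out
  opposite_in_in := X.opposite_in_in
  opposite_in_out := X.opposite_in_out

end CapChain

namespace FirstApproach

variable {d n : ℕ} (X : FirstApproach d n)

/-- The hyper-strip as a connector. -/
def stripConnector : Connector (X.cap X.ia) (X.cap X.ib) where
  link := X.strip
  toFun := X.stripMap
  continuousOn := X.strip_continuousOn
  injOn := X.strip_injOn
  zero := X.strip_zero
  one := X.strip_one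

theorem cylinder_subset {i j : Fin n} (h : (i, j) ∈ X.edges) :
    (X.link i j h).cylinder ⊆ X.cylinders :=
  subset_iUnion_of_subset i (subset_iUnion_of_subset j (subset_iUnion_of_subset h subset_rfl))

open Classical in
/-- All connectors. -/
def conn (i j : Fin n) (h : (i, j) ∈ X.edges ∨ (i = X.ia ∧ j = X.ib)) :
    Connector (X.cap i) (X.cap j) :=
  if h' : (i, j) ∈ X.edges then Connector.ofLink (X.link i j h') (X.link_injOn i j h')
  else (h.resolve_left h').1 ▸ (h.resolve_left h').2 ▸ X.stripConnector

variable {X}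

theorem conn_of_mem {i j : Fin n} (h : (i, j) ∈ X.edges ∨ (i = X.ia ∧ j = X.ib))
    (h' : (i, j) ∈ X.edges) :
    X.conn i j h = Connector.ofLink (X.link i j h') (X.link_injOn i j h') := dif_pos h'

theorem conn_strip (h : (X.ia, X.ib) ∈ X.edges ∨ (X.ia = X.ia ∧ X.ib = X.ib))
    (h' : (X.ia, X.ib) ∉ X.edges) : X.conn X.ia X.ib h = X.stripConnector := dif_neg h'

variable (X)

/-- The network of the caps and all connectors. -/
def network (hab : (X.ia, X.ib) ∉ X.edges) (hba : (X.ib, X.ia) ∉ X.edges) : Network d n where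
  cap := X.cap
  cap_disjoint := X.cap_disjoint
  -- The hyper-strip is one more connector; `hab` and `hba` say that its two caps are not joined
  -- already.
  dir i j := (i, j) ∈ X.edges ∨ (i = X.ia ∧ j = X.ib)
  dir_asymm i j h h' := by
    rcases id h with h1 | ⟨rfl, rfl⟩ <;> rcases id h' with h2 | ⟨h2, h3⟩
    · exact X.edges_asymm _ _ h1 h2
    · subst h2 h3; exact hba h1
    · exact hba h2
    · exact X.ia_ne_ib h3
  conn := X.conn
  inter_source i j h := by
    rcases id h with h1 | ⟨rfl, rfl⟩
    · rw [conn_of_mem h h1]; exact (X.link_inter_source i j h1).subset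
    · rw [conn_strip h hab]; exact X.strip_inter_source.subset
  inter_target i j h := by
    rcases id h with h1 | ⟨rfl, rfl⟩
    · rw [conn_of_mem h h1]; exact (X.link_inter_target i j h1).subset
    · rw [conn_strip h hab]; exact X.strip_inter_target.subset
  disjoint_cap i j h := by
    rcases id h with h1 | ⟨rfl, rfl⟩
    · rw [conn_of_mem h h1]; exact X.link_disjoint_cap i j h1
    · rw [conn_strip h hab]; exact X.strip_disjoint_cap
  inter_conn i j h k l h' hne := by
    rcases id h with h1 | ⟨rfl, rfl⟩ <;> rcases id h' with h2 | ⟨rfl, rfl⟩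
    · rw [conn_of_mem h h1, conn_of_mem h' h2]; exact X.link_inter_link _ _ _ _ _ _ hne
    · rw [conn_of_mem h h1, conn_strip h' hab]
      exact fun p hp => X.strip_inter_cylinders ⟨hp.2, X.cylinder_subset h1 hp.1⟩
    · rw [conn_strip h hab, conn_of_mem h' h2]
      exact fun p hp => X.strip_inter_cylinders ⟨hp.1, X.cylinder_subset h2 hp.2⟩
    · exact absurd rfl hne
  opposite_out_out i j k h h' hne := by
    rcases id h with h1 | ⟨rfl, rfl⟩ <;> rcases id h' with h2 | ⟨h2, h3⟩
    · rw [conn_of_mem h h1, conn_of_mem h' h2]; exact X.opposite_out_out _ _ _ _ _ hne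
    · subst h2 h3
      rw [conn_of_mem h h1, conn_strip h' hab]; exact X.strip_source_free.1 _ h1
    · rw [conn_strip h hab, conn_of_mem h' h2]; exact (X.strip_source_free.1 _ h2).symm
    · exact absurd h3.symm hne
  opposite_in_in i j k h h' hne := by
    rcases id h with h1 | ⟨rfl, rfl⟩ <;> rcases id h' with h2 | ⟨h2, h3⟩
    · rw [conn_of_mem h h1, conn_of_mem h' h2]; exact X.opposite_in_in _ _ _ _ _ hne
    · subst h2 h3
      rw [conn_of_mem h h1, conn_strip h' hab]; exact X.strip_target_free.2 _ h1
    · rw [conn_strip h hab, conn_of_mem h' h2]; exact (X.strip_target_free.2 _ h2).symm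
    · exact absurd h2.symm hne
  opposite_in_out i j k h h' := by
    rcases id h with h1 | ⟨rfl, rfl⟩ <;> rcases id h' with h2 | ⟨h2, h3⟩
    · rw [conn_of_mem h h1, conn_of_mem h' h2]; exact X.opposite_in_out _ _ _ _ _
    · subst h2 h3
      rw [conn_of_mem h h1, conn_strip h' hab]; exact X.strip_source_free.2 _ h1
    · rw [conn_strip h hab, conn_of_mem h' h2]; exact (X.strip_target_free.1 _ h2).symm
    · exact absurd h2.symm X.ia_ne_ib

theorem union_network (hab : (X.ia, X.ib) ∉ X.edges) (hba : (X.ib, X.ia) ∉ X.edges) :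
    (X.network hab hba).union = X.hypersurface := by
  rw [hypersurface, union_assoc]
  refine congrArg (X.caps ∪ ·) (Subset.antisymm ?_ (union_subset ?_ ?_))
  · refine iUnion_subset fun i => iUnion_subset fun j => iUnion_subset fun h => ?_
    change (X.conn i j h).carrier ⊆ _
    rcases id h with h1 | ⟨rfl, rfl⟩
    · rw [conn_of_mem h h1]; exact (X.cylinder_subset h1).trans subset_union_left
    · rw [conn_strip h hab]; exact subset_union_right
  · refine iUnion_subset fun i => iUnion_subset fun j => iUnion_subset fun h => ?_
    refine subset_iUnion_of_subset i (subset_iUnion_of_subset j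
      (subset_iUnion_of_subset (Or.inl h) ?_))
    change _ ⊆ (X.conn i j (Or.inl h)).carrier
    rw [conn_of_mem (Or.inl h) h]; exact subset_rfl
  · refine subset_iUnion_of_subset X.ia (subset_iUnion_of_subset X.ib
      (subset_iUnion_of_subset (Or.inr ⟨rfl, rfl⟩) ?_))
    change _ ⊆ (X.conn X.ia X.ib (Or.inr ⟨rfl, rfl⟩)).carrier
    rw [conn_strip (Or.inr ⟨rfl, rfl⟩) hab]; exact subset_rfl

theorem nonempty_homeomorph (hn : 3 ≤ n) :
    Nonempty (X.hypersurface ≃ₜ OrientableHyperStripLoop d) := by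
  obtain ⟨hab, hba⟩ := X.notMem_edges hn
  obtain ⟨c, h0, h1, h2, h3, h4, h5⟩ := X.exists_order
  obtain ⟨s, hs, hun, hun'⟩ := X.untwisted
  rw [← X.union_network hab hba]
  refine (X.network hab hba).nonempty_homeomorph_loop hn c h2 h3
    (fun k hk => (h4 k hk).imp Or.inl Or.inl) (Or.inr (Or.inr ⟨h0, h1⟩))
    (fun i j h => ?_) s hs (fun i j h => ?_)
  · rcases id h with h | ⟨rfl, rfl⟩
    · exact Or.inl (h5 i j h)
    · exact Or.inr (Or.inr ⟨h0.symm, h1.symm⟩)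
  · change (X.conn i j h).link.Untwisted (s i) (s j)
    rcases id h with h' | ⟨rfl, rfl⟩
    · rw [conn_of_mem h h']; exact hun i j h'
    · rw [conn_strip h hab]; exact hun'

end FirstApproach

theorem armTimes_false : armTimes False = Ici 0 := by
  ext; simp [armTimes]

namespace StripToInfinity

variable {d n : ℕ} {X : CapChain d n} {i : Fin n} {v : Euc d} (S : StripToInfinity X i v)

/-- The strip as an arm of its cap. -/
def arm : Arm (X.network.cap i) where
  foot := S.foot
  bounded := False
  toFun := S.toFun
  continuousOn := armTimes_false ▸ S.continuousOn
  injOn := armTimes_false ▸ S.injOn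
  zero := S.zero

theorem carrier_arm : S.arm.carrier = S.carrier := by
  change S.toFun '' (S.foot.carrier ×ˢ armTimes False) = _
  rw [armTimes_false]; rfl

/-- A point of the strip on a cap is a foot point, thus a value at time 0, and injectivity excludes
positive times. -/
theorem notMem_cap {p : Euc d} (hp : p ∈ S.foot.carrier) {s : ℝ} (hs : 0 < s) (j : Fin n) :
    S.toFun (p, s) ∉ (X.cap j).carrier := fun h => by
  have h1 : S.toFun (p, s) ∈ S.foot.carrier := by
    rw [← S.inter_cap]
    exact ⟨⟨_, mk_mem_prod hp hs.le, rfl⟩, mem_iUnion.2 ⟨j, h⟩⟩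
  have h2 := S.injOn (mk_mem_prod h1 self_mem_Ici) (mk_mem_prod hp hs.le) (S.zero _ h1)
  exact hs.ne (Prod.mk.inj h2).2

theorem exists_le_inner (r : ℝ) : ∃ a, ∀ p ∈ S.foot.carrier, ∀ s, a ≤ s →
    r ≤ inner ℝ v (S.toFun (p, s)) := by
  obtain ⟨t, ht, u, hu, h⟩ := eventually_prod_iff.1 (S.tendsto.eventually_ge_atTop r)
  obtain ⟨a, ha⟩ := eventually_atTop.1 hu
  exact ⟨a, fun p hp s hs => h (eventually_principal.1 ht p hp) (ha s hs)⟩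

/-- The functional `⟨v, ·⟩` is bounded on bounded sets but tends to infinity along the strip
uniformly over the foot; this is the properness that the quotient argument needs. -/
theorem exists_le_of_isBounded {B : Set (Euc d)} (hB : Bornology.IsBounded B) :
    ∃ a, ∀ p ∈ S.foot.carrier, ∀ s, S.toFun (p, s) ∈ B → s ≤ a := by
  obtain ⟨r, hr⟩ := hB.exists_norm_le
  obtain ⟨a, ha⟩ := S.exists_le_inner (‖v‖ * r + 1)
  refine ⟨a, fun p hp s hs => le_of_not_ge fun has => ?_⟩
  have h1 := ha p hp s has
  have h2 := real_inner_le_norm v (S.toFun (p, s))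
  have h3 := mul_le_mul_of_nonneg_left (hr _ hs) (norm_nonneg v)
  linarith

theorem not_isBounded : ¬ Bornology.IsBounded S.carrier := fun h => by
  obtain ⟨a, ha⟩ := S.exists_le_of_isBounded h
  obtain ⟨p, hp⟩ := S.foot.carrier_nonempty
  have h1 := ha p hp (|a| + 1) ⟨_, mk_mem_prod hp (show (0 : ℝ) ≤ |a| + 1 by positivity), rfl⟩
  linarith [le_abs_self a]

theorem pole_eq {j : Fin n} (h : X.network.Adj i j) :
    S.foot.pole = -(X.network.between i j h).link.source.pole := by
  rcases X.network.adj_iff.1 h with hd | hd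
  · rw [Network.between_of_dir _ _ hd]; exact S.foot_free.1 j hd
  · rw [Network.between_of_dir_symm _ _ hd]; exact S.foot_free.2 j hd

end StripToInfinity

namespace SecondApproach

variable {d n : ℕ} (X : SecondApproach d n)

theorem nonempty_homeomorph (hn : 2 ≤ n) :
    Nonempty (X.hypersurface ≃ₜ UnboundedOrientableHyperStrip d) := by
  obtain ⟨c, h0, h1, h2, h3, h4, h5⟩ := X.exists_order
  -- The first position of the order is `ia` and the last one is `ib`: the negative tail is
  -- `stripA`, the positive one `stripB`.
  have key : ∀ e : Bool, ∃ v, ∃ S : StripToInfinity X.toCapChain (c (if e then n - 1 else 0)) v,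
      S.carrier = if e then X.stripB.carrier else X.stripA.carrier := by
    have aux : ∀ {i j : Fin n} {v : Euc d} (S : StripToInfinity X.toCapChain j v), i = j →
        ∃ v, ∃ S' : StripToInfinity X.toCapChain i v, S'.carrier = S.carrier := by
      rintro i _ v S rfl
      exact ⟨v, S, rfl⟩
    rintro (_ | _)
    · exact aux X.stripA h0
    · exact aux X.stripB h1
  choose v S hS using key
  have hA : (S false).carrier = X.stripA.carrier := hS false
  have hB : (S true).carrier = X.stripB.carrier := hS true
  have := X.network.nonempty_homeomorph_strip hn c h2 h3 h4 h5 (fun e => (S e).arm)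
    (fun _ => id) (fun e j h => (S e).pole_eq h) (fun e p hp s hs i => (S e).notMem_cap hp hs i)
    (fun e i j h p hp => (S e).inter_cylinders ⟨(S e).carrier_arm.subset hp.1,
      mem_iUnion.2 ⟨i, mem_iUnion.2 ⟨j, mem_iUnion.2 ⟨h, hp.2⟩⟩⟩⟩)
    (by
      rw [StripToInfinity.carrier_arm, StripToInfinity.carrier_arm, hA, hB]
      exact X.strips_disjoint.symm)
    (fun e B hB => by
      obtain ⟨a, ha⟩ := (S e).exists_le_of_isBounded hB
      exact ⟨a, fun p hp s _ => ha p hp s⟩)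
  rw [StripToInfinity.carrier_arm, StripToInfinity.carrier_arm, hA, hB, union_right_comm] at this
  exact this

theorem not_isBounded_hypersurface : ¬ Bornology.IsBounded X.hypersurface := fun h =>
  X.stripB.not_isBounded (h.subset subset_union_right)

end SecondApproach

theorem mainTheorem2 (d n : ℕ) (hd : 2 ≤ d) (hn : d < n) :
    (∀ X : FirstApproach d n,
      Nonempty (X.hypersurface ≃ₜ OrientableHyperStripLoop d)) ∧
    (∀ X : SecondApproach d n,
      Nonempty (X.hypersurface ≃ₜ UnboundedOrientableHyperStrip d) ∧
        ¬ Bornology.IsBounded X.hypersurface) :=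
  -- From `2 ≤ d < n` one gets at least three caps, as the closed chain requires.
  ⟨fun X => X.nonempty_homeomorph (by omega),
    fun X => ⟨X.nonempty_homeomorph (by omega), X.not_isBounded_hypersurface⟩⟩

end
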